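/- **Setting.** Let $M$ be a compact smooth $n$-manifold without boundary with a smooth nowhere vanishing $n$-form $\eta_M$ (and the orientation it defines), let $S$ be a smooth $m$-manifold, and let $\pi: Y = X\times S\to X$ be the trivial bundle over $X=\mathbb R\times M$, with $\eta = dt\wedge\eta_M$. Use local coordinates $(x^\mu)_{\mu=0,\dots,n}$ on $X$ ($x^0=t$, the others from a chart of $M$), $(y^a)$ on $S$, and $(x^\mu,y^a,y^a_\mu)$ on the first jet bundle $J^1\pi$; write $\eta=\rho\,dx^0\wedge\dots\wedge dx^n$. Let $L:J^1\pi\to\mathbb R$ be smooth, and let $$\Theta_L = L\,\eta+\frac{\partial L}{\partial y^a_\mu}(dy^a-y^a_\nu dx^\nu)\wedge\Big(\frac{\partial}{\partial x^\mu}\lrcorner\,\eta\Big),\qquad \Omega_L=-d\Theta_L .$$ Let $\mathcal C=\{\varphi^1=\dots=\varphi^k=0\}\subset J^1\pi$, where $\varphi^1,\dots,\varphi^k$ are smooth functions whose differentials are linearly independent at every point of $\mathcal C$. Let $F$ be a smooth field of $k$-dimensional subspaces $F_\gamma\subset T_s^*S$, $\gamma\in\mathcal C$, where $s$ is the projection of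 $\gamma$ to $S$; locally $F$ is spanned by a frame $A^\alpha=A^\alpha_a\,dy^a$, $\alpha=1,\dots,k$, with smooth $A^\alpha_a$ on open subsets of $\mathcal C$. Let $F^\circ_\gamma\subset T_\gamma J^1\pi$ be the annihilator of the pullback of $F_\gamma$ to $J^1\pi$. For a $\pi$-vertical vector field $V=V^a\partial/\partial y^a$ on $Y$ let $j^1V = V^a\frac{\partial}{\partial y^a}+\big(\frac{\partial V^a}{\partial x^\mu}+y^b_\mu\frac{\partial V^a}{\partial y^b}\big)\frac{\partial}{\partial y^a_\mu}$ be its first prolongation to $J^1\pi$. **Theorem.** Let $U\subset X$ be open with compact closure, and let $\phi$ be a section of $\pi$, smooth on a neighbourhood of $\overline U$, such that $j^1\phi(U)\subset\mathcal C$. The following are equivalent. (A) $\phi$ is a stationary point of the action under admissible variations: for every smooth $\pi$-vertical vector field $V$ on a neighbourhood of $\phi(\overline U)$ with $V=0$ on $\phi(\partial U)$ and $j^1V(j^1_x\phi)\in F^\circ_{j^1_x\phi}$ for all $x\in U$, one has $$\frac{d}{d\varepsilon}\Big|_{\varepsilon=0}\int_U L\big(j^1(\Phi_\varepsilon\circ\phi)\big)\,\eta=0,$$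 where $\Phi_\varepsilon$ is the local one-parameter group of $V$. (B) $\phi$ satisfies the nonholonomic Euler–Lagrange equations on $U$: for every local frame $(A^\alpha)$ of $F$ there are smooth functions $\lambda_1,\dots,\lambda_k$ on the set of those $x\in U$ for which $j^1_x\phi$ lies in the domain of the frame, such that in all coordinates as above $$\Big(\frac{\partial L}{\partial y^a}\Big)(j^1\phi)-\frac1\rho\,\frac{d}{dx^\mu}\Big(\rho\,\frac{\partial L}{\partial y^a_\mu}(j^1\phi)\Big)=\lambda_\alpha A^\alpha_a(j^1\phi),\qquad a=1,\dots,m,$$ (in coordinates with $\rho=1$ the left-hand side is the usual $\frac{\partial L}{\partial y^a}-\frac{d}{dx^\mu}\frac{\partial L}{\partial y^a_\mu}$), and moreover $\varphi^\alpha(j^1\phi)=0$ on $U$ for all $\alpha$. (C) $(j^1\phi)^*(j^1V\lrcorner\,\Omega_L)=0$ on $U$ for every smooth $\pi$-vertical vector field $V$ on $Y$ such that $j^1V(j^1_x\phi)\in F^\circ_{j^1_x\phi}$ for all $x\in U$. -/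

import Mathlib

open Bundle Set MeasureTheory Topology
open scoped Manifold ContDiff

noncomputable section

namespace NonholonomicFieldTheory

/-! ### Generalities on differential forms on a manifold without boundary -/

section Forms

variable {E : Type*} [NormedAddCommGroup E] [NormedSpace ℝ E]
  {H : Type*} [TopologicalSpace H] (I : ModelWithCorners ℝ E H)
  {N : Type*} [TopologicalSpace N] [ChartedSpace H N] {r : ℕ}

/-- The expression in the chart centred at `p` of a differential `r`-form `w` on a manifold: the
pullback of `w` by the inverse of the chart, a differential form on the model space. -/
def formInChart (w : (q : N) → TangentSpace I q [⋀^Fin r]→L[ℝ] ℝ) (p : N) (z : E) :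
    E [⋀^Fin r]→L[ℝ] ℝ :=
  (w ((extChartAt I p).symm z)).compContinuousLinearMap
    (mfderiv 𝓘(ℝ, E) I (extChartAt I p).symm z)

/-- A differential form is smooth if all its chart expressions are. -/
def IsSmoothForm (w : (q : N) → TangentSpace I q [⋀^Fin r]→L[ℝ] ℝ) : Prop :=
  ∀ p : N, ContDiffOn ℝ ∞ (formInChart I w p) (extChartAt I p).target

/-- The exterior derivative of a differential form on a manifold, computed at `p` in the chart
centred at `p`. -/
def extDerivForm (w : (q : N) → TangentSpace I q [⋀^Fin r]→L[ℝ] ℝ) (p : N) :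
    TangentSpace I p [⋀^Fin (r + 1)]→L[ℝ] ℝ :=
  (extDeriv (formInChart I w p) (extChartAt I p p)).compContinuousLinearMap
    (mfderiv I 𝓘(ℝ, E) (extChartAt I p) p)

/-- The exterior product `θ ∧ β` of a linear form and an alternating `r`-form:
`(θ ∧ β)(v₀, …, v_r) = ∑ i, (-1)^i θ(v_i) β(v₀, …, v_{i-1}, v_{i+1}, …, v_r)`. -/
def wedgeOne (θ : E →L[ℝ] ℝ) (β : E [⋀^Fin r]→L[ℝ] ℝ) : E [⋀^Fin (r + 1)]→L[ℝ] ℝ :=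
  ContinuousAlternatingMap.alternatizeUncurryFin (θ.smulRight β)

end Forms

/-! ### The bundle `π : Y = X × S → X = ℝ × M` and its first jet bundle -/

/-- The model space of `X = ℝ × M`. -/
abbrev EX (n : ℕ) : Type := ℝ × EuclideanSpace ℝ (Fin n)

/-- The model space of `S`. -/
abbrev ES (m : ℕ) : Type := EuclideanSpace ℝ (Fin m)

/-- The model space of the first jet bundle, with coordinates `(x^μ, y^a, y^a_μ)`. -/
abbrev EJ (n m : ℕ) : Type := (EX n × ES m) × (EX n →L[ℝ] ES m)

/-- The model of `X = ℝ × M`. -/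
abbrev IX (n : ℕ) : ModelWithCorners ℝ (EX n) (ModelProd ℝ (EuclideanSpace ℝ (Fin n))) :=
  𝓘(ℝ, ℝ).prod (𝓡 n)

/-- The model of `Y = X × S`. -/
abbrev IY (n m : ℕ) : ModelWithCorners ℝ (EX n × ES m)
    (ModelProd (ModelProd ℝ (EuclideanSpace ℝ (Fin n))) (EuclideanSpace ℝ (Fin m))) :=
  (IX n).prod (𝓡 m)

/-- The model of the first jet bundle. -/
abbrev IJ (n m : ℕ) : ModelWithCorners ℝ (EJ n m)
    (ModelProd (ModelProd (ModelProd ℝ (EuclideanSpace ℝ (Fin n))) (EuclideanSpace ℝ (Fin m)))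
      (EX n →L[ℝ] ES m)) :=
  (IY n m).prod 𝓘(ℝ, EX n →L[ℝ] ES m)

/-- The coordinate vectors `∂/∂x^μ`, `μ = 0, …, n`, of `ℝ × ℝⁿ` (`μ = 0` is time). -/
def dX {n : ℕ} : Fin (n + 1) → EX n :=
  Fin.cons (1, 0) fun i => (0, EuclideanSpace.single i 1)

/-- The coordinate one-forms `dx^μ`, `μ = 0, …, n`, of `ℝ × ℝⁿ`. -/
def dXdual {n : ℕ} : Fin (n + 1) → (EX n →L[ℝ] ℝ) :=
  Fin.cons (ContinuousLinearMap.fst ℝ ℝ (EuclideanSpace ℝ (Fin n))) fun i =>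
    (EuclideanSpace.proj i).comp (ContinuousLinearMap.snd ℝ ℝ (EuclideanSpace ℝ (Fin n)))

section Jets

variable (n m : ℕ)
  (M : Type*) [TopologicalSpace M] [ChartedSpace (EuclideanSpace ℝ (Fin n)) M]
  [IsManifold (𝓡 n) ∞ M]
  (S : Type*) [TopologicalSpace S] [ChartedSpace (EuclideanSpace ℝ (Fin m)) S]
  [IsManifold (𝓡 m) ∞ S]

/-- The pullback of the tangent bundle `TX` to `Y = X × S`. -/
abbrev TXY : (ℝ × M) × S → Type :=
  (ContMDiffMap.fst : C^∞⟮IY n m, (ℝ × M) × S; IX n, ℝ × M⟯) *ᵖ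
    (TangentSpace (IX n) : ℝ × M → Type)

/-- The pullback of the tangent bundle `TS` to `Y = X × S`. -/
abbrev TSY : (ℝ × M) × S → Type :=
  (ContMDiffMap.snd : C^∞⟮IY n m, (ℝ × M) × S; 𝓡 m, S⟯) *ᵖ
    (TangentSpace (𝓡 m) : S → Type)

instance instAddCommGroupTXY (y : (ℝ × M) × S) : AddCommGroup (TXY n m M S y) :=
  inferInstanceAs (AddCommGroup (TangentSpace (IX n) y.1))

instance instAddCommGroupTSY (y : (ℝ × M) × S) : AddCommGroup (TSY n m M S y) :=
  inferInstanceAs (AddCommGroup (TangentSpace (𝓡 m) y.2))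

instance instIsTopologicalAddGroupTSY (y : (ℝ × M) × S) :
    IsTopologicalAddGroup (TSY n m M S y) :=
  inferInstanceAs (IsTopologicalAddGroup (TangentSpace (𝓡 m) y.2))

instance instContinuousSMulTSY (y : (ℝ × M) × S) : ContinuousSMul ℝ (TSY n m M S y) :=
  inferInstanceAs (ContinuousSMul ℝ (TangentSpace (𝓡 m) y.2))

/-- The first jet bundle `J¹π` of the trivial bundle `π : Y = X × S → X`, as a smooth manifold.
A one-jet `j¹_x φ` with value `y = (x, s)` is the linear map `T_x X → T_s S` given by the derivative
at `x` of the `S`-component of `φ`; hence `J¹π` is the total space of the smooth vector bundle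
`Hom(pr₁^* TX, pr₂^* TS)` over `Y`. -/
abbrev J1 : Type _ :=
  TotalSpace (EX n →L[ℝ] ES m) (fun y => TXY n m M S y →L[ℝ] TSY n m M S y)

end Jets

section Theory

variable {n m : ℕ}
  {M : Type*} [TopologicalSpace M] [ChartedSpace (EuclideanSpace ℝ (Fin n)) M]
  [IsManifold (𝓡 n) ∞ M]
  {S : Type*} [TopologicalSpace S] [ChartedSpace (EuclideanSpace ℝ (Fin m)) S]
  [IsManifold (𝓡 m) ∞ S]

/-- The first jet prolongation `j¹φ : X → J¹π` of the section `φ : x ↦ (x, f x)` of `π`. -/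
def jet (f : ℝ × M → S) (x : ℝ × M) : J1 n m M S :=
  ⟨(x, f x), (mfderiv (IX n) (𝓡 m) f x : TangentSpace (IX n) x →L[ℝ] TangentSpace (𝓡 m) (f x))⟩

/-! ### Volume form, volume measure, action -/

/-- The form `η = dt ∧ η_M` on `X = ℝ × M`. -/
def volForm (ηM : (p : M) → TangentSpace (𝓡 n) p [⋀^Fin n]→L[ℝ] ℝ) (x : ℝ × M) :
    TangentSpace (IX n) x [⋀^Fin (n + 1)]→L[ℝ] ℝ :=
  wedgeOne (E := EX n) (ContinuousLinearMap.fst ℝ ℝ (EuclideanSpace ℝ (Fin n)))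
    (ContinuousAlternatingMap.compContinuousLinearMap (ηM x.2)
      (ContinuousLinearMap.snd ℝ ℝ (EuclideanSpace ℝ (Fin n))))

/-- The density `ρ` of `η_M` in a chart `e` of `M`: in the coordinates of `e` one has
`η_M = ρ dx¹ ∧ ⋯ ∧ dxⁿ`. -/
def density (ηM : (p : M) → TangentSpace (𝓡 n) p [⋀^Fin n]→L[ℝ] ℝ)
    (e : OpenPartialHomeomorph M (EuclideanSpace ℝ (Fin n))) (z : EuclideanSpace ℝ (Fin n)) : ℝ :=
  ηM (e.symm z) fun i => mfderiv (𝓡 n) (𝓡 n) e.symm z (EuclideanSpace.single i (1 : ℝ))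

/-- The measure on `M` defined by the volume form `η_M` (and the orientation for which `η_M` is
positive): on the domain of a chart it has density `|ρ|` with respect to Lebesgue measure in the
chart. It is the supremum of its restrictions to the chart domains. -/
def volMeasure [MeasurableSpace M] (ηM : (p : M) → TangentSpace (𝓡 n) p [⋀^Fin n]→L[ℝ] ℝ) :
    Measure M :=
  ⨆ p : M, Measure.map (chartAt (EuclideanSpace ℝ (Fin n)) p).symm
    ((volume.restrict (chartAt (EuclideanSpace ℝ (Fin n)) p).target).withDensity fun z =>
      ENNReal.ofReal |density ηM (chartAt (EuclideanSpace ℝ (Fin n)) p) z|)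

/-- The action `∫_U L(j¹φ) η`. As `η = dt ∧ η_M`, the measure on `X = ℝ × M` defined by `η` is the
product of Lebesgue measure and the measure defined by `η_M`. -/
def action [MeasurableSpace M] (ηM : (p : M) → TangentSpace (𝓡 n) p [⋀^Fin n]→L[ℝ] ℝ)
    (L : J1 n m M S → ℝ) (U : Set (ℝ × M)) (f : ℝ × M → S) : ℝ :=
  ∫ x in U, L (jet f x) ∂((volume : Measure ℝ).prod (volMeasure ηM))

/-! ### Vertical vector fields, their flows and prolongations -/

/-- `V` is a smooth `π`-vertical vector field on the subset `N` of `Y`. -/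
def IsVerticalOn (V : (y : (ℝ × M) × S) → TangentSpace (IY n m) y)
    (N : Set ((ℝ × M) × S)) : Prop :=
  ContMDiffOn (IY n m) (IY n m).tangent ∞
      (fun y => (⟨y, V y⟩ : TangentBundle (IY n m) ((ℝ × M) × S))) N ∧
    ∀ y ∈ N, mfderiv (IY n m) (IX n) (Prod.fst : (ℝ × M) × S → ℝ × M) y (V y) = 0

/-- `Φ` is the local one-parameter group of `V`, defined for `|ε| < δ` on the open subset `N'`
of `Y`, and with values in the domain `N` of `V`. -/
def IsLocalFlow (V : (y : (ℝ × M) × S) → TangentSpace (IY n m) y) (N : Set ((ℝ × M) × S))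
    (δ : ℝ) (N' : Set ((ℝ × M) × S)) (Φ : ℝ → (ℝ × M) × S → (ℝ × M) × S) : Prop :=
  0 < δ ∧ IsOpen N' ∧
    ContMDiffOn (𝓘(ℝ, ℝ).prod (IY n m)) (IY n m) ∞ (fun q : ℝ × ((ℝ × M) × S) => Φ q.1 q.2)
      (Ioo (-δ) δ ×ˢ N') ∧
    ∀ y ∈ N', Φ 0 y = y ∧ (∀ ε ∈ Ioo (-δ) δ, Φ ε y ∈ N) ∧
      IsMIntegralCurveOn (fun ε => Φ ε y) V (Ioo (-δ) δ)

/-- The first prolongation `j¹V`, a vector field on `J¹π`, of a `π`-vertical vector field `V` on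
`Y`: in coordinates, `j¹V = V^a ∂/∂y^a + (∂V^a/∂x^μ + y^b_μ ∂V^a/∂y^b) ∂/∂y^a_μ`.
The value at `γ` is computed in the chart of `J¹π` centred at `γ`, through which `T_γ J¹π` is
identified with the model space. -/
def prolong (V : (y : (ℝ × M) × S) → TangentSpace (IY n m) y) (γ : J1 n m M S) :
    TangentSpace (IJ n m) γ :=
  let DV : EX n × ES m →L[ℝ] ES m :=
    mfderiv (IY n m) 𝓘(ℝ, ES m) (fun y : (ℝ × M) × S =>
      (mfderiv (𝓡 m) 𝓘(ℝ, ES m) (extChartAt (𝓡 m) γ.proj.2) y.2 (V y : EX n × ES m).2 : ES m))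
      γ.proj
  let A : EX n →L[ℝ] ES m := γ.snd
  let W : EJ n m :=
    (V γ.proj, DV ∘L (ContinuousLinearMap.id ℝ (EX n)).prod A)
  W

/-! ### The Cartan form -/

/-- The fibre derivative of the Lagrangian at the jet `γ`, a linear form on `Hom(T_x X, T_s S)`:
in coordinates, `B ↦ ∂L/∂y^a_μ B^a_μ`. -/
def fibreDeriv (L : J1 n m M S → ℝ) (γ : J1 n m M S) : (EX n →L[ℝ] ES m) →L[ℝ] ℝ :=
  fderiv ℝ (fun B : EX n →L[ℝ] ES m => L ⟨γ.proj, B⟩) γ.snd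

/-- The Cartan form `Θ_L = L η + ∂L/∂y^a_μ (dy^a - y^a_ν dx^ν) ∧ (∂/∂x^μ ⌟ η)`. -/
def cartanForm (ηM : (p : M) → TangentSpace (𝓡 n) p [⋀^Fin n]→L[ℝ] ℝ) (L : J1 n m M S → ℝ)
    (γ : J1 n m M S) : TangentSpace (IJ n m) γ [⋀^Fin (n + 1)]→L[ℝ] ℝ :=
  let η : EX n [⋀^Fin (n + 1)]→L[ℝ] ℝ := volForm ηM γ.proj.1
  -- the tangent maps at `γ` of the projections of `J¹π` onto `X` and onto `S`
  let TX : EJ n m →L[ℝ] EX n :=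
    mfderiv (IJ n m) (IX n) (fun γ' : J1 n m M S => γ'.proj.1) γ
  let TS : EJ n m →L[ℝ] ES m :=
    mfderiv (IJ n m) (𝓡 m) (fun γ' : J1 n m M S => γ'.proj.2) γ
  let A : EX n →L[ℝ] ES m := γ.snd
  -- the contact form `dy^a - y^a_ν dx^ν`
  let θ : EJ n m →L[ℝ] ES m := TS - A ∘L TX
  let Θ : EJ n m [⋀^Fin (n + 1)]→L[ℝ] ℝ :=
    L γ • η.compContinuousLinearMap TX +
      ∑ μ : Fin (n + 1), wedgeOne
        (fibreDeriv L γ ∘L ContinuousLinearMap.smulRightL ℝ (EX n) (ES m) (dXdual μ) ∘L θ)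
        ((η.curryLeft (dX μ)).compContinuousLinearMap TX)
  Θ

/-- The form `Ω_L = -dΘ_L` on `J¹π`. -/
def omegaForm (ηM : (p : M) → TangentSpace (𝓡 n) p [⋀^Fin n]→L[ℝ] ℝ) (L : J1 n m M S → ℝ)
    (γ : J1 n m M S) : TangentSpace (IJ n m) γ [⋀^Fin (n + 2)]→L[ℝ] ℝ :=
  -extDerivForm (IJ n m) (cartanForm ηM L) γ

/-- The form `(j¹φ)^*(W ⌟ Ω_L)` on `X`, for a vector field `W` on `J¹π`. -/
def pullbackContraction (ηM : (p : M) → TangentSpace (𝓡 n) p [⋀^Fin n]→L[ℝ] ℝ)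
    (L : J1 n m M S → ℝ) (f : ℝ × M → S) (W : (γ : J1 n m M S) → TangentSpace (IJ n m) γ)
    (x : ℝ × M) : TangentSpace (IX n) x [⋀^Fin (n + 1)]→L[ℝ] ℝ :=
  let Ω : EJ n m [⋀^Fin (n + 2)]→L[ℝ] ℝ := omegaForm ηM L (jet f x)
  (Ω.curryLeft (W (jet f x))).compContinuousLinearMap
    (mfderiv (IX n) (IJ n m) (jet f : ℝ × M → J1 n m M S) x)

/-! ### The Euler–Lagrange expression in coordinates -/

/-- The Lagrangian in the coordinates `(x^μ, y^a, y^a_μ)` of `J¹π` induced by a chart `e` of `M`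
(together with the time coordinate) and a chart `e'` of `S`. -/
def lagrangianInCharts (L : J1 n m M S → ℝ)
    (e : OpenPartialHomeomorph M (EuclideanSpace ℝ (Fin n)))
    (e' : OpenPartialHomeomorph S (EuclideanSpace ℝ (Fin m)))
    (z : EX n) (y : ES m) (A : EX n →L[ℝ] ES m) : ℝ :=
  let Dx : EX n →L[ℝ] EX n :=
    mfderiv (IX n) 𝓘(ℝ, EX n) (fun x : ℝ × M => ((x.1, e x.2) : EX n)) (z.1, e.symm z.2)
  let Dy : ES m →L[ℝ] ES m := mfderiv (𝓡 m) (𝓡 m) e'.symm y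
  L ⟨((z.1, e.symm z.2), e'.symm y), Dy ∘L A ∘L Dx⟩

/-- The `S`-component of the section `φ` in the coordinates given by `e` and `e'`. -/
def fieldInCharts (f : ℝ × M → S) (e : OpenPartialHomeomorph M (EuclideanSpace ℝ (Fin n)))
    (e' : OpenPartialHomeomorph S (EuclideanSpace ℝ (Fin m))) (z : EX n) : ES m :=
  e' (f (z.1, e.symm z.2))

/-- The component `EL_a` at `x`, along `φ`, of the Euler–Lagrange expression in the coordinates
given by `e` and `e'`:
`EL_a = ∂L/∂y^a (j¹φ) - ρ⁻¹ d/dx^μ (ρ ∂L/∂y^a_μ (j¹φ))`, where `η = ρ dx⁰ ∧ ⋯ ∧ dxⁿ`.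
In coordinates with `η = dx⁰ ∧ ⋯ ∧ dxⁿ` this is `∂L/∂y^a - d/dx^μ (∂L/∂y^a_μ)`. -/
def eulerLagrange (ηM : (p : M) → TangentSpace (𝓡 n) p [⋀^Fin n]→L[ℝ] ℝ) (L : J1 n m M S → ℝ)
    (f : ℝ × M → S) (e : OpenPartialHomeomorph M (EuclideanSpace ℝ (Fin n)))
    (e' : OpenPartialHomeomorph S (EuclideanSpace ℝ (Fin m))) (x : ℝ × M) (a : Fin m) : ℝ :=
  let ℓ := lagrangianInCharts L e e'
  let φ := fieldInCharts f e e'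
  let z : EX n := (x.1, e x.2)
  fderiv ℝ (fun y => ℓ z y (fderiv ℝ φ z)) (φ z) (EuclideanSpace.single a 1) -
    (density ηM e z.2)⁻¹ * ∑ μ : Fin (n + 1),
      fderiv ℝ (fun z' : EX n => density ηM e z'.2 *
        fderiv ℝ (ℓ z' (φ z')) (fderiv ℝ φ z')
          ((dXdual μ).smulRight (EuclideanSpace.single a (1 : ℝ)))) z (dX μ)

/-! ### Constraints and reaction forces -/

/-- The differential at `γ` of a real function on `J¹π`. -/
def differential (g : J1 n m M S → ℝ) (γ : J1 n m M S) : TangentSpace (IJ n m) γ →L[ℝ] ℝ :=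
  mfderiv (IJ n m) 𝓘(ℝ, ℝ) g γ

/-- Functionally independent smooth constraint functions `φ^1, …, φ^k` on `J¹π`; their common zero
set is the constraint submanifold, of codimension `k`. -/
structure Constraint (n m : ℕ)
    (M : Type*) [TopologicalSpace M] [ChartedSpace (EuclideanSpace ℝ (Fin n)) M]
    [IsManifold (𝓡 n) ∞ M]
    (S : Type*) [TopologicalSpace S] [ChartedSpace (EuclideanSpace ℝ (Fin m)) S]
    [IsManifold (𝓡 m) ∞ S] (k : ℕ) where
  /-- The constraint functions. -/
  fn : Fin k → J1 n m M S → ℝ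
  smooth : ∀ α, ContMDiff (IJ n m) 𝓘(ℝ, ℝ) ∞ (fn α)
  independent : ∀ γ, (∀ α, fn α γ = 0) →
    LinearIndependent ℝ (fun α => differential (fn α) γ)

/-- The constraint submanifold `C ⊂ J¹π`. -/
def Constraint.carrier {k : ℕ} (C : Constraint n m M S k) : Set (J1 n m M S) :=
  {γ | ∀ α, C.fn α γ = 0}

/-- `A^1, …, A^k : C ∩ W → T^*S` are smooth maps over `S` which form at each `γ ∈ C ∩ W` a basis of
the subspace `F γ` of `T^*_s S`, `s` being the projection of `γ` to `S`. -/
def IsFrameOn {k : ℕ} (C : Set (J1 n m M S))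
    (F : (γ : J1 n m M S) → Submodule ℝ (TangentSpace (𝓡 m) γ.proj.2 →L[ℝ] ℝ))
    (W : Set (J1 n m M S))
    (A : Fin k → (γ : J1 n m M S) → (TangentSpace (𝓡 m) γ.proj.2 →L[ℝ] ℝ)) : Prop :=
  (∀ α, ContMDiffOn (IJ n m) ((𝓡 m).prod 𝓘(ℝ, ES m →L[ℝ] ℝ)) ∞
    (fun γ => (⟨γ.proj.2, A α γ⟩ : TotalSpace (ES m →L[ℝ] ℝ)
      (fun s : S => TangentSpace (𝓡 m) s →L[ℝ] Trivial S ℝ s))) (C ∩ W)) ∧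
  ∀ γ ∈ C ∩ W, LinearIndependent ℝ (fun α => A α γ) ∧
    Submodule.span ℝ (Set.range fun α => A α γ) = F γ

/-- A bundle of reaction forces along `C`: a smooth field `γ ↦ F γ ⊂ T^*_s S`, `γ ∈ C`, of
`k`-dimensional subspaces, `s` being the projection of `γ` to `S`. (The values outside `C` are
irrelevant.) -/
structure ReactionForces {k : ℕ} (C : Constraint n m M S k) where
  /-- The fibres. -/
  fibre : (γ : J1 n m M S) → Submodule ℝ (TangentSpace (𝓡 m) γ.proj.2 →L[ℝ] ℝ)
  exists_frame : ∀ γ ∈ C.carrier, ∃ W : Set (J1 n m M S), IsOpen W ∧ γ ∈ W ∧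
    ∃ A : Fin k → (γ : J1 n m M S) → (TangentSpace (𝓡 m) γ.proj.2 →L[ℝ] ℝ),
      IsFrameOn C.carrier fibre W A

/-- The annihilator `F°_γ ⊂ T_γ J¹π`, the elements of `F_γ ⊂ T^*_s S` being pulled back to `J¹π`. -/
def ReactionForces.annihilator {k : ℕ} {C : Constraint n m M S k} (F : ReactionForces C)
    (γ : J1 n m M S) : Set (TangentSpace (IJ n m) γ) :=
  {v | ∀ α ∈ F.fibre γ, α (mfderiv (IJ n m) (𝓡 m) (fun γ' : J1 n m M S => γ'.proj.2) γ v) = 0}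

/-! ### The three conditions -/

/-- The section `φ : x ↦ (x, f x)` is a stationary point of the action over `U` under admissible
variations: for each smooth vertical vector field `V` on a neighbourhood of `φ(closure U)` which
vanishes on `φ(∂U)` and satisfies `j¹V ∈ F°` along `j¹φ(U)`, the derivative at `ε = 0` of the action
of `Φ_ε ∘ φ` is zero, `Φ` being the local one-parameter group of `V`. -/
def IsStationary [MeasurableSpace M] (ηM : (p : M) → TangentSpace (𝓡 n) p [⋀^Fin n]→L[ℝ] ℝ)
    (L : J1 n m M S → ℝ) {k : ℕ} {C : Constraint n m M S k} (F : ReactionForces C)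
    (U : Set (ℝ × M)) (f : ℝ × M → S) : Prop :=
  ∀ (N : Set ((ℝ × M) × S)) (V : (y : (ℝ × M) × S) → TangentSpace (IY n m) y),
    IsOpen N → (∀ x ∈ closure U, (x, f x) ∈ N) → IsVerticalOn V N →
    (∀ x ∈ frontier U, V (x, f x) = 0) →
    (∀ x ∈ U, prolong V (jet f x) ∈ F.annihilator (jet f x)) →
    ∀ (δ : ℝ) (N' : Set ((ℝ × M) × S)) (Φ : ℝ → (ℝ × M) × S → (ℝ × M) × S),
      IsLocalFlow V N δ N' Φ → (∀ x ∈ closure U, (x, f x) ∈ N') →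
      HasDerivAt (fun ε => action ηM L U (fun x => (Φ ε (x, f x)).2)) 0 0

/-- The nonholonomic Euler–Lagrange equations on `U`: for each local frame `A^1, …, A^k` of `F`
there are smooth multipliers `λ_1, …, λ_k` such that in all charts `EL_a = λ_α A^α_a(j¹φ)`, where
`A^α_a = A^α(∂/∂y^a)`; moreover `φ^α(j¹φ) = 0`. -/
def SatisfiesEL (ηM : (p : M) → TangentSpace (𝓡 n) p [⋀^Fin n]→L[ℝ] ℝ)
    (L : J1 n m M S → ℝ) {k : ℕ} {C : Constraint n m M S k} (F : ReactionForces C)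
    (U : Set (ℝ × M)) (f : ℝ × M → S) : Prop :=
  (∀ (W : Set (J1 n m M S))
      (A : Fin k → (γ : J1 n m M S) → (TangentSpace (𝓡 m) γ.proj.2 →L[ℝ] ℝ)),
    IsOpen W → IsFrameOn C.carrier F.fibre W A →
    ∃ lam : Fin k → ℝ × M → ℝ,
      (∀ α, ContMDiffOn (IX n) 𝓘(ℝ, ℝ) ∞ (lam α) {x ∈ U | jet f x ∈ W}) ∧
      ∀ e ∈ IsManifold.maximalAtlas (𝓡 n) ∞ M, ∀ e' ∈ IsManifold.maximalAtlas (𝓡 m) ∞ S,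
        ∀ x ∈ U, jet f x ∈ W → x.2 ∈ e.source → f x ∈ e'.source → ∀ a : Fin m,
          eulerLagrange ηM L f e e' x a = ∑ α, lam α x *
            A α (jet f x) (mfderiv (𝓡 m) (𝓡 m) e'.symm (e' (f x))
              (EuclideanSpace.single a (1 : ℝ)))) ∧
  ∀ x ∈ U, ∀ α, C.fn α (jet f x) = 0

/-- `(j¹φ)^*(j¹V ⌟ Ω_L) = 0` on `U` for all smooth vertical vector fields `V` on `Y` with
`j¹V ∈ F°` along `j¹φ(U)`. -/
def SatisfiesIntrinsic (ηM : (p : M) → TangentSpace (𝓡 n) p [⋀^Fin n]→L[ℝ] ℝ)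
    (L : J1 n m M S → ℝ) {k : ℕ} {C : Constraint n m M S k} (F : ReactionForces C)
    (U : Set (ℝ × M)) (f : ℝ × M → S) : Prop :=
  ∀ V : (y : (ℝ × M) × S) → TangentSpace (IY n m) y, IsVerticalOn V univ →
    (∀ x ∈ U, prolong V (jet f x) ∈ F.annihilator (jet f x)) →
    ∀ x ∈ U, pullbackContraction ηM L f (prolong V) x = 0

end Theory

end NonholonomicFieldTheory

end

/-!
At a point `x` of `U` let `E_x(w) = (∂L/∂y^a - ρ⁻¹ d/dx^μ (ρ ∂L/∂y^a_μ)) w^a` be the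
Euler–Lagrange covector of the section, a linear form on the tangent space of `S` at `f x`
(`elCovectorAt`). Each of the three conditions says that for all `x ∈ U` the form `E_x` vanishes on
the tangent vectors annihilated by the reaction forces (`AnnihilatesAdmissible`).

*Stationarity.* The action is differentiated under the integral sign (`hasDerivAt_action`), and the
derivative is integrated by parts: for a variation vanishing on `∂U` it is the integral over `U` of
`E_x` applied to the variation. Nothing is assumed about `∂U`, so Stokes' theorem is not available.
Instead, a `C¹` function `g` vanishing on `∂U` is truncated near its zeros, which gives functions
with compact support in `U`; as the derivative of `g` is zero almost everywhere on the zero set of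
`g`, dominated convergence shows that the partial derivatives of `g` have integral zero over `U`
(`setIntegral_fderiv_eq_zero`). This gives the first variation formula in coordinates
(`model_firstVariation`, `firstVariation_chart`), and a partition of unity gives its global
consequence (`integral_lagrangianVariation_eq_zero`).

*Covariance.* That the coordinate expressions of `E_x` agree (`elForm_coordChange`) needs no
computation of second derivatives: integrated against bump functions, each of them yields the first
variation of the action along one and the same family of sections.

*Contraction with `Ω_L`.* In coordinates, `(j¹φ)^*(W ⌟ Ω_L) = -E_x(w) η` for each vector `W`
projecting to zero in `X` and to `w` in `S` (`pullbackContraction_apply_dX`): the contact form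
vanishes along `j¹φ`, so in `dΘ_L` only the derivative of the contact form itself remains, and it
cancels the component of `W` along the fibres of `J¹π → Y` (`extDeriv_modelCartan`).

*Test fields.* Both the stationarity condition and the condition on `Ω_L` imply
`AnnihilatesAdmissible` by means of the same vector fields. A vector annihilated by `F` at a point
extends to a smooth field of such vectors along the section, by subtraction of its components with
respect to a smooth right inverse of a local frame (`exists_admissible_extension`); multiplied by
cut-off functions on `X` and on `S` it becomes a global vertical field (`testField`), whose flow
near the section consists of translations in a chart (`exists_isLocalFlow_testField`).

*Multipliers.* A form vanishing on the common kernel of a frame is a combination of the frame, and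
the right inverse shows that the coefficients are smooth (`exists_multipliers`).
-/

set_option linter.unusedSectionVars false

noncomputable section

namespace NonholonomicFieldTheory

/-! ### Smooth charts -/

section SmoothCharts

variable {E : Type*} [NormedAddCommGroup E] [NormedSpace ℝ E]
  {H : Type*} [TopologicalSpace H] {I : ModelWithCorners ℝ E H}
  {N : Type*} [TopologicalSpace N] [ChartedSpace H N]

/-- A chart with values in the model vector space which is smooth together with its inverse. -/
structure IsSmoothChart (I : ModelWithCorners ℝ E H) (c : OpenPartialHomeomorph N E) : Prop where
  smooth : ContMDiffOn I 𝓘(ℝ, E) ∞ c c.source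
  smooth_symm : ContMDiffOn 𝓘(ℝ, E) I ∞ c.symm c.target

namespace IsSmoothChart

variable {c : OpenPartialHomeomorph N E}

theorem contMDiffAt (hc : IsSmoothChart I c) {x : N} (hx : x ∈ c.source) :
    ContMDiffAt I 𝓘(ℝ, E) ∞ c x :=
  hc.smooth.contMDiffAt (c.open_source.mem_nhds hx)

theorem contMDiffAt_symm (hc : IsSmoothChart I c) {z : E} (hz : z ∈ c.target) :
    ContMDiffAt 𝓘(ℝ, E) I ∞ c.symm z :=
  hc.smooth_symm.contMDiffAt (c.open_target.mem_nhds hz)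

theorem mdifferentiableAt (hc : IsSmoothChart I c) {x : N} (hx : x ∈ c.source) :
    MDifferentiableAt I 𝓘(ℝ, E) c x :=
  (hc.contMDiffAt hx).mdifferentiableAt (by simp)

theorem mdifferentiableAt_symm (hc : IsSmoothChart I c) {z : E} (hz : z ∈ c.target) :
    MDifferentiableAt 𝓘(ℝ, E) I c.symm z :=
  (hc.contMDiffAt_symm hz).mdifferentiableAt (by simp)

theorem mfderiv_comp_symm (hc : IsSmoothChart I c) {z : E} (hz : z ∈ c.target) (v : E) :
    (mfderiv I 𝓘(ℝ, E) c (c.symm z) (mfderiv 𝓘(ℝ, E) I c.symm z v) : E) = v := by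
  have h1 : mfderiv 𝓘(ℝ, E) 𝓘(ℝ, E) (c ∘ c.symm) z
      = (mfderiv I 𝓘(ℝ, E) c (c.symm z)).comp (mfderiv 𝓘(ℝ, E) I c.symm z) :=
    mfderiv_comp z (hc.mdifferentiableAt (c.map_target hz)) (hc.mdifferentiableAt_symm hz)
  have h2 : (c ∘ c.symm) =ᶠ[𝓝 z] id := by
    filter_upwards [c.open_target.mem_nhds hz] with w hw using c.right_inv hw
  rw [h2.mfderiv_eq, mfderiv_id] at h1
  exact (congrArg (fun T : E →L[ℝ] E => T v) h1).symm

theorem mfderiv_symm_comp (hc : IsSmoothChart I c) {x : N} (hx : x ∈ c.source) (v : E) :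
    (mfderiv 𝓘(ℝ, E) I c.symm (c x) (mfderiv I 𝓘(ℝ, E) c x v) : E) = v := by
  have h1 : mfderiv I I (c.symm ∘ c) x
      = (mfderiv 𝓘(ℝ, E) I c.symm (c x)).comp (mfderiv I 𝓘(ℝ, E) c x) :=
    mfderiv_comp x (hc.mdifferentiableAt_symm (c.map_source hx)) (hc.mdifferentiableAt hx)
  have h2 : (c.symm ∘ c) =ᶠ[𝓝 x] id := by
    filter_upwards [c.open_source.mem_nhds hx] with w hw using c.left_inv hw
  rw [h2.mfderiv_eq, mfderiv_id] at h1
  exact (congrArg (fun T : E →L[ℝ] E => T v) h1).symm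

/-- The derivative of a coordinate change. -/
theorem fderiv_coordChange (hc : IsSmoothChart I c) {c' : OpenPartialHomeomorph N E}
    (hc' : IsSmoothChart I c') {z : E} (hz : z ∈ c.target) (hz' : c.symm z ∈ c'.source) (v : E) :
    fderiv ℝ (c' ∘ c.symm) z v
      = (mfderiv I 𝓘(ℝ, E) c' (c.symm z) (mfderiv 𝓘(ℝ, E) I c.symm z v) : E) := by
  have h1 : mfderiv 𝓘(ℝ, E) 𝓘(ℝ, E) (c' ∘ c.symm) z
      = (mfderiv I 𝓘(ℝ, E) c' (c.symm z)).comp (mfderiv 𝓘(ℝ, E) I c.symm z) :=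
    mfderiv_comp z (hc'.mdifferentiableAt hz') (hc.mdifferentiableAt_symm hz)
  rw [mfderiv_eq_fderiv] at h1
  exact (congrArg (fun T : E →L[ℝ] E => T v) h1)

theorem contDiffAt_coordChange (hc : IsSmoothChart I c) {c' : OpenPartialHomeomorph N E}
    (hc' : IsSmoothChart I c') {z : E} (hz : z ∈ c.target) (hz' : c.symm z ∈ c'.source) :
    ContDiffAt ℝ ∞ (c' ∘ c.symm) z :=
  ((hc'.contMDiffAt hz').comp z (hc.contMDiffAt_symm hz)).contDiffAt

end IsSmoothChart

theorem isSmoothChart_of_mem_maximalAtlas {d : ℕ} {N : Type*} [TopologicalSpace N]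
    [ChartedSpace (EuclideanSpace ℝ (Fin d)) N]
    {e : OpenPartialHomeomorph N (EuclideanSpace ℝ (Fin d))}
    (he : e ∈ IsManifold.maximalAtlas (𝓡 d) ∞ N) : IsSmoothChart (𝓡 d) e :=
  ⟨contMDiffOn_of_mem_maximalAtlas he, contMDiffOn_symm_of_mem_maximalAtlas he⟩

end SmoothCharts

/-! ### Product charts of `X = ℝ × M` -/

section XCharts

variable {n : ℕ} {M : Type*} [TopologicalSpace M] [ChartedSpace (EuclideanSpace ℝ (Fin n)) M]

/-- The chart of `X = ℝ × M` given by the time coordinate and a chart of `M`. -/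
def xChart (e : OpenPartialHomeomorph M (EuclideanSpace ℝ (Fin n))) :
    OpenPartialHomeomorph (ℝ × M) (EX n) :=
  (OpenPartialHomeomorph.refl ℝ).prod e

variable {e : OpenPartialHomeomorph M (EuclideanSpace ℝ (Fin n))}

@[simp] theorem xChart_apply (x : ℝ × M) : xChart e x = (x.1, e x.2) := rfl
@[simp] theorem xChart_symm_apply (z : EX n) : (xChart e).symm z = (z.1, e.symm z.2) := rfl
@[simp] theorem mem_xChart_source {x : ℝ × M} : x ∈ (xChart e).source ↔ x.2 ∈ e.source := by
  simp [xChart]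
@[simp] theorem mem_xChart_target {z : EX n} : z ∈ (xChart e).target ↔ z.2 ∈ e.target := by
  simp [xChart]

theorem isSmoothChart_xChart (he : IsSmoothChart (𝓡 n) e) : IsSmoothChart (IX n) (xChart e) where
  smooth := by
    rw [modelWithCornersSelf_prod, ← chartedSpaceSelf_prod]
    exact contMDiffOn_fst.prodMk
      (he.smooth.comp contMDiffOn_snd fun x hx => mem_xChart_source.1 hx)
  smooth_symm := by
    have h2 : ContMDiffOn 𝓘(ℝ, EX n) (𝓡 n) ∞ (fun z : EX n => e.symm z.2) (xChart e).target :=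
      he.smooth_symm.comp (contDiff_snd.contMDiff.contMDiffOn) fun x hx => mem_xChart_target.1 hx
    exact (contDiff_fst.contMDiff.contMDiffOn).prodMk h2

end XCharts

/-! ### Charts of the first jet bundle -/

section JetCharts
variable {n m : ℕ}
  {M : Type*} [TopologicalSpace M] [ChartedSpace (EuclideanSpace ℝ (Fin n)) M]
  [IsManifold (𝓡 n) ∞ M]
  {S : Type*} [TopologicalSpace S] [ChartedSpace (EuclideanSpace ℝ (Fin m)) S]
  [IsManifold (𝓡 m) ∞ S]

/-- The inverse of the chart of `J¹π` with coordinates `(x^μ, y^a, y^a_μ)` induced by a chart `e`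
of `M` and a chart `e'` of `S`. -/
def jetParam (e : OpenPartialHomeomorph M (EuclideanSpace ℝ (Fin n)))
    (e' : OpenPartialHomeomorph S (EuclideanSpace ℝ (Fin m))) (q : EJ n m) : J1 n m M S :=
  ⟨((xChart e).symm q.1.1, e'.symm q.1.2),
    ((mfderiv (𝓡 m) (𝓡 m) e'.symm q.1.2 : ES m →L[ℝ] ES m) ∘L q.2 ∘L
      (mfderiv (IX n) 𝓘(ℝ, EX n) (xChart e) ((xChart e).symm q.1.1) : EX n →L[ℝ] EX n) :
        EX n →L[ℝ] ES m)⟩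

/-- The trivializations of the pullback of `TS` to `Y` are those of `TS`. -/
theorem continuousLinearMapAt_TSY (y₀ y : (ℝ × M) × S)
    (h : y.2 ∈ (chartAt (EuclideanSpace ℝ (Fin m)) y₀.2).source) (v : ES m) :
    ((trivializationAt (ES m) (TSY n m M S) y₀).continuousLinearMapAt ℝ y v : ES m) =
      (trivializationAt (ES m) (TangentSpace (𝓡 m)) y₀.2).continuousLinearMapAt ℝ y.2 v := by
  exact (congrFun (Trivialization.coe_linearMapAt_of_mem
    (trivializationAt (ES m) (TSY n m M S) y₀) (R := ℝ) (show y ∈ _ from h)) v).trans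
    (congrFun (Trivialization.coe_linearMapAt_of_mem (R := ℝ)
      (trivializationAt (ES m) (TangentSpace (𝓡 m)) y₀.2) h) v).symm

/-- The trivializations of the pullback of `TX` to `Y` are those of `TX`. -/
theorem symmL_TXY (y₀ y : (ℝ × M) × S)
    (h : y.1 ∈ (chartAt (ModelProd ℝ (EuclideanSpace ℝ (Fin n))) y₀.1).source) (v : EX n) :
    ((trivializationAt (EX n) (TXY n m M S) y₀).symmL ℝ y v : EX n) =
      (trivializationAt (EX n) (TangentSpace (IX n)) y₀.1).symmL ℝ y.1 v := by
  refine ((trivializationAt (EX n) (TXY n m M S) y₀).symmL_apply (R := ℝ)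
    (show y ∈ _ from h) v).trans (Eq.trans ?_
    ((trivializationAt (EX n) (TangentSpace (IX n)) y₀.1).symmL_apply (R := ℝ) h v).symm)
  set w := (trivializationAt (EX n) (TXY n m M S) y₀).symm y v
  have h1 : ((trivializationAt (EX n) (TangentSpace (IX n)) y₀.1) ⟨y.1, w⟩).2 = v :=
    congrArg Prod.snd ((trivializationAt (EX n) (TXY n m M S) y₀).apply_mk_symm
      (show y ∈ _ from h) v)
  have h2 := (trivializationAt (EX n) (TangentSpace (IX n)) y₀.1).symm_apply_apply_mk h w
  rw [h1] at h2
  exact h2.symm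

theorem extChartAt_IX (x : ℝ × M) :
    extChartAt (IX n) x = (xChart (chartAt (EuclideanSpace ℝ (Fin n)) x.2)).toPartialEquiv := by
  apply PartialEquiv.ext
  · intro y; rfl
  · intro y; rfl
  · simp only [extChartAt_source, prodChartedSpace_chartAt, chartAt_self_eq]; rfl

theorem isSmoothChart_chartAt (s : S) :
    IsSmoothChart (𝓡 m) (chartAt (EuclideanSpace ℝ (Fin m)) s) :=
  isSmoothChart_of_mem_maximalAtlas (IsManifold.chart_mem_maximalAtlas s)

/-- The expression of a one-jet in the trivialization of `J¹π → Y` given by the preferred charts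
around a point. -/
theorem inCoordinates_J1 (y₀ y : (ℝ × M) × S) (A : EX n →L[ℝ] ES m)
    (h1 : y.1.2 ∈ (chartAt (EuclideanSpace ℝ (Fin n)) y₀.1.2).source)
    (h2 : y.2 ∈ (chartAt (EuclideanSpace ℝ (Fin m)) y₀.2).source) :
    ContinuousLinearMap.inCoordinates (EX n) (TXY n m M S) (ES m) (TSY n m M S) y₀ y y₀ y A =
      ((mfderiv (𝓡 m) 𝓘(ℝ, ES m) (chartAt (EuclideanSpace ℝ (Fin m)) y₀.2) y.2 :
        ES m →L[ℝ] ES m) ∘L A ∘L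
        (mfderiv 𝓘(ℝ, EX n) (IX n) (xChart (chartAt (EuclideanSpace ℝ (Fin n)) y₀.1.2)).symm
          (xChart (chartAt (EuclideanSpace ℝ (Fin n)) y₀.1.2) y.1) : EX n →L[ℝ] EX n)) := by
  have h1' : y.1 ∈ (chartAt (ModelProd ℝ (EuclideanSpace ℝ (Fin n))) y₀.1).source := by
    exact ⟨by rw [chartAt_self_eq]; trivial, h1⟩
  have h3 := TangentBundle.continuousLinearMapAt_trivializationAt (I := 𝓡 m) h2
  have h4 := TangentBundle.symmL_trivializationAt (I := IX n) h1'
  rw [ModelWithCorners.range_eq_univ, mfderivWithin_univ, extChartAt_IX] at h4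
  refine ContinuousLinearMap.ext fun v => ?_
  refine (continuousLinearMapAt_TSY y₀ y h2 _).trans ?_
  rw [h3]
  refine congrArg (fun w : EX n => (mfderiv (𝓡 m) 𝓘(ℝ, ES m)
    (chartAt (EuclideanSpace ℝ (Fin m)) y₀.2) y.2 (A w) : ES m)) ((symmL_TXY y₀ y h1' v).trans ?_)
  rw [h4]
  rfl

/-- The preferred chart of `J¹π` at `γ`: a jet is expressed by the derivatives of the preferred
charts of `M` and `S` at the projections of `γ`. -/
theorem extChartAt_J1_apply (γ γ' : J1 n m M S)
    (h1 : γ'.proj.1.2 ∈ (chartAt (EuclideanSpace ℝ (Fin n)) γ.proj.1.2).source)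
    (h2 : γ'.proj.2 ∈ (chartAt (EuclideanSpace ℝ (Fin m)) γ.proj.2).source) :
    extChartAt (IJ n m) γ γ' = ((xChart (chartAt (EuclideanSpace ℝ (Fin n)) γ.proj.1.2) γ'.proj.1,
        chartAt (EuclideanSpace ℝ (Fin m)) γ.proj.2 γ'.proj.2),
      ((mfderiv (𝓡 m) 𝓘(ℝ, ES m) (chartAt (EuclideanSpace ℝ (Fin m)) γ.proj.2) γ'.proj.2 :
          ES m →L[ℝ] ES m) ∘L (γ'.snd : EX n →L[ℝ] ES m) ∘L
        (mfderiv 𝓘(ℝ, EX n) (IX n) (xChart (chartAt (EuclideanSpace ℝ (Fin n)) γ.proj.1.2)).symm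
          (xChart (chartAt (EuclideanSpace ℝ (Fin n)) γ.proj.1.2) γ'.proj.1) :
            EX n →L[ℝ] EX n))) := by
  have h := hom_chart (F₁ := EX n) (E₁ := TXY n m M S) (F₂ := ES m) (E₂ := TSY n m M S)
    (HB := ModelProd (ModelProd ℝ (EuclideanSpace ℝ (Fin n))) (EuclideanSpace ℝ (Fin m))) γ γ'
  change (IJ n m) (chartAt _ γ γ') = _
  rw [h]
  exact Prod.ext rfl (inCoordinates_J1 γ.proj γ'.proj γ'.snd h1 h2)

variable {e : OpenPartialHomeomorph M (EuclideanSpace ℝ (Fin n))}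
    {e' : OpenPartialHomeomorph S (EuclideanSpace ℝ (Fin m))}

/-- The coordinates `(x^μ, y^a, y^a_μ)` are smooth: expressed in the preferred chart of `J¹π`, the
map `jetParam` composes a jet with the derivatives of the coordinate changes of `X` and `S`. -/
theorem contMDiffAt_jetParam (he : IsSmoothChart (𝓡 n) e) (he' : IsSmoothChart (𝓡 m) e')
    {q : EJ n m} (h1 : q.1.1.2 ∈ e.target) (h2 : q.1.2 ∈ e'.target) :
    ContMDiffAt 𝓘(ℝ, EJ n m) (IJ n m) ∞ (jetParam e e' : EJ n m → J1 n m M S) q := by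
  have hx := isSmoothChart_xChart he
  rw [contMDiffAt_hom_bundle]
  have hp1 : ContMDiffAt 𝓘(ℝ, EJ n m) (IX n) ∞ (fun q : EJ n m => (xChart e).symm q.1.1) q :=
    (hx.contMDiffAt_symm (mem_xChart_target.2 h1)).comp q
      (contDiff_fst.comp contDiff_fst).contMDiff.contMDiffAt
  have hp2 : ContMDiffAt 𝓘(ℝ, EJ n m) (𝓡 m) ∞ (fun q : EJ n m => e'.symm q.1.2) q :=
    (he'.contMDiffAt_symm h2).comp q
      (contDiff_snd.comp contDiff_fst).contMDiff.contMDiffAt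
  refine ⟨hp1.prodMk hp2, ?_⟩
  set e0 := chartAt (EuclideanSpace ℝ (Fin n)) (e.symm q.1.1.2) with he0
  set e0' := chartAt (EuclideanSpace ℝ (Fin m)) (e'.symm q.1.2) with he0'
  have hs0 : IsSmoothChart (𝓡 m) e0' := isSmoothChart_chartAt _
  have hx0 : IsSmoothChart (IX n) (xChart e0) := isSmoothChart_xChart (isSmoothChart_chartAt _)
  have hxs : (xChart e).symm q.1.1 ∈ (xChart e0).source :=
    mem_xChart_source.2 (mem_chart_source _ _)
  have hss : e'.symm q.1.2 ∈ e0'.source := mem_chart_source _ _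
  have key : (fun p : EJ n m => (fderiv ℝ (e0' ∘ e'.symm) p.1.2) ∘L p.2 ∘L
      fderiv ℝ (xChart e ∘ (xChart e0).symm) (xChart e0 ((xChart e).symm p.1.1)))
      =ᶠ[𝓝 q] fun p => ContinuousLinearMap.inCoordinates (EX n) (TXY n m M S) (ES m)
        (TSY n m M S) (jetParam e e' q).proj (jetParam e e' p).proj (jetParam e e' q).proj
        (jetParam e e' p).proj (jetParam e e' p).snd := by
    have c1 : ContinuousAt (fun q : EJ n m => (xChart e).symm q.1.1) q := hp1.continuousAt
    have c2 : ContinuousAt (fun q : EJ n m => e'.symm q.1.2) q := hp2.continuousAt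
    filter_upwards [c1.preimage_mem_nhds ((xChart e0).open_source.mem_nhds hxs),
      c2.preimage_mem_nhds (e0'.open_source.mem_nhds hss),
      ((xChart e).open_target.preimage (continuous_fst.comp continuous_fst)).mem_nhds
        (show q ∈ _ from mem_xChart_target.2 h1),
      (e'.open_target.preimage (continuous_snd.comp continuous_fst)).mem_nhds
        (show q ∈ _ from h2)] with p a1 a2 a3 a4
    have a1 : (xChart e).symm p.1.1 ∈ (xChart e0).source := a1
    have a2 : e'.symm p.1.2 ∈ e0'.source := a2
    have a3 : p.1.1 ∈ (xChart e).target := a3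
    have a4 : p.1.2 ∈ e'.target := a4
    refine Eq.trans ?_ (inCoordinates_J1 (jetParam e e' q).proj (jetParam e e' p).proj
      (jetParam e e' p).snd (mem_xChart_source.1 a1) a2).symm
    refine ContinuousLinearMap.ext fun v => ?_
    have r1 := hx0.fderiv_coordChange hx ((xChart e0).map_source a1)
      (by rw [(xChart e0).left_inv a1]; exact (xChart e).map_target a3) v
    rw [(xChart e0).left_inv a1] at r1
    have r2 := he'.fderiv_coordChange hs0 a4 a2
    simp only [ContinuousLinearMap.comp_apply]
    rw [r1, r2]
    rfl
  have d1 : ContDiffAt ℝ ∞ (e0' ∘ e'.symm) q.1.2 := he'.contDiffAt_coordChange hs0 h2 hss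
  have d2 : ContDiffAt ℝ ∞ (xChart e ∘ (xChart e0).symm) (xChart e0 ((xChart e).symm q.1.1)) :=
    hx0.contDiffAt_coordChange hx ((xChart e0).map_source hxs)
      (by rw [(xChart e0).left_inv hxs]; exact (xChart e).map_target (mem_xChart_target.2 h1))
  have d3 : ContDiffAt ℝ ∞ (xChart e0 ∘ (xChart e).symm) q.1.1 :=
    hx.contDiffAt_coordChange hx0 (mem_xChart_target.2 h1) hxs
  have d1' : ContDiffAt ℝ ∞ (fderiv ℝ (e0' ∘ e'.symm)) q.1.2 := d1.fderiv_right (by simp)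
  have d2' := d2.fderiv_right (m := ∞) (by simp)
  refine ContMDiffAt.congr_of_eventuallyEq ?_ key.symm
  refine ContDiffAt.contMDiffAt ?_
  refine ContDiffAt.clm_comp ?_ (ContDiffAt.clm_comp ?_ ?_)
  · exact d1'.comp q (contDiff_snd.comp contDiff_fst).contDiffAt
  · exact contDiff_snd.contDiffAt
  · have d4 : ContDiffAt ℝ ∞ (fun p : EJ n m => (xChart e0 ∘ (xChart e).symm) p.1.1) q :=
      ContDiffAt.comp (𝕜 := ℝ) (E := EJ n m) (F := EX n) (G := EX n) q
        (g := xChart e0 ∘ (xChart e).symm) (f := fun p : EJ n m => p.1.1) d3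
        (contDiff_fst.comp contDiff_fst).contDiffAt
    have d5 := ContDiffAt.comp (𝕜 := ℝ) (E := EJ n m) (F := EX n) (G := EX n →L[ℝ] EX n) q
      (g := fderiv ℝ (xChart e ∘ (xChart e0).symm))
      (f := fun p : EJ n m => (xChart e0 ∘ (xChart e).symm) p.1.1) d2' d4
    exact d5

theorem contDiffAt_lagrangian {L : J1 n m M S → ℝ} (hL : ContMDiff (IJ n m) 𝓘(ℝ, ℝ) ∞ L)
    (he : IsSmoothChart (𝓡 n) e) (he' : IsSmoothChart (𝓡 m) e')
    {q : EJ n m} (h1 : q.1.1.2 ∈ e.target) (h2 : q.1.2 ∈ e'.target) :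
    ContDiffAt ℝ ∞ (fun q : EJ n m => L (jetParam e e' q)) q :=
  ((hL _).comp q (contMDiffAt_jetParam he he' h1 h2)).contDiffAt

/-- In coordinates, the prolongation of a section consists of its values and its partial
derivatives. -/
theorem jet_eq_jetParam (he : IsSmoothChart (𝓡 n) e) (he' : IsSmoothChart (𝓡 m) e')
    {f : ℝ × M → S} {x : ℝ × M} (hf : MDifferentiableAt (IX n) (𝓡 m) f x)
    (h1 : x.2 ∈ e.source) (h2 : f x ∈ e'.source) :
    jet f x = jetParam e e' ((xChart e x, fieldInCharts f e e' (xChart e x)),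
      fderiv ℝ (fieldInCharts f e e') (xChart e x)) := by
  have hx := isSmoothChart_xChart he
  have h1' := mem_xChart_source.2 h1
  have hl : (xChart e).symm (xChart e x) = x := (xChart e).left_inv h1'
  have hfi : fieldInCharts f e e' = e' ∘ f ∘ (xChart e).symm := rfl
  have hv : fieldInCharts f e e' (xChart e x) = e' (f x) := by
    rw [hfi]; simp only [Function.comp_apply, hl]
  have hd : fderiv ℝ (fieldInCharts f e e') (xChart e x) =
      ((mfderiv (𝓡 m) 𝓘(ℝ, ES m) e' (f x)).comp ((mfderiv (IX n) (𝓡 m) f x).comp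
        (mfderiv 𝓘(ℝ, EX n) (IX n) (xChart e).symm (xChart e x))) : EX n →L[ℝ] ES m) := by
    rw [hfi, ← mfderiv_eq_fderiv]
    have k1 := hx.mdifferentiableAt_symm ((xChart e).map_source h1')
    have k2 : MDifferentiableAt (IX n) (𝓡 m) f ((xChart e).symm (xChart e x)) := by rwa [hl]
    have k3 : MDifferentiableAt (𝓡 m) 𝓘(ℝ, ES m) e' ((f ∘ (xChart e).symm) (xChart e x)) := by
      simp only [Function.comp_apply, hl]; exact he'.mdifferentiableAt h2
    rw [mfderiv_comp (I' := 𝓡 m) _ k3 (k2.comp _ k1), mfderiv_comp (I' := IX n) _ k2 k1]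
    simp only [Function.comp_apply]
    rw [hl]
    rfl
  rw [hd, hv]
  simp only [jetParam]
  have hr : e'.symm (e' (f x)) = f x := e'.left_inv h2
  have aux : ∀ (x' : ℝ × M) (s' : S) (B : EX n →L[ℝ] ES m), x' = x → s' = f x →
      B = (mfderiv (IX n) (𝓡 m) f x : EX n →L[ℝ] ES m) →
      jet f x = (⟨(x', s'), B⟩ : J1 n m M S) := by
    rintro _ _ _ rfl rfl rfl; rfl
  refine aux _ _ _ hl hr (ContinuousLinearMap.ext fun v => ?_)
  rw [hl]
  have r1 := hx.mfderiv_symm_comp h1' v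
  refine (he'.mfderiv_symm_comp h2 _).trans ?_
  exact congrArg (fun w : EX n => (mfderiv (IX n) (𝓡 m) f x w : ES m)) r1

end JetCharts

/-! ### Alternating forms on `ℝ × ℝⁿ` -/

section LinearAlgebra

variable {n : ℕ}

theorem wedgeOne_apply {E : Type*} [NormedAddCommGroup E] [NormedSpace ℝ E] {r : ℕ}
    (θ : E →L[ℝ] ℝ) (β : E [⋀^Fin r]→L[ℝ] ℝ) (v : Fin (r + 1) → E) :
    wedgeOne θ β v = ∑ i : Fin (r + 1), (-1) ^ (i : ℕ) * (θ (v i) * β (i.removeNth v)) := by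
  simp [wedgeOne, ContinuousAlternatingMap.alternatizeUncurryFin_apply]

theorem dXdual_dX (μ ν : Fin (n + 1)) : dXdual μ (dX ν) = if μ = ν then (1 : ℝ) else 0 := by
  refine Fin.cases ?_ (fun i => ?_) μ <;> refine Fin.cases ?_ (fun j => ?_) ν
  · simp [dX, dXdual]
  · simp [dX, dXdual, (Fin.succ_ne_zero _).symm]
  · simp [dX, dXdual]
  · simp [dX, dXdual, Fin.succ_inj]

theorem sum_dXdual_smul_dX (v : EX n) : ∑ μ : Fin (n + 1), dXdual μ v • dX μ = v := by
  rw [Fin.sum_univ_succ]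
  refine Prod.ext ?_ ?_
  · simp [dX, dXdual, Prod.fst_sum]
  · ext i
    simp [dX, dXdual, Prod.snd_sum, Pi.single_apply]

/-- The coordinate basis of `ℝ × ℝⁿ`. -/
def dXBasis (n : ℕ) : Module.Basis (Fin (n + 1)) ℝ (EX n) :=
  Module.Basis.ofEquivFun
    { toFun := fun v μ => dXdual μ v
      map_add' := fun v w => by ext; simp
      map_smul' := fun c v => by ext; simp
      invFun := fun c => ∑ μ, c μ • dX μ
      left_inv := fun v => sum_dXdual_smul_dX v
      right_inv := fun c => by ext μ; simp [dXdual_dX] }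

@[simp] theorem dXBasis_apply (μ : Fin (n + 1)) : dXBasis n μ = dX μ := by
  simp [dXBasis, Module.Basis.ofEquivFun, Pi.single_apply]

/-- An alternating form of top degree is determined by its value on the coordinate vectors. -/
theorem topForm_ext {η η' : EX n [⋀^Fin (n + 1)]→L[ℝ] ℝ} (h : η dX = η' dX) : η = η' := by
  have hb : (dXBasis n : Fin (n + 1) → EX n) = dX := funext dXBasis_apply
  apply ContinuousAlternatingMap.toAlternatingMap_injective
  rw [η.toAlternatingMap.eq_smul_basis_det (dXBasis n),
    η'.toAlternatingMap.eq_smul_basis_det (dXBasis n), hb]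
  exact congrArg (fun c : ℝ => c • (dXBasis n).det) h

/-- The tensor `Σ_μ dx^μ ⊗ ∂_μ` does not change if `T` is moved from the covectors to the vectors.
This is why the sum over `μ` in the Cartan form does not depend on the coordinates of `X`. -/
theorem sum_comp_eq_sum {g : (EX n →L[ℝ] ℝ) →L[ℝ] ℝ} {h : EX n →ₗ[ℝ] ℝ}
    (T : EX n →L[ℝ] EX n) :
    ∑ μ : Fin (n + 1), g (dXdual μ ∘L T) * h (dX μ) =
      ∑ μ : Fin (n + 1), g (dXdual μ) * h (T (dX μ)) := by
  have h1 : ∀ μ, dXdual μ ∘L T = ∑ ν : Fin (n + 1), dXdual μ (T (dX ν)) • dXdual (n := n) ν := by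
    intro μ
    refine ContinuousLinearMap.ext fun v => ?_
    conv_lhs => rw [ContinuousLinearMap.comp_apply, ← sum_dXdual_smul_dX v]
    simp only [map_sum, map_smul, smul_eq_mul, sum_apply, smul_apply]
    exact Finset.sum_congr rfl fun i _ => mul_comm _ _
  have h2 : ∀ v, h v = ∑ μ, dXdual μ v * h (dX μ) := by
    intro v
    conv_lhs => rw [← sum_dXdual_smul_dX v]
    simp
  simp_rw [h1, h2 (T _), map_sum, map_smul, smul_eq_mul, Finset.sum_mul, Finset.mul_sum]
  rw [Finset.sum_comm]
  exact Finset.sum_congr rfl fun i _ => Finset.sum_congr rfl fun j _ => by ring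

theorem topForm_vecCons_removeNth (η : EX n [⋀^Fin (n + 1)]→L[ℝ] ℝ) (μ ν : Fin (n + 1)) :
    η (Matrix.vecCons (dX ν) (μ.removeNth dX)) =
      if ν = μ then (-1) ^ (μ : ℕ) * η dX else 0 := by
  split_ifs with h
  · subst h
    have := η.toAlternatingMap.neg_one_pow_smul_map_insertNth ν (dX ν) (ν.removeNth dX)
    rw [Fin.insertNth_self_removeNth] at this
    simpa using! this.symm
  · obtain ⟨j, rfl⟩ := Fin.exists_succAbove_eq h
    refine η.map_eq_zero_of_eq _ (i := 0) (j := j.succ) ?_ (Fin.succ_ne_zero j).symm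
    simp [Fin.removeNth]

theorem euclidean_form_comp {n : ℕ}
    (η : EuclideanSpace ℝ (Fin n) [⋀^Fin n]→L[ℝ] ℝ)
    (T : EuclideanSpace ℝ (Fin n) →L[ℝ] EuclideanSpace ℝ (Fin n)) :
    η (fun i => T (EuclideanSpace.single i 1)) =
      T.det * η (fun i => EuclideanSpace.single i 1) := by
  have hb : ((EuclideanSpace.basisFun (Fin n) ℝ).toBasis : Fin n → EuclideanSpace ℝ (Fin n)) =
      fun i => EuclideanSpace.single i 1 := by ext i; simp
  have h := η.toAlternatingMap.eq_smul_basis_det (EuclideanSpace.basisFun (Fin n) ℝ).toBasis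
  have h1 := congrArg (fun F => F (fun i => T (EuclideanSpace.single i 1))) h
  have h2 := (EuclideanSpace.basisFun (Fin n) ℝ).toBasis.det_comp (T : _ →ₗ[ℝ] _)
    (EuclideanSpace.basisFun (Fin n) ℝ).toBasis
  rw [Module.Basis.det_self, hb, mul_one] at h2
  simp only [hb] at h1
  have h3 : (EuclideanSpace.basisFun (Fin n) ℝ).toBasis.det
      (fun i => T (EuclideanSpace.single i 1)) = T.det := h2
  rw [AlternatingMap.smul_apply, h3, smul_eq_mul, mul_comm] at h1
  exact h1

theorem contDiff_det {n : ℕ} : ContDiff ℝ ∞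
    (fun T : EuclideanSpace ℝ (Fin n) →L[ℝ] EuclideanSpace ℝ (Fin n) => T.det) := by
  have h : ∀ T : EuclideanSpace ℝ (Fin n) →L[ℝ] EuclideanSpace ℝ (Fin n), T.det =
      ∑ σ : Equiv.Perm (Fin n), ((Equiv.Perm.sign σ : ℤ) : ℝ) *
        ∏ i, T (EuclideanSpace.single i 1) (σ i) := by
    intro T
    have : T.det = LinearMap.det (T : EuclideanSpace ℝ (Fin n) →ₗ[ℝ] _) := rfl
    rw [this, ← LinearMap.det_toMatrix (EuclideanSpace.basisFun (Fin n) ℝ).toBasis,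
      Matrix.det_apply']
    refine Finset.sum_congr rfl fun σ _ => ?_
    congr 1
  simp_rw [h]
  refine ContDiff.sum fun σ _ => contDiff_const.mul (contDiff_prod fun i _ => ?_)
  exact ((EuclideanSpace.proj (σ i)).contDiff (𝕜 := ℝ)).comp
    (contDiff_id.clm_apply contDiff_const)

end LinearAlgebra

/-! ### The density of the volume form in a chart -/

section Density

variable {n : ℕ}
  {M : Type*} [TopologicalSpace M] [ChartedSpace (EuclideanSpace ℝ (Fin n)) M]
  [IsManifold (𝓡 n) ∞ M]
  {ηM : (p : M) → TangentSpace (𝓡 n) p [⋀^Fin n]→L[ℝ] ℝ}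
  {e e₁ : OpenPartialHomeomorph M (EuclideanSpace ℝ (Fin n))}

/-- The transformation law of the density: it is multiplied by the Jacobian determinant. -/
theorem density_coordChange (he : IsSmoothChart (𝓡 n) e) (he₁ : IsSmoothChart (𝓡 n) e₁)
    {z : EuclideanSpace ℝ (Fin n)} (hz : z ∈ e.target) (hz₁ : e.symm z ∈ e₁.source) :
    density ηM e z =
      (fderiv ℝ (e₁ ∘ e.symm) z).det * density ηM e₁ (e₁ (e.symm z)) := by
  let η : EuclideanSpace ℝ (Fin n) [⋀^Fin n]→L[ℝ] ℝ :=
    ContinuousAlternatingMap.compContinuousLinearMap (ηM (e.symm z))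
      (mfderiv (𝓡 n) (𝓡 n) e₁.symm (e₁ (e.symm z)))
  have h := euclidean_form_comp η (fderiv ℝ (e₁ ∘ e.symm) z)
  have h1 : η (fun i => EuclideanSpace.single i 1) = density ηM e₁ (e₁ (e.symm z)) := by
    simp only [density]
    rw [e₁.left_inv hz₁]
    rfl
  have h2 : η (fun i => fderiv ℝ (e₁ ∘ e.symm) z (EuclideanSpace.single i 1)) =
      density ηM e z := by
    simp only [density]
    refine congrArg (ηM (e.symm z)) (funext fun i => ?_)
    simp only [he.fderiv_coordChange he₁ hz hz₁]
    exact he₁.mfderiv_symm_comp hz₁ _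
  rw [← h1, ← h2, h]

theorem contDiffAt_density (hηM : IsSmoothForm (𝓡 n) ηM) (he : IsSmoothChart (𝓡 n) e)
    {z : EuclideanSpace ℝ (Fin n)} (hz : z ∈ e.target) :
    ContDiffAt ℝ ∞ (density ηM e) z := by
  set e₁ := chartAt (EuclideanSpace ℝ (Fin n)) (e.symm z)
  have he₁ : IsSmoothChart (𝓡 n) e₁ := isSmoothChart_chartAt _
  have hs : e.symm z ∈ e₁.source := mem_chart_source _ _
  have h1 : ContDiffAt ℝ ∞ (density ηM e₁) (e₁ (e.symm z)) := by
    have h2 := (hηM (e.symm z)).contDiffAt (x := e₁ (e.symm z))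
      ((isOpen_extChartAt_target (I := 𝓡 n) (e.symm z)).mem_nhds
        (mem_extChartAt_target (I := 𝓡 n) (e.symm z)))
    have h3 : ContDiffAt ℝ ∞ (fun w => formInChart (𝓡 n) ηM (e.symm z) w
      (fun i => EuclideanSpace.single i 1)) (e₁ (e.symm z)) :=
      ((ContinuousAlternatingMap.apply ℝ (EuclideanSpace ℝ (Fin n)) ℝ
        (fun i : Fin n => EuclideanSpace.single i (1 : ℝ))).contDiff.contDiffAt).comp
          (𝕜 := ℝ) _ h2
    exact h3
  have h4 : ContDiffAt ℝ ∞ (e₁ ∘ e.symm) z := he.contDiffAt_coordChange he₁ hz hs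
  have h5 : ContDiffAt ℝ ∞ (fun w => (fderiv ℝ (e₁ ∘ e.symm) w).det *
      density ηM e₁ ((e₁ ∘ e.symm) w)) z :=
    (contDiff_det.contDiffAt.comp z (h4.fderiv_right (m := ∞) (by simp))).mul
      (ContDiffAt.comp z (g := density ηM e₁) (f := e₁ ∘ e.symm) h1 h4)
  refine h5.congr_of_eventuallyEq ?_
  filter_upwards [e.open_target.mem_nhds hz,
    (e.continuousAt_symm hz).preimage_mem_nhds (e₁.open_source.mem_nhds hs)] with w hw hw'
  exact density_coordChange he he₁ hw hw'

theorem density_ne_zero (hη0 : ∀ p, ηM p ≠ 0) (he : IsSmoothChart (𝓡 n) e)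
    {z : EuclideanSpace ℝ (Fin n)} (hz : z ∈ e.target) : density ηM e z ≠ 0 := by
  intro h
  apply hη0 (e.symm z)
  let η : EuclideanSpace ℝ (Fin n) [⋀^Fin n]→L[ℝ] ℝ :=
    ContinuousAlternatingMap.compContinuousLinearMap (ηM (e.symm z))
      (mfderiv (𝓡 n) (𝓡 n) e.symm z)
  have hη : η = 0 := by
    apply ContinuousAlternatingMap.toAlternatingMap_injective
    rw [η.toAlternatingMap.eq_smul_basis_det (EuclideanSpace.basisFun (Fin n) ℝ).toBasis]
    have hb : ((EuclideanSpace.basisFun (Fin n) ℝ).toBasis : Fin n → EuclideanSpace ℝ (Fin n)) =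
      fun i => EuclideanSpace.single i 1 := by ext i; simp
    rw [hb]
    have : η.toAlternatingMap (fun i => EuclideanSpace.single i 1) = 0 := h
    rw [this, zero_smul]; rfl
  refine ContinuousAlternatingMap.ext fun v => ?_
  have h1 : (ηM (e.symm z)) v = η fun i => (mfderiv (𝓡 n) (𝓡 n) e (e.symm z) (v i)) := by
    refine congrArg (ηM (e.symm z)) (funext fun i => ?_)
    have := he.mfderiv_symm_comp (e.map_target hz) (v i)
    rw [e.right_inv hz] at this
    exact this.symm
  rw [h1, hη]; rfl

theorem mfderiv_xChart_symm (he : IsSmoothChart (𝓡 n) e) {z : EX n} (hz : z.2 ∈ e.target)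
    (v : EX n) : (mfderiv 𝓘(ℝ, EX n) (IX n) (xChart e).symm z v : EX n) =
      (v.1, (mfderiv (𝓡 n) (𝓡 n) e.symm z.2 v.2 : EuclideanSpace ℝ (Fin n))) := by
  have h1 : HasMFDerivAt 𝓘(ℝ, EX n) 𝓘(ℝ, ℝ) (fun z : EX n => z.1) z
      (ContinuousLinearMap.fst ℝ ℝ (EuclideanSpace ℝ (Fin n))) := hasFDerivAt_fst.hasMFDerivAt
  have h2 : HasMFDerivAt 𝓘(ℝ, EX n) (𝓡 n) (fun z : EX n => z.2) z
      (ContinuousLinearMap.snd ℝ ℝ (EuclideanSpace ℝ (Fin n))) := hasFDerivAt_snd.hasMFDerivAt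
  have h3 := HasMFDerivAt.comp z (he.mdifferentiableAt_symm hz).hasMFDerivAt h2
  exact congrArg (fun T : EX n →L[ℝ] EX n => T v) (h1.prodMk h3).mfderiv

/-- The coefficient of `dt ∧ η_M` in a product chart is the density of `η_M`. -/
theorem volForm_xChart (he : IsSmoothChart (𝓡 n) e) {z : EX n} (hz : z.2 ∈ e.target) :
    volForm ηM ((xChart e).symm z)
      (fun i => mfderiv 𝓘(ℝ, EX n) (IX n) (xChart e).symm z (dX i)) = density ηM e z.2 := by
  simp only [volForm]
  refine (wedgeOne_apply _ _ _).trans ?_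
  rw [Fin.sum_univ_succ, Finset.sum_eq_zero]
  · simp only [mfderiv_xChart_symm he hz]
    simp [dX, density]
    rfl
  · intro i _
    simp only [mfderiv_xChart_symm he hz]
    simp [dX]

end Density

/-! ### Derivatives of products with a factor vanishing at the point -/

section Calculus

variable {E F G : Type*} [NormedAddCommGroup E] [NormedSpace ℝ E] [NormedAddCommGroup F]
  [NormedSpace ℝ F] [NormedAddCommGroup G] [NormedSpace ℝ G]

theorem differentiableAt_wedgeOne {r : ℕ} (β : E [⋀^Fin r]→L[ℝ] ℝ) {θ : F → E →L[ℝ] ℝ} {q : F}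
    (hθ : DifferentiableAt ℝ θ q) : DifferentiableAt ℝ (fun q => wedgeOne (θ q) β) q := by
  let K : (E →L[ℝ] ℝ) →L[ℝ] (E →L[ℝ] E [⋀^Fin r]→L[ℝ] ℝ) :=
    (ContinuousLinearMap.smulRightL ℝ E (E [⋀^Fin r]→L[ℝ] ℝ)).flip β
  let K' := ContinuousAlternatingMap.alternatizeUncurryFinCLM (n := r) ℝ E ℝ
  exact DifferentiableAt.comp q (g := fun θ => (K'.comp K) θ)
    (K'.comp K).differentiableAt hθ

theorem differentiableAt_smul_add_sum_wedgeOne {ι : Type*} [Fintype ι] {r : ℕ}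
    (α : E [⋀^Fin (r + 1)]→L[ℝ] ℝ) (β : ι → E [⋀^Fin r]→L[ℝ] ℝ) {a : F → ℝ} {R : F → ℝ}
    {θ : ι → F → E →L[ℝ] ℝ} {q : F} (ha : DifferentiableAt ℝ a q) (hR : DifferentiableAt ℝ R q)
    (hθ : ∀ i, DifferentiableAt ℝ (θ i) q) :
    DifferentiableAt ℝ (fun q => (a q * R q) • α + ∑ i, wedgeOne (R q • θ i q) (β i)) q := by
  refine DifferentiableAt.fun_add ((ha.mul hR).smul_const _) ?_
  exact DifferentiableAt.fun_sum fun i _ => differentiableAt_wedgeOne _ (hR.smul (hθ i))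

/-- If `c` vanishes at `q`, the coefficients of a product with `c` need not be differentiated
there. -/
theorem hasFDerivAt_mul_clm_apply_of_eq_zero {r : E → ℝ} {a : E → F →L[ℝ] ℝ} {c : E → F}
    {c' : E →L[ℝ] F} {q : E} (hr : DifferentiableAt ℝ r q) (ha : DifferentiableAt ℝ a q)
    (hc : HasFDerivAt c c' q) (h0 : c q = 0) :
    HasFDerivAt (fun q => r q * a q (c q)) (r q • (a q ∘L c')) q := by
  convert! hr.hasFDerivAt.mul (ha.hasFDerivAt.clm_apply hc) using 1
  ext v
  simp [h0]

/-- The derivative of a coefficient of the Cartan form at a point where the contact forms `c i`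
vanish. -/
theorem fderiv_mul_add_sum_of_eq_zero {ι : Type*} [Fintype ι] {ℓ r : E → ℝ} {a : E → F →L[ℝ] ℝ}
    {c : ι → E → F} {c' : ι → E →L[ℝ] F} {q : E} (hℓ : DifferentiableAt ℝ ℓ q)
    (hr : DifferentiableAt ℝ r q) (ha : DifferentiableAt ℝ a q)
    (hc : ∀ i, HasFDerivAt (c i) (c' i) q) (h0 : ∀ i, c i q = 0) (k : ℝ) (w : E) :
    fderiv ℝ (fun q => (ℓ q * r q + ∑ i, r q * a q (c i q)) * k) q w =
      (ℓ q * fderiv ℝ r q w + r q * fderiv ℝ ℓ q w + ∑ i, r q * a q (c' i w)) * k := by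
  have hd := ((hℓ.hasFDerivAt.mul hr.hasFDerivAt).add (HasFDerivAt.fun_sum
    fun i (_ : i ∈ Finset.univ) =>
      hasFDerivAt_mul_clm_apply_of_eq_zero hr ha (hc i) (h0 i))).mul_const k
  refine (congrArg (fun T : E →L[ℝ] ℝ => T w) hd.fderiv).trans ?_
  simp [sum_apply]
  ring

end Calculus

/-! ### The Cartan form in coordinates -/

section ModelCartan

variable {n m : ℕ}

/-- The fibre derivative of a function `ℓ` of the coordinates `(x^μ, y^a, y^a_μ)`. -/
def partialA (ℓ : EJ n m → ℝ) (q : EJ n m) : (EX n →L[ℝ] ES m) →L[ℝ] ℝ :=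
  fderiv ℝ (fun B : EX n →L[ℝ] ES m => ℓ (q.1, B)) q.2

/-- The derivative of a function `ℓ` of the coordinates `(x^μ, y^a, y^a_μ)` with respect to the
field variable `y`. -/
def partialY (ℓ : EJ n m → ℝ) (q : EJ n m) : ES m →L[ℝ] ℝ :=
  fderiv ℝ (fun y : ES m => ℓ ((q.1.1, y), q.2)) q.1.2

theorem partialA_eq {ℓ : EJ n m → ℝ} {q : EJ n m} (h : DifferentiableAt ℝ ℓ q) :
    partialA ℓ q = fderiv ℝ ℓ q ∘L ContinuousLinearMap.inr ℝ (EX n × ES m) (EX n →L[ℝ] ES m) := by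
  have h1 : HasFDerivAt (fun B : EX n →L[ℝ] ES m => (q.1, B))
      (ContinuousLinearMap.inr ℝ (EX n × ES m) (EX n →L[ℝ] ES m)) q.2 :=
    hasFDerivAt_prodMk_right q.1 q.2
  exact (h.hasFDerivAt.comp (𝕜 := ℝ) q.2 h1).fderiv

theorem partialY_apply {ℓ : EJ n m → ℝ} {q : EJ n m} (h : DifferentiableAt ℝ ℓ q) (w : ES m) :
    partialY ℓ q w = fderiv ℝ ℓ q ((0, w), 0) := by
  have h1 : HasFDerivAt (fun y : ES m => (((q.1.1, y), q.2) : EJ n m))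
      ((ContinuousLinearMap.inl ℝ (EX n × ES m) (EX n →L[ℝ] ES m)) ∘L
        (ContinuousLinearMap.inr ℝ (EX n) (ES m))) q.1.2 :=
    (hasFDerivAt_prodMk_left (q.1) q.2).comp (𝕜 := ℝ) q.1.2 (hasFDerivAt_prodMk_right q.1.1 q.1.2)
  have h2 := (h.hasFDerivAt.comp (𝕜 := ℝ) q.1.2 h1).fderiv
  exact congrArg (fun T : ES m →L[ℝ] ℝ => T w) h2

theorem contDiffAt_partialA {ℓ : EJ n m → ℝ} {q : EJ n m} (h : ContDiffAt ℝ ∞ ℓ q) :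
    ContDiffAt ℝ ∞ (partialA ℓ) q := by
  have h1 : ContDiffAt ℝ ∞ (fun q => fderiv ℝ ℓ q ∘L
      ContinuousLinearMap.inr ℝ (EX n × ES m) (EX n →L[ℝ] ES m)) q :=
    (h.fderiv_right (m := ∞) (by simp)).clm_comp contDiffAt_const
  refine h1.congr_of_eventuallyEq ?_
  filter_upwards [(h.of_le (m := 1) (by simp)).eventually (by simp)] with p hp
  exact partialA_eq (hp.differentiableAt (by simp))

/-- The one-jet of a map `φ` between the model spaces, in coordinates. -/
def modelJet (φ : EX n → ES m) (z : EX n) : EJ n m := ((z, φ z), fderiv ℝ φ z)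

theorem contDiffAt_modelJet {φ : EX n → ES m} {z : EX n} (h : ContDiffAt ℝ ∞ φ z) :
    ContDiffAt ℝ ∞ (modelJet φ) z :=
  (contDiffAt_id.prodMk h).prodMk (h.fderiv_right (m := ∞) (by simp))

theorem fderiv_modelJet_apply {φ : EX n → ES m} {z : EX n} (h : ContDiffAt ℝ ∞ φ z) (v : EX n) :
    fderiv ℝ (modelJet φ) z v = ((v, fderiv ℝ φ z v), fderiv ℝ (fderiv ℝ φ) z v) := by
  have h1 := (h.differentiableAt (by simp)).hasFDerivAt
  have h2 := ((h.fderiv_right (m := ∞) (by simp)).differentiableAt (by simp)).hasFDerivAt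
  exact congrArg (fun T : EX n →L[ℝ] EJ n m => T v)
    (((hasFDerivAt_id z).prodMk h1).prodMk h2).fderiv

/-- The projection of `EJ n m` to the base coordinates. -/
abbrev projX : EJ n m →L[ℝ] EX n :=
  ContinuousLinearMap.fst ℝ (EX n) (ES m) ∘L
    ContinuousLinearMap.fst ℝ (EX n × ES m) (EX n →L[ℝ] ES m)

/-- The projection of `EJ n m` to the field coordinates. -/
abbrev projS : EJ n m →L[ℝ] ES m :=
  ContinuousLinearMap.snd ℝ (EX n) (ES m) ∘L
    ContinuousLinearMap.fst ℝ (EX n × ES m) (EX n →L[ℝ] ES m)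

/-- The Cartan form in coordinates, for the Lagrangian `ℓ` and the volume form `R η`, `η` being
constant. -/
def modelCartan (η : EX n [⋀^Fin (n + 1)]→L[ℝ] ℝ) (R : EX n → ℝ) (ℓ : EJ n m → ℝ) (q : EJ n m) :
    EJ n m [⋀^Fin (n + 1)]→L[ℝ] ℝ :=
  (ℓ q * R q.1.1) • η.compContinuousLinearMap projX +
    ∑ μ : Fin (n + 1), wedgeOne
      (R q.1.1 • (partialA ℓ q ∘L ContinuousLinearMap.smulRightL ℝ (EX n) (ES m) (dXdual μ) ∘L
        (projS - q.2 ∘L projX)))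
      ((η.curryLeft (dX μ)).compContinuousLinearMap projX)

variable {η : EX n [⋀^Fin (n + 1)]→L[ℝ] ℝ} {R : EX n → ℝ} {ℓ : EJ n m → ℝ}

theorem modelCartan_apply (q : EJ n m) (u : Fin (n + 1) → EJ n m) :
    modelCartan η R ℓ q u = ℓ q * R q.1.1 * η (fun i => (u i).1.1) +
      ∑ μ : Fin (n + 1), ∑ i : Fin (n + 1), (-1) ^ (i : ℕ) *
        (R q.1.1 * partialA ℓ q ((dXdual μ).smulRight ((u i).1.2 - q.2 (u i).1.1)) *
          η (Matrix.vecCons (dX μ) (i.removeNth fun i => (u i).1.1))) := by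
  simp only [modelCartan, ContinuousAlternatingMap.add_apply, ContinuousAlternatingMap.smul_apply,
    ContinuousAlternatingMap.sum_apply, wedgeOne_apply, smul_eq_mul]
  rfl

/-- The value of the Cartan form on vectors projecting to the coordinate vectors of the base. -/
theorem modelCartan_apply_lift (q : EJ n m) (u : Fin (n + 1) → EJ n m)
    (hu : ∀ i, (u i).1.1 = dX i) :
    modelCartan η R ℓ q u = (ℓ q * R q.1.1 + ∑ μ : Fin (n + 1),
      R q.1.1 * partialA ℓ q ((dXdual μ).smulRight ((u μ).1.2 - q.2 (dX μ)))) * η dX := by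
  rw [modelCartan_apply, add_mul, Finset.sum_mul]
  simp only [hu]
  congr 1
  refine Finset.sum_congr rfl fun μ _ => ?_
  rw [Finset.sum_eq_single μ]
  · rw [topForm_vecCons_removeNth, if_pos rfl]
    have : (-1 : ℝ) ^ (μ : ℕ) * (-1) ^ (μ : ℕ) = 1 := by rw [← mul_pow]; simp
    linear_combination (R q.1.1 * partialA ℓ q ((dXdual μ).smulRight ((u μ).1.2 - q.2 (dX μ))) *
      η dX) * this
  · intro i _ hi
    rw [topForm_vecCons_removeNth, if_neg (Ne.symm hi)]; simp
  · simp

/-- The value of the Cartan form on a vertical vector `W` together with lifts of all coordinate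
vectors of the base but `∂_ν`: up to sign, the momentum `ρ ∂L/∂y^a_ν` applied to `W`. -/
theorem modelCartan_apply_vertical (q : EJ n m) (W : EJ n m) (hW : W.1.1 = 0)
    (T : Fin (n + 1) → EJ n m) (hT : ∀ i, (T i).1.1 = dX i) (ν : Fin (n + 1)) :
    modelCartan η R ℓ q (Fin.cons W (ν.removeNth T)) =
      (-1) ^ (ν : ℕ) * (R q.1.1 * partialA ℓ q ((dXdual ν).smulRight W.1.2)) * η dX := by
  rw [modelCartan_apply]
  have hr : (fun i : Fin n => (ν.removeNth T i).1.1) = ν.removeNth dX := by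
    ext1 i; simp [Fin.removeNth, hT]
  have hu : (fun i => ((Fin.cons W (ν.removeNth T) : Fin (n + 1) → EJ n m) i).1.1) =
      Fin.cons 0 (ν.removeNth dX) := by
    rw [← hr]
    ext1 i
    refine Fin.cases ?_ (fun j => ?_) i
    · simp [hW]
    · simp
  rw [hu, η.map_coord_zero (i := 0) (by simp), mul_zero, zero_add]
  have hi : ∀ μ : Fin (n + 1), ∀ i : Fin n, η (Matrix.vecCons (dX μ) (i.succ.removeNth
      (Fin.cons 0 (ν.removeNth dX) : Fin (n + 1) → EX n))) = 0 := by
    intro μ i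
    obtain ⟨k, rfl⟩ : ∃ k, n = k + 1 := ⟨n - 1, by have := i.2; omega⟩
    refine η.map_coord_zero (i := 1) ?_
    simp [Fin.removeNth, Matrix.vecCons]
  have h0 : (Fin.removeNth 0 (Fin.cons 0 (ν.removeNth dX) : Fin (n + 1) → EX n)) =
      ν.removeNth dX := by ext1 i; simp [Fin.removeNth]
  have hμ : ∀ μ : Fin (n + 1), ∑ i : Fin (n + 1), (-1) ^ (i : ℕ) * (R q.1.1 * partialA ℓ q
      ((dXdual μ).smulRight (((Fin.cons W (ν.removeNth T) : Fin (n + 1) → EJ n m) i).1.2 -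
        q.2 ((Fin.cons W (ν.removeNth T) : Fin (n + 1) → EJ n m) i).1.1)) *
        η (Matrix.vecCons (dX μ) (i.removeNth
          (Fin.cons 0 (ν.removeNth dX) : Fin (n + 1) → EX n)))) =
      R q.1.1 * partialA ℓ q ((dXdual μ).smulRight W.1.2) *
        η (Matrix.vecCons (dX μ) (ν.removeNth dX)) := by
    intro μ
    rw [Fin.sum_univ_succ, Finset.sum_eq_zero fun i _ => by rw [hi]; simp, h0]
    simp [hW]
  rw [Finset.sum_congr rfl fun μ _ => hμ μ, Finset.sum_eq_single ν]
  · rw [topForm_vecCons_removeNth, if_pos rfl]; ring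
  · intro μ _ hμ
    rw [topForm_vecCons_removeNth, if_neg hμ, mul_zero]
  · simp

theorem differentiableAt_modelCartan {q : EJ n m} (hℓ : ContDiffAt ℝ ∞ ℓ q)
    (hR : DifferentiableAt ℝ R q.1.1) : DifferentiableAt ℝ (modelCartan η R ℓ) q := by
  have hR' : DifferentiableAt ℝ (fun q : EJ n m => R q.1.1) q :=
    DifferentiableAt.comp (𝕜 := ℝ) q (f := fun q : EJ n m => q.1.1) hR
      (projX (n := n) (m := m)).differentiableAt
  have hA : DifferentiableAt ℝ (partialA ℓ) q :=
    (contDiffAt_partialA hℓ).differentiableAt (by simp)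
  refine differentiableAt_smul_add_sum_wedgeOne _ _ (hℓ.differentiableAt (by simp)) hR' fun μ => ?_
  refine hA.clm_comp ((differentiableAt_const _).clm_comp ?_)
  exact (differentiableAt_const _).sub (differentiableAt_snd.clm_comp (differentiableAt_const _))

/-- The contact form `dy^a - y^a_ν dx^ν` on a fixed vector is an affine function of the jet
coordinates; its derivative only sees the component along the fibres of `J¹π → Y`. -/
theorem exists_hasFDerivAt_contact (b : ES m) (μ : Fin (n + 1)) (q : EJ n m) :
    ∃ c' : EJ n m →L[ℝ] (EX n →L[ℝ] ES m),
      (∀ v, c' v = (dXdual μ).smulRight (-(v.2 (dX μ)))) ∧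
      HasFDerivAt (fun q : EJ n m => (dXdual μ).smulRight (b - q.2 (dX μ))) c' q := by
  have h1 : HasFDerivAt (fun q : EJ n m => b - q.2 (dX μ))
      (-(ContinuousLinearMap.apply ℝ (ES m) (dX μ) ∘L
        ContinuousLinearMap.snd ℝ (EX n × ES m) (EX n →L[ℝ] ES m))) q :=
    ((ContinuousLinearMap.apply ℝ (ES m) (dX μ) ∘L
      ContinuousLinearMap.snd ℝ (EX n × ES m) (EX n →L[ℝ] ES m)).hasFDerivAt).const_sub _
  exact ⟨_, fun v => rfl,
    (ContinuousLinearMap.smulRightL ℝ (EX n) (ES m) (dXdual μ)).hasFDerivAt.comp q h1⟩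

theorem dXdual_smulRight_zero (μ : Fin (n + 1)) :
    (dXdual μ).smulRight (0 : ES m) = (0 : EX n →L[ℝ] ES m) :=
  ContinuousLinearMap.ext fun u => smul_zero (dXdual μ u)

theorem sum_dXdual_smulRight (B : EX n →L[ℝ] ES m) :
    ∑ μ : Fin (n + 1), (dXdual μ).smulRight (B (dX μ)) = B := by
  refine ContinuousLinearMap.ext fun v => ?_
  conv_rhs => rw [← sum_dXdual_smul_dX v]
  simp [sum_apply]

set_option maxHeartbeats 1000000 in
/-- The pullback by the one-jet of `φ` of the contraction of `dΘ` with a vertical vector is the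
Euler–Lagrange expression times the volume form; the component of the vector along the fibres of
the jet bundle drops out. -/
theorem extDeriv_modelCartan {φ : EX n → ES m} {z : EX n} (hφ : ContDiffAt ℝ ∞ φ z)
    (hℓ : ContDiffAt ℝ ∞ ℓ (modelJet φ z)) (hR : DifferentiableAt ℝ R z) (hRz : R z = 1)
    (w : ES m) (B : EX n →L[ℝ] ES m) :
    extDeriv (modelCartan η R ℓ) (modelJet φ z)
      (Fin.cons ((0, w), B) fun i => fderiv ℝ (modelJet φ) z (dX i)) =
      (partialY ℓ (modelJet φ z) w - ∑ μ : Fin (n + 1), fderiv ℝ (fun z =>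
        R z * partialA ℓ (modelJet φ z) ((dXdual μ).smulRight w)) z (dX μ)) * η dX := by
  set q := modelJet φ z with hq
  have hq1 : q.1.1 = z := rfl
  have hdℓ : DifferentiableAt ℝ ℓ q := hℓ.differentiableAt (by simp)
  have hA : DifferentiableAt ℝ (partialA ℓ) q :=
    (contDiffAt_partialA hℓ).differentiableAt (by simp)
  have hR' : DifferentiableAt ℝ (fun q : EJ n m => R q.1.1) q :=
    DifferentiableAt.comp (𝕜 := ℝ) q (f := fun q : EJ n m => q.1.1) hR
      (projX (n := n) (m := m)).differentiableAt
  have hj : DifferentiableAt ℝ (modelJet φ) z :=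
    (contDiffAt_modelJet hφ).differentiableAt (by simp)
  set T : Fin (n + 1) → EJ n m := fun i => fderiv ℝ (modelJet φ) z (dX i) with hTdef
  have hT : ∀ i, T i = ((dX i, fderiv ℝ φ z (dX i)), fderiv ℝ (fderiv ℝ φ) z (dX i)) :=
    fun i => fderiv_modelJet_apply hφ _
  have hT1 : ∀ i, (T i).1.1 = dX i := fun i => by rw [hT]
  -- the term of the exterior derivative in which the vertical vector differentiates is treated
  -- apart from those in which the tangent vectors `T i` of the prolonged section do
  rw [extDeriv_apply (differentiableAt_modelCartan hℓ hR), Fin.sum_univ_succ, sub_mul]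
  have hrem : ∀ i : Fin (n + 1), i.succ.removeNth
      (Fin.cons ((0, w), B) T : Fin (n + 2) → EJ n m) =
      Fin.cons ((0, w), B) (i.removeNth T) := fun i => Fin.cons_comp_succ_succAbove _ _ _
  rw [sub_eq_add_neg]
  congr 1
  · have h0 : (0 : Fin (n + 2)).removeNth (Fin.cons ((0, w), B) T : Fin (n + 2) → EJ n m) = T := by
      ext1 i; simp [Fin.removeNth]
    simp only [Fin.val_zero, pow_zero, one_smul, Fin.cons_zero, h0]
    have hfun : (fun q => modelCartan η R ℓ q T) = fun q : EJ n m => (ℓ q * R q.1.1 +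
        ∑ μ : Fin (n + 1), R q.1.1 * partialA ℓ q ((dXdual μ).smulRight
          ((T μ).1.2 - q.2 (dX μ)))) * η dX :=
      funext fun q => modelCartan_apply_lift q T hT1
    rw [hfun]
    choose c' hc' hc using fun μ : Fin (n + 1) => exists_hasFDerivAt_contact (T μ).1.2 μ q
    -- the contact form vanishes along the prolonged section
    have hc0 : ∀ μ : Fin (n + 1), (dXdual μ).smulRight ((T μ).1.2 - q.2 (dX μ)) = 0 := by
      intro μ
      have h1 : (T μ).1.2 - q.2 (dX μ) = 0 := by
        rw [hT]
        exact sub_self _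
      rw [h1]
      exact ContinuousLinearMap.ext fun v => smul_zero (dXdual μ v)
    have hRW : fderiv ℝ (fun q : EJ n m => R q.1.1) q ((0, w), B) = 0 := by
      have h1 : HasFDerivAt (fun q : EJ n m => R q.1.1) (fderiv ℝ R q.1.1 ∘L projX) q :=
        HasFDerivAt.comp (𝕜 := ℝ) q (f := fun q : EJ n m => q.1.1) hR.hasFDerivAt
          (projX (n := n) (m := m)).hasFDerivAt
      rw [h1.fderiv]
      simp
    have hBA : ∑ μ : Fin (n + 1), partialA ℓ q ((dXdual μ).smulRight (B (dX μ))) =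
        fderiv ℝ ℓ q (0, B) := by
      rw [← map_sum, sum_dXdual_smulRight, partialA_eq hdℓ]; rfl
    have hsplit : fderiv ℝ ℓ q ((0, w), B) = fderiv ℝ ℓ q ((0, w), 0) + fderiv ℝ ℓ q (0, B) := by
      rw [← map_add]; simp
    rw [partialY_apply hdℓ]
    have hcW : ∀ μ : Fin (n + 1), partialA ℓ q (c' μ ((0, w), B)) =
        -partialA ℓ q ((dXdual μ).smulRight (B (dX μ))) := by
      intro μ
      have : (dXdual μ).smulRight (-(B (dX μ))) = -(dXdual μ).smulRight (B (dX μ)) :=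
        ContinuousLinearMap.ext fun v => smul_neg (dXdual μ v) (B (dX μ))
      exact (congrArg (partialA ℓ q) ((hc' μ _).trans this)).trans (map_neg (partialA ℓ q) _)
    -- the derivative of the contact form in the direction `B` cancels that of `ℓ`
    refine (fderiv_mul_add_sum_of_eq_zero hdℓ hR' hA hc hc0 (η dX) _).trans ?_
    rw [hRW, hsplit, ← hBA, hq1, hRz]
    simp only [hcW, one_mul, mul_zero, zero_add, Finset.sum_neg_distrib]
    ring
  -- the derivatives along the prolonged section give the divergence of the momenta
  · rw [Finset.sum_mul, ← Finset.sum_neg_distrib]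
    refine Finset.sum_congr rfl fun μ _ => ?_
    simp only [hrem, Fin.cons_succ]
    have hfun : (fun q => modelCartan η R ℓ q (Fin.cons ((0, w), B) (μ.removeNth T))) =
        fun q : EJ n m => (R q.1.1 * partialA ℓ q ((dXdual μ).smulRight w)) *
          ((-1) ^ (μ : ℕ) * η dX) := by
      ext1 q
      rw [modelCartan_apply_vertical q _ rfl T hT1]
      ring
    have hg : DifferentiableAt ℝ
        (fun q : EJ n m => R q.1.1 * partialA ℓ q ((dXdual μ).smulRight w)) q :=
      hR'.mul (hA.clm_apply (differentiableAt_const _))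
    have hcomp : fderiv ℝ (fun z => R z * partialA ℓ (modelJet φ z) ((dXdual μ).smulRight w)) z =
        fderiv ℝ (fun q : EJ n m => R q.1.1 * partialA ℓ q ((dXdual μ).smulRight w)) q ∘L
          fderiv ℝ (modelJet φ) z :=
      (HasFDerivAt.comp (𝕜 := ℝ) z (f := modelJet φ) hg.hasFDerivAt hj.hasFDerivAt).fderiv
    rw [hfun, fderiv_mul_const hg, hcomp]
    have : (-1 : ℝ) ^ (μ : ℕ) * (-1) ^ (μ : ℕ) = 1 := by rw [← mul_pow]; simp
    simp only [smul_apply, smul_eq_mul, ContinuousLinearMap.comp_apply, Fin.val_succ, pow_succ]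
    linear_combination (-(fderiv ℝ (fun q : EJ n m => R q.1.1 * partialA ℓ q
      ((dXdual μ).smulRight w)) q (T μ) * η dX)) * this

end ModelCartan

/-! ### The coordinate expression of the Cartan form on the jet bundle -/

section CartanCharts
variable {n m : ℕ}
  {M : Type*} [TopologicalSpace M] [ChartedSpace (EuclideanSpace ℝ (Fin n)) M]
  [IsManifold (𝓡 n) ∞ M]
  {S : Type*} [TopologicalSpace S] [ChartedSpace (EuclideanSpace ℝ (Fin m)) S]
  [IsManifold (𝓡 m) ∞ S]
  {e : OpenPartialHomeomorph M (EuclideanSpace ℝ (Fin n))}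
  {e' : OpenPartialHomeomorph S (EuclideanSpace ℝ (Fin m))}
  {ηM : (p : M) → TangentSpace (𝓡 n) p [⋀^Fin n]→L[ℝ] ℝ} {L : J1 n m M S → ℝ}

/-- The Lagrangian in coordinates, as a function on the model space of `J¹π`. -/
def lagr (L : J1 n m M S → ℝ) (e : OpenPartialHomeomorph M (EuclideanSpace ℝ (Fin n)))
    (e' : OpenPartialHomeomorph S (EuclideanSpace ℝ (Fin m))) (q : EJ n m) : ℝ :=
  L (jetParam e e' q)

/-- The fibre derivative of `L` on the tensor `ξ ⊗ ∂/∂y^a` in coordinates. -/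
theorem fibreDeriv_jetParam (hL : ContMDiff (IJ n m) 𝓘(ℝ, ℝ) ∞ L)
    (he : IsSmoothChart (𝓡 n) e) (he' : IsSmoothChart (𝓡 m) e') {q : EJ n m}
    (h1 : q.1.1.2 ∈ e.target) (h2 : q.1.2 ∈ e'.target) (ξ : EX n →L[ℝ] ℝ) (c : ES m) :
    fibreDeriv L (jetParam e e' q)
      (ξ.smulRight (mfderiv (𝓡 m) (𝓡 m) e'.symm q.1.2 c : ES m)) =
    partialA (lagr L e e') q ((ξ ∘L (mfderiv 𝓘(ℝ, EX n) (IX n) (xChart e).symm q.1.1 :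
      EX n →L[ℝ] EX n)).smulRight c) := by
  have hx := isSmoothChart_xChart he
  have h1' : q.1.1 ∈ (xChart e).target := mem_xChart_target.2 h1
  set T : EX n →L[ℝ] EX n := mfderiv 𝓘(ℝ, EX n) (IX n) (xChart e).symm q.1.1 with hT
  set Dx : EX n →L[ℝ] EX n :=
    mfderiv (IX n) 𝓘(ℝ, EX n) (xChart e) ((xChart e).symm q.1.1) with hDx
  set σ : ES m →L[ℝ] ES m := mfderiv (𝓡 m) (𝓡 m) e'.symm q.1.2 with hσ
  let σ' : ES m →L[ℝ] ES m := mfderiv (𝓡 m) (𝓡 m) e' (e'.symm q.1.2)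
  have hTD : ∀ v, T (Dx v) = v := by
    intro v
    have := hx.mfderiv_symm_comp ((xChart e).map_target h1') v
    rw [(xChart e).right_inv h1'] at this
    exact this
  have hDT : ∀ v, Dx (T v) = v := fun v => hx.mfderiv_comp_symm h1' v
  have hσ1 : ∀ v, σ' (σ v) = v := fun v => he'.mfderiv_comp_symm h2 v
  have hσ2 : ∀ v, σ (σ' v) = v := by
    intro v
    have := he'.mfderiv_symm_comp (e'.map_target h2) v
    rw [e'.right_inv h2] at this
    exact this
  let K' : (EX n →L[ℝ] ES m) →L[ℝ] (EX n →L[ℝ] ES m) :=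
    (ContinuousLinearMap.compL ℝ (EX n) (ES m) (ES m) σ') ∘L
      ((ContinuousLinearMap.compL ℝ (EX n) (EX n) (ES m)).flip T)
  have hK' : ∀ B v, K' B v = σ' (B (T v)) := fun B v => rfl
  have hG : (fun B : EX n →L[ℝ] ES m => L ⟨(jetParam e e' q : J1 n m M S).proj, B⟩) =
      fun B => (fun B => lagr L e e' (q.1, B)) (K' B) := by
    funext B
    change _ = L ⟨(jetParam e e' q : J1 n m M S).proj, σ ∘L K' B ∘L Dx⟩
    have : σ ∘L K' B ∘L Dx = B := by
      refine ContinuousLinearMap.ext fun v => ?_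
      simp only [ContinuousLinearMap.comp_apply, hK', hTD, hσ2]
    exact congrArg (fun B' : EX n →L[ℝ] ES m =>
      L ⟨(jetParam e e' q : J1 n m M S).proj, B'⟩) this.symm
  have hq2 : K' (σ ∘L q.2 ∘L Dx) = q.2 := by
    refine ContinuousLinearMap.ext fun v => ?_
    simp only [ContinuousLinearMap.comp_apply, hK', hDT, hσ1]
  have hℓ : DifferentiableAt ℝ (lagr L e e') q :=
    (contDiffAt_lagrangian hL he he' h1 h2).differentiableAt (by simp)
  have hA : HasFDerivAt (fun B => lagr L e e' (q.1, B)) (partialA (lagr L e e') q)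
      (K' (σ ∘L q.2 ∘L Dx)) := by
    rw [hq2, partialA_eq hℓ]
    exact hℓ.hasFDerivAt.comp (𝕜 := ℝ) q.2 (hasFDerivAt_prodMk_right q.1 q.2)
  have hfib : fibreDeriv L (jetParam e e' q) = partialA (lagr L e e') q ∘L K' := by
    have h3 : fibreDeriv L (jetParam e e' q) = fderiv ℝ (fun B : EX n →L[ℝ] ES m =>
      L ⟨(jetParam e e' q : J1 n m M S).proj, B⟩) (σ ∘L q.2 ∘L Dx) := rfl
    rw [h3, hG]
    exact (hA.comp (𝕜 := ℝ) (σ ∘L q.2 ∘L Dx) K'.hasFDerivAt).fderiv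
  have hK2 : K' (ξ.smulRight (σ c)) = (ξ ∘L T).smulRight c := by
    refine ContinuousLinearMap.ext fun v => ?_
    exact (map_smul σ' (ξ (T v)) (σ c)).trans (congrArg (fun w => ξ (T v) • w) (hσ1 c))
  rw [hfib]
  exact congrArg (partialA (lagr L e e') q) hK2

theorem mfderiv_projX_jetParam (he : IsSmoothChart (𝓡 n) e) (he' : IsSmoothChart (𝓡 m) e')
    {q : EJ n m} (h1 : q.1.1.2 ∈ e.target) (h2 : q.1.2 ∈ e'.target) (u : EJ n m) :
    (mfderiv (IJ n m) (IX n) (fun γ : J1 n m M S => γ.proj.1) (jetParam e e' q)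
      (mfderiv 𝓘(ℝ, EJ n m) (IJ n m) (jetParam e e' : EJ n m → J1 n m M S) q u) : EX n) =
    mfderiv 𝓘(ℝ, EX n) (IX n) (xChart e).symm q.1.1 u.1.1 := by
  have hj := (contMDiffAt_jetParam he he' h1 h2).mdifferentiableAt (by simp)
  have hp : MDifferentiableAt (IJ n m) (IX n) (fun γ : J1 n m M S => γ.proj.1)
      (jetParam e e' q) :=
    ((contMDiff_fst.comp (contMDiff_proj (n := ∞) (IB := IY n m)
      (fun y => TXY n m M S y →L[ℝ] TSY n m M S y))).contMDiffAt).mdifferentiableAt (by simp)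
  have h3 := mfderiv_comp (I' := IJ n m) q hp hj
  have h4 : HasMFDerivAt 𝓘(ℝ, EJ n m) 𝓘(ℝ, EX n) (fun q : EJ n m => q.1.1) q
      (projX (n := n) (m := m)) := (projX (n := n) (m := m)).hasFDerivAt.hasMFDerivAt
  have h5 := HasMFDerivAt.comp q ((isSmoothChart_xChart he).mdifferentiableAt_symm
    (mem_xChart_target.2 h1)).hasMFDerivAt h4
  have h6 := h3.symm.trans h5.mfderiv
  exact congrArg (fun T : EJ n m →L[ℝ] EX n => T u) h6

theorem mfderiv_projS_jetParam (he : IsSmoothChart (𝓡 n) e) (he' : IsSmoothChart (𝓡 m) e')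
    {q : EJ n m} (h1 : q.1.1.2 ∈ e.target) (h2 : q.1.2 ∈ e'.target) (u : EJ n m) :
    (mfderiv (IJ n m) (𝓡 m) (fun γ : J1 n m M S => γ.proj.2) (jetParam e e' q)
      (mfderiv 𝓘(ℝ, EJ n m) (IJ n m) (jetParam e e' : EJ n m → J1 n m M S) q u) : ES m) =
    mfderiv (𝓡 m) (𝓡 m) e'.symm q.1.2 u.1.2 := by
  have hj := (contMDiffAt_jetParam he he' h1 h2).mdifferentiableAt (by simp)
  have hp : MDifferentiableAt (IJ n m) (𝓡 m) (fun γ : J1 n m M S => γ.proj.2)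
      (jetParam e e' q) :=
    ((contMDiff_snd.comp (contMDiff_proj (n := ∞) (IB := IY n m)
      (fun y => TXY n m M S y →L[ℝ] TSY n m M S y))).contMDiffAt).mdifferentiableAt (by simp)
  have h3 := mfderiv_comp (I' := IJ n m) q hp hj
  have h4 : HasMFDerivAt 𝓘(ℝ, EJ n m) 𝓘(ℝ, ES m) (fun q : EJ n m => q.1.2) q
      (projS (n := n) (m := m)) := (projS (n := n) (m := m)).hasFDerivAt.hasMFDerivAt
  have h5 := HasMFDerivAt.comp q (he'.mdifferentiableAt_symm h2).hasMFDerivAt h4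
  have h6 := h3.symm.trans h5.mfderiv
  exact congrArg (fun T : EJ n m →L[ℝ] ES m => T u) h6

/-- The Cartan form in the coordinates `(x^μ, y^a, y^a_μ)`. Any factorization `R η` of the volume
form into a function and a constant form is allowed. -/
theorem cartanForm_jetParam (hL : ContMDiff (IJ n m) 𝓘(ℝ, ℝ) ∞ L)
    (he : IsSmoothChart (𝓡 n) e) (he' : IsSmoothChart (𝓡 m) e') {q : EJ n m}
    (h1 : q.1.1.2 ∈ e.target) (h2 : q.1.2 ∈ e'.target)
    (η : EX n [⋀^Fin (n + 1)]→L[ℝ] ℝ) (R : EX n → ℝ)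
    (hR : R q.1.1 * η dX = density ηM e q.1.1.2) (u : Fin (n + 1) → EJ n m) :
    cartanForm ηM L (jetParam e e' q) (fun i =>
      mfderiv 𝓘(ℝ, EJ n m) (IJ n m) (jetParam e e' : EJ n m → J1 n m M S) q (u i)) =
    modelCartan η R (lagr L e e') q u := by
  have hx := isSmoothChart_xChart he
  have h1' : q.1.1 ∈ (xChart e).target := mem_xChart_target.2 h1
  set T : EX n →L[ℝ] EX n := mfderiv 𝓘(ℝ, EX n) (IX n) (xChart e).symm q.1.1 with hT
  set σ : ES m →L[ℝ] ES m := mfderiv (𝓡 m) (𝓡 m) e'.symm q.1.2 with hσ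
  let ηx : EX n [⋀^Fin (n + 1)]→L[ℝ] ℝ := volForm ηM ((xChart e).symm q.1.1)
  have hη : ηx.compContinuousLinearMap T = R q.1.1 • η := by
    apply topForm_ext
    rw [ContinuousAlternatingMap.smul_apply, smul_eq_mul, hR]
    exact volForm_xChart he h1
  have hη' : ∀ v : Fin (n + 1) → EX n, ηx (fun i => T (v i)) = R q.1.1 * η v :=
    fun v => congrArg (fun F : EX n [⋀^Fin (n + 1)]→L[ℝ] ℝ => F v) hη
  let TX : EJ n m →L[ℝ] EX n :=
    mfderiv (IJ n m) (IX n) (fun γ : J1 n m M S => γ.proj.1) (jetParam e e' q)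
  let TS : EJ n m →L[ℝ] ES m :=
    mfderiv (IJ n m) (𝓡 m) (fun γ : J1 n m M S => γ.proj.2) (jetParam e e' q)
  let P : EJ n m →L[ℝ] EJ n m :=
    mfderiv 𝓘(ℝ, EJ n m) (IJ n m) (jetParam e e' : EJ n m → J1 n m M S) q
  let A : EX n →L[ℝ] ES m := (jetParam e e' q : J1 n m M S).snd
  have hX : ∀ i, TX (P (u i)) = T (u i).1.1 :=
    fun i => mfderiv_projX_jetParam he he' h1 h2 (u i)
  have hS : ∀ i, TS (P (u i)) = σ (u i).1.2 :=
    fun i => mfderiv_projS_jetParam he he' h1 h2 (u i)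
  have hA : ∀ v, A (T v) = σ (q.2 v) :=
    fun v => congrArg (fun w => σ (q.2 w)) (hx.mfderiv_comp_symm h1' v)
  have hθ : ∀ i, TS (P (u i)) - A (TX (P (u i))) = σ ((u i).1.2 - q.2 (u i).1.1) := by
    intro i
    rw [hX, hS, hA, map_sub]
  have hL0 : cartanForm ηM L (jetParam e e' q) (fun i => P (u i)) =
      lagr L e e' q * ηx (fun i => TX (P (u i))) + ∑ μ : Fin (n + 1), ∑ i : Fin (n + 1),
        (-1) ^ (i : ℕ) * (fibreDeriv L (jetParam e e' q) ((dXdual μ).smulRight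
          (TS (P (u i)) - A (TX (P (u i))))) *
          ηx (Matrix.vecCons (dX μ) (i.removeNth fun i => TX (P (u i))))) := by
    simp only [cartanForm]
    refine (ContinuousAlternatingMap.add_apply _ _ _).trans ?_
    congr 1
    refine (ContinuousAlternatingMap.sum_apply _ _).trans ?_
    exact Finset.sum_congr rfl fun μ _ => wedgeOne_apply _ _ _
  have hL1 : cartanForm ηM L (jetParam e e' q) (fun i => P (u i)) =
      lagr L e e' q * ηx (fun i => T (u i).1.1) + ∑ μ : Fin (n + 1), ∑ i : Fin (n + 1),
        (-1) ^ (i : ℕ) * (partialA (lagr L e e') q ((dXdual μ ∘L T).smulRight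
          ((u i).1.2 - q.2 (u i).1.1)) *
          ηx (Matrix.vecCons (dX μ) (i.removeNth fun i => T (u i).1.1))) := by
    rw [hL0]
    simp only [hθ]
    simp only [hX]
    congr 1
    refine Finset.sum_congr rfl fun μ _ => Finset.sum_congr rfl fun i _ => ?_
    exact congrArg (fun r => (-1 : ℝ) ^ (i : ℕ) * (r *
      ηx (Matrix.vecCons (dX μ) (i.removeNth fun i => T (u i).1.1))))
      (fibreDeriv_jetParam hL he he' h1 h2 (dXdual μ) ((u i).1.2 - q.2 (u i).1.1))
  refine hL1.trans ?_
  rw [modelCartan_apply, hη' (fun i => (u i).1.1), mul_assoc]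
  congr 1
  rw [Finset.sum_comm, Finset.sum_comm (γ := Fin (n + 1)) (α := Fin (n + 1))
    (f := fun μ i => (-1 : ℝ) ^ (i : ℕ) * (R q.1.1 * partialA (lagr L e e') q
      ((dXdual μ).smulRight ((u i).1.2 - q.2 (u i).1.1)) *
        η (Matrix.vecCons (dX μ) (i.removeNth fun i => (u i).1.1))))]
  refine Finset.sum_congr rfl fun i _ => ?_
  rw [← Finset.mul_sum, ← Finset.mul_sum]
  congr 1
  let c : ES m := (u i).1.2 - q.2 (u i).1.1
  let g : (EX n →L[ℝ] ℝ) →L[ℝ] ℝ := partialA (lagr L e e') q ∘L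
    ((ContinuousLinearMap.smulRightL ℝ (EX n) (ES m)).flip c)
  let h : EX n →ₗ[ℝ] ℝ :=
    { toFun := fun v => ηx (Matrix.vecCons v (i.removeNth fun i => T (u i).1.1))
      map_add' := fun v w => ηx.map_vecCons_add _ v w
      map_smul' := fun a v => ηx.map_vecCons_smul _ a v }
  -- the derivative `T` of the chart passes from the covectors `dx^μ` to the vectors `∂_μ`
  refine (sum_comp_eq_sum (g := g) (h := h) T).trans ?_
  refine Finset.sum_congr rfl fun μ _ => ?_
  have h3 : h (T (dX μ)) =
      R q.1.1 * η (Matrix.vecCons (dX μ) (i.removeNth fun i => (u i).1.1)) := by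
    rw [← hη']
    refine congrArg ηx (funext fun j => ?_)
    refine Fin.cases rfl (fun k => rfl) j
  rw [h3]
  change partialA (lagr L e e') q ((dXdual μ).smulRight c) * _ = _
  ring

end CartanCharts

/-! ### The pullback of the contraction of `Ω_L` -/

theorem contDiffAt_real_smul {E F : Type*} [NormedAddCommGroup E] [NormedSpace ℝ E]
    [NormedAddCommGroup F] [NormedSpace ℝ F] {a : E → ℝ} {b : E → F} {z : E}
    (ha : ContDiffAt ℝ ∞ a z) (hb : ContDiffAt ℝ ∞ b z) :
    ContDiffAt ℝ ∞ (fun z => a z • b z) z := ha.smul hb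

/-- The derivative at `p` of the preferred chart at `p` is the identity. -/
theorem mfderiv_extChartAt_self {E : Type*} [NormedAddCommGroup E] [NormedSpace ℝ E]
    {H : Type*} [TopologicalSpace H] {I : ModelWithCorners ℝ E H} [I.Boundaryless]
    {N : Type*} [TopologicalSpace N] [ChartedSpace H N] [IsManifold I 1 N] (p : N) (v : E) :
    (mfderiv I 𝓘(ℝ, E) (extChartAt I p) p v : E) = v := by
  have hd : MDifferentiableAt I 𝓘(ℝ, E) (extChartAt I p) p :=
    (contMDiffAt_extChartAt (n := 1)).mdifferentiableAt (by simp)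
  have h1 : fderivWithin ℝ (writtenInExtChartAt I 𝓘(ℝ, E) p (extChartAt I p)) (range I)
      (extChartAt I p p) = ContinuousLinearMap.id ℝ E := by
    rw [ModelWithCorners.range_eq_univ, fderivWithin_univ]
    have h2 : writtenInExtChartAt I 𝓘(ℝ, E) p (extChartAt I p) =ᶠ[𝓝 (extChartAt I p p)] id := by
      filter_upwards [extChartAt_target_mem_nhds (I := I) p] with w hw
      exact (extChartAt I p).right_inv hw
    rw [h2.fderiv_eq, fderiv_id]
  exact (congrArg (fun T : E →L[ℝ] E => T v) hd.mfderiv).trans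
    (congrArg (fun T : E →L[ℝ] E => T v) h1)

/-- The chart expression of a form may be computed with any local parametrization which agrees
with the inverse of the chart. -/
theorem formInChart_apply_of_eventuallyEq {E : Type*} [NormedAddCommGroup E] [NormedSpace ℝ E]
    {H : Type*} [TopologicalSpace H] {I : ModelWithCorners ℝ E H}
    {N : Type*} [TopologicalSpace N] [ChartedSpace H N] {r : ℕ}
    (w : (q : N) → TangentSpace I q [⋀^Fin r]→L[ℝ] ℝ) (p : N) {G : E → N} {z : E}
    (h : (extChartAt I p).symm =ᶠ[𝓝 z] G) (u : Fin r → E) :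
    formInChart I w p z u = w (G z) (fun i => mfderiv 𝓘(ℝ, E) I G z (u i)) := by
  have h1 : mfderiv 𝓘(ℝ, E) I (extChartAt I p).symm z = mfderiv 𝓘(ℝ, E) I G z := h.mfderiv_eq
  simp only [formInChart]
  rw [h1, h.self_of_nhds]
  rfl

section IntrinsicForm
variable {n m : ℕ}
  {M : Type*} [TopologicalSpace M] [ChartedSpace (EuclideanSpace ℝ (Fin n)) M]
  [IsManifold (𝓡 n) ∞ M]
  {S : Type*} [TopologicalSpace S] [ChartedSpace (EuclideanSpace ℝ (Fin m)) S]
  [IsManifold (𝓡 m) ∞ S]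
  {e : OpenPartialHomeomorph M (EuclideanSpace ℝ (Fin n))}
  {e' : OpenPartialHomeomorph S (EuclideanSpace ℝ (Fin m))}
  {ηM : (p : M) → TangentSpace (𝓡 n) p [⋀^Fin n]→L[ℝ] ℝ} {L : J1 n m M S → ℝ}
  {f : ℝ × M → S}

/-- The Euler–Lagrange covector along `φ` in the charts `e`, `e'`, evaluated on a vector `w` given
by its components in the chart `e'`. The vector stands inside the derivatives, as the basis vector
does in `eulerLagrange`; linearity in `w` therefore requires the smoothness of the momenta, see
`elForm_eq_elCovector`. -/
def elForm (ηM : (p : M) → TangentSpace (𝓡 n) p [⋀^Fin n]→L[ℝ] ℝ) (L : J1 n m M S → ℝ)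
    (f : ℝ × M → S) (e : OpenPartialHomeomorph M (EuclideanSpace ℝ (Fin n)))
    (e' : OpenPartialHomeomorph S (EuclideanSpace ℝ (Fin m))) (x : ℝ × M) (w : ES m) : ℝ :=
  partialY (lagr L e e') (modelJet (fieldInCharts f e e') (xChart e x)) w -
    (density ηM e (e x.2))⁻¹ * ∑ μ : Fin (n + 1), fderiv ℝ (fun z : EX n => density ηM e z.2 *
      partialA (lagr L e e') (modelJet (fieldInCharts f e e') z) ((dXdual μ).smulRight w))
        (xChart e x) (dX μ)

theorem eulerLagrange_eq_elForm (x : ℝ × M) (a : Fin m) :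
    eulerLagrange ηM L f e e' x a = elForm ηM L f e e' x (EuclideanSpace.single a 1) := rfl

theorem elForm_zero (x : ℝ × M) : elForm ηM L f e e' x 0 = 0 := by
  rw [elForm, map_zero]
  simp only [dXdual_smulRight_zero, map_zero, mul_zero]
  simp

theorem contDiffAt_fieldInCharts (he : IsSmoothChart (𝓡 n) e) (he' : IsSmoothChart (𝓡 m) e')
    {z : EX n} (hz : z ∈ (xChart e).target)
    (hf : ContMDiffAt (IX n) (𝓡 m) ∞ f ((xChart e).symm z))
    (h2 : f ((xChart e).symm z) ∈ e'.source) : ContDiffAt ℝ ∞ (fieldInCharts f e e') z :=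
  ((he'.contMDiffAt h2).comp z (hf.comp z
    ((isSmoothChart_xChart he).contMDiffAt_symm hz))).contDiffAt

theorem fieldInCharts_xChart {x : ℝ × M} (h1 : x.2 ∈ e.source) :
    fieldInCharts f e e' (xChart e x) = e' (f x) := by
  have hl : (xChart e).symm (xChart e x) = x := (xChart e).left_inv (mem_xChart_source.2 h1)
  change e' (f ((xChart e).symm (xChart e x))) = _
  rw [hl]

theorem contDiffAt_lagr_modelJet (hL : ContMDiff (IJ n m) 𝓘(ℝ, ℝ) ∞ L)
    (he : IsSmoothChart (𝓡 n) e) (he' : IsSmoothChart (𝓡 m) e') {z : EX n}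
    (hz : z ∈ (xChart e).target) (h2 : f ((xChart e).symm z) ∈ e'.source) :
    ContDiffAt ℝ ∞ (lagr L e e') (modelJet (fieldInCharts f e e') z) :=
  contDiffAt_lagrangian hL he he' (mem_xChart_target.1 hz) (e'.map_source h2)

/-- The momenta `ρ ∂L/∂y^a_μ`, contracted with a vector, are smooth along the field. -/
theorem contDiffAt_momentum (hηM : IsSmoothForm (𝓡 n) ηM) (hL : ContMDiff (IJ n m) 𝓘(ℝ, ℝ) ∞ L)
    (he : IsSmoothChart (𝓡 n) e) (he' : IsSmoothChart (𝓡 m) e')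
    {z : EX n} (hz : z ∈ (xChart e).target)
    (hf : ContMDiffAt (IX n) (𝓡 m) ∞ f ((xChart e).symm z))
    (h2 : f ((xChart e).symm z) ∈ e'.source) :
    ContDiffAt ℝ ∞ (fun z : EX n => density ηM e z.2 •
      partialA (lagr L e e') (modelJet (fieldInCharts f e e') z)) z := by
  have h3 : ContDiffAt ℝ ∞ (fun z : EX n => density ηM e z.2) z :=
    ContDiffAt.comp (𝕜 := ℝ) z (f := fun z : EX n => z.2)
      (contDiffAt_density hηM he (mem_xChart_target.1 hz)) contDiffAt_snd
  have h4 := contDiffAt_partialA (contDiffAt_lagr_modelJet hL he he' hz h2)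
  have h5 := contDiffAt_modelJet (contDiffAt_fieldInCharts he he' hz hf h2)
  exact contDiffAt_real_smul h3
    (ContDiffAt.comp (𝕜 := ℝ) z (f := modelJet (fieldInCharts f e e')) h4 h5)

/-- For preferred charts, `jetParam` inverts the preferred chart of `J¹π`. -/
theorem extChartAt_jetParam (γ : J1 n m M S) {q : EJ n m}
    (h1 : q.1.1.2 ∈ (chartAt (EuclideanSpace ℝ (Fin n)) γ.proj.1.2).target)
    (h2 : q.1.2 ∈ (chartAt (EuclideanSpace ℝ (Fin m)) γ.proj.2).target) :
    extChartAt (IJ n m) γ (jetParam (chartAt (EuclideanSpace ℝ (Fin n)) γ.proj.1.2)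
      (chartAt (EuclideanSpace ℝ (Fin m)) γ.proj.2) q) = q := by
  set e0 := chartAt (EuclideanSpace ℝ (Fin n)) γ.proj.1.2 with he0
  set e0' := chartAt (EuclideanSpace ℝ (Fin m)) γ.proj.2 with he0'
  have hs0 : IsSmoothChart (𝓡 m) e0' := isSmoothChart_chartAt _
  have hx0 : IsSmoothChart (IX n) (xChart e0) := isSmoothChart_xChart (isSmoothChart_chartAt _)
  have h1' : q.1.1 ∈ (xChart e0).target := mem_xChart_target.2 h1
  refine (extChartAt_J1_apply γ (jetParam e0 e0' q) (e0.map_target h1) (e0'.map_target h2)).trans ?_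
  have r1 : xChart e0 ((xChart e0).symm q.1.1) = q.1.1 := (xChart e0).right_inv h1'
  refine Prod.ext (Prod.ext r1 (e0'.right_inv h2)) (ContinuousLinearMap.ext fun v => ?_)
  let T : EX n →L[ℝ] EX n := mfderiv 𝓘(ℝ, EX n) (IX n) (xChart e0).symm q.1.1
  let Dx : EX n →L[ℝ] EX n :=
    mfderiv (IX n) 𝓘(ℝ, EX n) (xChart e0) ((xChart e0).symm q.1.1)
  let T' : EX n →L[ℝ] EX n := mfderiv 𝓘(ℝ, EX n) (IX n) (xChart e0).symm
    (xChart e0 ((xChart e0).symm q.1.1))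
  have hT : T' v = T v := by simp only [T', T]; rw [r1]
  have hD : Dx (T v) = v := hx0.mfderiv_comp_symm h1' v
  refine (hs0.mfderiv_comp_symm h2 (q.2 (Dx (T' v)))).trans ?_
  rw [hT, hD]
  rfl

theorem eventually_jet_eq (he : IsSmoothChart (𝓡 n) e) (he' : IsSmoothChart (𝓡 m) e')
    {x : ℝ × M} (hf : ContMDiffAt (IX n) (𝓡 m) ∞ f x) (h1 : x.2 ∈ e.source)
    (h2 : f x ∈ e'.source) :
    ∀ᶠ x' in 𝓝 x, jet f x' =
      jetParam e e' (modelJet (fieldInCharts f e e') (xChart e x')) := by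
  filter_upwards [(contMDiffAt_iff_contMDiffAt_nhds (by simp)).1 (hf.of_le (m := 1) (by simp)),
    hf.continuousAt.preimage_mem_nhds (e'.open_source.mem_nhds h2),
    (xChart e).open_source.mem_nhds (mem_xChart_source.2 h1)] with x' a1 a2 a3
  rw [jet_eq_jetParam he he' (a1.mdifferentiableAt (by simp)) (mem_xChart_source.1 a3) a2]
  rfl

theorem contMDiffAt_jet {x : ℝ × M} (hf : ContMDiffAt (IX n) (𝓡 m) ∞ f x) :
    ContMDiffAt (IX n) (IJ n m) ∞ (jet f : ℝ × M → J1 n m M S) x := by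
  set e := chartAt (EuclideanSpace ℝ (Fin n)) x.2
  set e' := chartAt (EuclideanSpace ℝ (Fin m)) (f x)
  have he : IsSmoothChart (𝓡 n) e := isSmoothChart_chartAt _
  have he' : IsSmoothChart (𝓡 m) e' := isSmoothChart_chartAt _
  have h1 : x.2 ∈ e.source := mem_chart_source _ _
  have h2 : f x ∈ e'.source := mem_chart_source _ _
  have h1' : x ∈ (xChart e).source := mem_xChart_source.2 h1
  have hl : (xChart e).symm (xChart e x) = x := (xChart e).left_inv h1'
  refine ContMDiffAt.congr_of_eventuallyEq ?_ (eventually_jet_eq he he' hf h1 h2)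
  have h3 := (contDiffAt_modelJet (contDiffAt_fieldInCharts he he' ((xChart e).map_source h1')
    (by rwa [hl]) (by rwa [hl]))).contMDiffAt
  have h4 := h3.comp x ((isSmoothChart_xChart he).contMDiffAt h1')
  refine ContMDiffAt.comp x (contMDiffAt_jetParam he he' ?_ ?_) h4
  · exact e.map_source h1
  · change fieldInCharts f e e' (xChart e x) ∈ _
    rw [fieldInCharts_xChart h1]
    exact e'.map_source h2

set_option maxHeartbeats 1000000 in
/-- The tangent map of `j¹φ`, in the preferred charts. -/
theorem mfderiv_jet_eq {x : ℝ × M} (hf : ContMDiffAt (IX n) (𝓡 m) ∞ f x) (v : EX n) :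
    (mfderiv (IX n) (IJ n m) (jet f : ℝ × M → J1 n m M S) x v : EJ n m) =
      fderiv ℝ (modelJet (fieldInCharts f (chartAt (EuclideanSpace ℝ (Fin n)) x.2)
        (chartAt (EuclideanSpace ℝ (Fin m)) (f x))))
        (xChart (chartAt (EuclideanSpace ℝ (Fin n)) x.2) x) v := by
  set e := chartAt (EuclideanSpace ℝ (Fin n)) x.2 with hedef
  set e' := chartAt (EuclideanSpace ℝ (Fin m)) (f x) with hedef'
  have he : IsSmoothChart (𝓡 n) e := isSmoothChart_chartAt _
  have he' : IsSmoothChart (𝓡 m) e' := isSmoothChart_chartAt _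
  have hx := isSmoothChart_xChart he
  have h1 : x.2 ∈ e.source := mem_chart_source _ _
  have h2 : f x ∈ e'.source := mem_chart_source _ _
  have h1' : x ∈ (xChart e).source := mem_xChart_source.2 h1
  have hl : (xChart e).symm (xChart e x) = x := (xChart e).left_inv h1'
  set φ := fieldInCharts f e e' with hφdef
  set z := xChart e x with hz
  have hzt : z ∈ (xChart e).target := (xChart e).map_source h1'
  have hφ : ContDiffAt ℝ ∞ φ z := contDiffAt_fieldInCharts he he' hzt (by rwa [hl]) (by rwa [hl])
  have hφz : φ z = e' (f x) := fieldInCharts_xChart h1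
  have hev := eventually_jet_eq he he' hf h1 h2
  have hext : ∀ q : EJ n m, q.1.1.2 ∈ e.target → q.1.2 ∈ e'.target →
      extChartAt (IJ n m) (jet f x) (jetParam e e' q) = q :=
    fun q a b => extChartAt_jetParam (jet f x) a b
  have hψ : MDifferentiableAt (IJ n m) 𝓘(ℝ, EJ n m) (extChartAt (IJ n m) (jet f x : J1 n m M S))
      (jet f x : J1 n m M S) := (contMDiffAt_extChartAt (n := 1)).mdifferentiableAt (by simp)
  have hjet : MDifferentiableAt (IX n) (IJ n m) (jet f : ℝ × M → J1 n m M S) x :=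
    (contMDiffAt_jet hf).mdifferentiableAt (by simp)
  have hm : MDifferentiableAt 𝓘(ℝ, EX n) 𝓘(ℝ, EJ n m) (modelJet φ) (xChart e x) :=
    ((contDiffAt_modelJet hφ).differentiableAt (by simp)).mdifferentiableAt
  have heq : extChartAt (IJ n m) (jet f x) ∘ (jet f : ℝ × M → J1 n m M S) =ᶠ[𝓝 x]
      modelJet φ ∘ xChart e := by
    filter_upwards [hev, (xChart e).open_source.mem_nhds h1',
      hf.continuousAt.preimage_mem_nhds (e'.open_source.mem_nhds h2)] with y a b c
    refine (congrArg (extChartAt (IJ n m) (jet f x)) a).trans (hext _ ?_ ?_)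
    · exact e.map_source (mem_xChart_source.1 b)
    · change φ (xChart e y) ∈ _
      rw [hφdef, fieldInCharts_xChart (mem_xChart_source.1 b)]
      exact e'.map_source c
  have c1 := hψ.hasMFDerivAt.comp x hjet.hasMFDerivAt
  have c2 := (hm.hasMFDerivAt.comp x (hx.mdifferentiableAt h1').hasMFDerivAt).congr_of_eventuallyEq
    heq
  have c3 := congrArg (fun T : EX n →L[ℝ] EJ n m => T v) (hasMFDerivAt_unique c1 c2)
  have c4 : (mfderiv (IX n) 𝓘(ℝ, EX n) (xChart e) x v : EX n) = v := by
    have := mfderiv_extChartAt_self (I := IX n) x v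
    rw [extChartAt_IX] at this
    exact this
  let Jv : EJ n m := mfderiv (IX n) (IJ n m) (jet f : ℝ × M → J1 n m M S) x v
  refine (mfderiv_extChartAt_self (I := IJ n m) (jet f x) Jv).symm.trans (c3.trans ?_)
  let F : EX n →L[ℝ] EJ n m := mfderiv 𝓘(ℝ, EX n) 𝓘(ℝ, EJ n m) (modelJet φ) (xChart e x)
  refine (congrArg F c4).trans ?_
  simp only [F, mfderiv_eq_fderiv]
  rfl

set_option maxHeartbeats 1000000 in
/-- The contraction of `Ω_L` with a vertical vector, pulled back by `j¹φ`, is minus the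
Euler–Lagrange covector times the volume form. -/
theorem pullbackContraction_apply_dX (hηM : IsSmoothForm (𝓡 n) ηM) (hηM0 : ∀ p, ηM p ≠ 0)
    (hL : ContMDiff (IJ n m) 𝓘(ℝ, ℝ) ∞ L) {x : ℝ × M} (hf : ContMDiffAt (IX n) (𝓡 m) ∞ f x)
    (W : (γ : J1 n m M S) → TangentSpace (IJ n m) γ) (w : ES m) (B : EX n →L[ℝ] ES m)
    (hW : W (jet f x) = (((0, w), B) : EJ n m)) :
    pullbackContraction ηM L f W x dX =
      -(elForm ηM L f (chartAt (EuclideanSpace ℝ (Fin n)) x.2)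
          (chartAt (EuclideanSpace ℝ (Fin m)) (f x)) x w *
        density ηM (chartAt (EuclideanSpace ℝ (Fin n)) x.2)
          (chartAt (EuclideanSpace ℝ (Fin n)) x.2 x.2)) := by
  set e := chartAt (EuclideanSpace ℝ (Fin n)) x.2 with hedef
  set e' := chartAt (EuclideanSpace ℝ (Fin m)) (f x) with hedef'
  have he : IsSmoothChart (𝓡 n) e := isSmoothChart_chartAt _
  have he' : IsSmoothChart (𝓡 m) e' := isSmoothChart_chartAt _
  have hx := isSmoothChart_xChart he
  have h1 : x.2 ∈ e.source := mem_chart_source _ _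
  have h2 : f x ∈ e'.source := mem_chart_source _ _
  have h1' : x ∈ (xChart e).source := mem_xChart_source.2 h1
  have hl : (xChart e).symm (xChart e x) = x := (xChart e).left_inv h1'
  set φ := fieldInCharts f e e' with hφdef
  set z := xChart e x with hz
  have hzt : z ∈ (xChart e).target := (xChart e).map_source h1'
  have hφ : ContDiffAt ℝ ∞ φ z := contDiffAt_fieldInCharts he he' hzt (by rwa [hl]) (by rwa [hl])
  have hℓ : ContDiffAt ℝ ∞ (lagr L e e') (modelJet φ z) :=
    contDiffAt_lagr_modelJet hL he he' hzt (by rwa [hl])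
  have hφz : φ z = e' (f x) := fieldInCharts_xChart h1
  have hev := eventually_jet_eq he he' hf h1 h2
  set q := modelJet φ z with hq
  have hγ : jet f x = jetParam e e' q := hev.self_of_nhds
  have hq1 : q.1.1.2 ∈ e.target := mem_xChart_target.1 hzt
  have hq2 : q.1.2 ∈ e'.target := by
    change φ z ∈ _
    rw [hφz]; exact e'.map_source h2
  have hext : ∀ q : EJ n m, q.1.1.2 ∈ e.target → q.1.2 ∈ e'.target →
      extChartAt (IJ n m) (jet f x) (jetParam e e' q) = q :=
    fun q a b => extChartAt_jetParam (jet f x) a b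
  have hγq : extChartAt (IJ n m) (jet f x) (jet f x) = q :=
    (congrArg (extChartAt (IJ n m) (jet f x)) hγ).trans (hext q hq1 hq2)
  have hjc := contMDiffAt_jetParam (M := M) (S := S) he he' hq1 hq2
  have hnear : ∀ᶠ p : EJ n m in 𝓝 q, p.1.1.2 ∈ e.target ∧ p.1.2 ∈ e'.target ∧
      (extChartAt (IJ n m) (jet f x)).symm =ᶠ[𝓝 p] jetParam e e' := by
    have o1 : ∀ᶠ p : EJ n m in 𝓝 q, p.1.1.2 ∈ e.target :=
      (e.open_target.preimage (continuous_snd.comp (continuous_fst.comp continuous_fst))).mem_nhds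
        hq1
    have o2 : ∀ᶠ p : EJ n m in 𝓝 q, p.1.2 ∈ e'.target :=
      (e'.open_target.preimage (continuous_snd.comp continuous_fst)).mem_nhds hq2
    have o3 : ∀ᶠ p : EJ n m in 𝓝 q,
        (jetParam e e' p : J1 n m M S) ∈ (extChartAt (IJ n m) (jet f x)).source :=
      hjc.continuousAt.preimage_mem_nhds
        (by rw [← hγ]; exact extChartAt_source_mem_nhds (I := IJ n m) (jet f x))
    filter_upwards [o1, o2, (o1.and (o2.and o3)).eventually_nhds] with p a b c
    refine ⟨a, b, ?_⟩
    filter_upwards [c] with p' hp'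
    have h3 := (extChartAt (IJ n m) (jet f x)).left_inv hp'.2.2
    rw [hext p' hp'.1 hp'.2.1] at h3
    exact h3
  -- the volume form in the chart, relative to its value at the centre
  set ρ := density ηM e with hρdef
  have hρz : ρ z.2 ≠ 0 := density_ne_zero hηM0 he hq1
  let R : EX n → ℝ := fun z' => (ρ z.2)⁻¹ * ρ z'.2
  have hRz : R z = 1 := inv_mul_cancel₀ hρz
  have hρd : DifferentiableAt ℝ (fun z' : EX n => ρ z'.2) z :=
    ((contDiffAt_density hηM he hq1).differentiableAt (by simp)).comp z differentiableAt_snd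
  have hR : DifferentiableAt ℝ R z := hρd.const_mul _
  let T : EX n →L[ℝ] EX n := mfderiv 𝓘(ℝ, EX n) (IX n) (xChart e).symm z
  let ηx : EX n [⋀^Fin (n + 1)]→L[ℝ] ℝ := volForm ηM ((xChart e).symm z)
  let η : EX n [⋀^Fin (n + 1)]→L[ℝ] ℝ := ηx.compContinuousLinearMap T
  have hη : η dX = ρ z.2 := volForm_xChart he hq1
  have hform : formInChart (IJ n m) (cartanForm ηM L) (jet f x) =ᶠ[𝓝 q]
      modelCartan η R (lagr L e e') := by
    filter_upwards [hnear] with p hp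
    obtain ⟨a, b, c⟩ := hp
    refine ContinuousAlternatingMap.ext fun u => ?_
    have h3 := cartanForm_jetParam hL he he' a b η R
      (by rw [hη]; change (ρ z.2)⁻¹ * ρ p.1.1.2 * ρ z.2 = ρ p.1.1.2; field_simp) u
    exact (formInChart_apply_of_eventuallyEq (cartanForm ηM L) (jet f x) c u).trans h3
  have hjd := mfderiv_jet_eq hf
  let Dψ : EJ n m →L[ℝ] EJ n m :=
    mfderiv (IJ n m) 𝓘(ℝ, EJ n m) (extChartAt (IJ n m) (jet f x : J1 n m M S)) (jet f x)
  have hDψ : ∀ v, Dψ v = v := mfderiv_extChartAt_self (I := IJ n m) (jet f x : J1 n m M S)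
  let J : EX n →L[ℝ] EJ n m := mfderiv (IX n) (IJ n m) (jet f : ℝ × M → J1 n m M S) x
  have hJ : ∀ v, J v = fderiv ℝ (modelJet φ) z v := hjd
  have hd : extDeriv (formInChart (IJ n m) (cartanForm ηM L) (jet f x))
      (extChartAt (IJ n m) (jet f x : J1 n m M S) (jet f x)) =
        extDeriv (modelCartan η R (lagr L e e')) q := by
    rw [hγq]
    exact hform.extDeriv_eq
  have hv : (fun i => Dψ ((Fin.cons (W (jet f x)) fun i => J (dX i) : Fin (n + 2) → EJ n m) i)) =
      (Fin.cons ((0, w), B) fun i => fderiv ℝ (modelJet φ) z (dX i) : Fin (n + 2) → EJ n m) := by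
    funext i
    rw [hDψ]
    refine Fin.cases ?_ (fun j => ?_) i
    · exact hW
    · exact hJ _
  have hval : pullbackContraction ηM L f W x dX = -(extDeriv (formInChart (IJ n m)
      (cartanForm ηM L) (jet f x)) (extChartAt (IJ n m) (jet f x) (jet f x))
      (fun i => Dψ ((Fin.cons (W (jet f x)) fun i => J (dX i) : Fin (n + 2) → EJ n m) i))) := rfl
  rw [hval, hd, hv, extDeriv_modelCartan hφ hℓ hR hRz, hη]
  have hmul : ∀ μ : Fin (n + 1), fderiv ℝ (fun z' =>
      R z' * partialA (lagr L e e') (modelJet φ z') ((dXdual μ).smulRight w)) z (dX μ) =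
      (ρ z.2)⁻¹ * fderiv ℝ (fun z' : EX n => ρ z'.2 *
      partialA (lagr L e e') (modelJet φ z') ((dXdual μ).smulRight w)) z (dX μ) := by
    intro μ
    have hP := ((contDiffAt_momentum hηM hL he he' hzt (by rwa [hl])
      (by rwa [hl])).differentiableAt (by simp)).clm_apply
        (differentiableAt_const ((dXdual μ).smulRight w))
    have := fderiv_const_mul hP (ρ z.2)⁻¹
    have h5 := congrArg (fun T : EX n →L[ℝ] ℝ => T (dX μ)) this
    refine Eq.trans ?_ h5
    refine congrArg (fun g : EX n → ℝ => fderiv ℝ g z (dX μ)) (funext fun z' => ?_)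
    exact mul_assoc _ _ _
  simp only [hmul, ← Finset.mul_sum]
  rfl

end IntrinsicForm

/-! ### Measures defined by a density in a chart -/

section ChartMeasure

theorem measurableSet_target_inter_preimage {N E : Type*} [TopologicalSpace N] [MeasurableSpace N]
    [BorelSpace N] [TopologicalSpace E] [MeasurableSpace E] [BorelSpace E]
    (c : OpenPartialHomeomorph N E) {A : Set N} (hA : MeasurableSet A) :
    MeasurableSet (c.target ∩ c.symm ⁻¹' A) := by
  have h : Measurable (c.target.domRestrict c.symm) := c.continuousOn_symm.domRestrict.measurable
  have h2 : c.target ∩ c.symm ⁻¹' A = Subtype.val '' (c.target.domRestrict c.symm ⁻¹' A) := by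
    ext z
    constructor
    · rintro ⟨h1, h2⟩
      exact ⟨⟨z, h1⟩, h2, rfl⟩
    · rintro ⟨⟨z', h1⟩, h2, rfl⟩
      exact ⟨h1, h2⟩
  rw [h2]
  exact c.open_target.measurableSet.subtype_image (h hA)

variable {N E : Type*} [TopologicalSpace N] [MeasurableSpace N]
    [BorelSpace N] [TopologicalSpace E] [MeasureSpace E] [BorelSpace E]
    [SFinite (volume : Measure E)] (c : OpenPartialHomeomorph N E)

/-- The measure on the domain of a chart with density `w` in the chart. -/
def chartMeasure (w : E → ENNReal) : Measure N :=
  Measure.map c.symm ((volume.restrict c.target).withDensity w)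

theorem aemeasurable_symm (w : E → ENNReal) :
    AEMeasurable c.symm ((volume.restrict c.target).withDensity w) :=
  (c.continuousOn_symm.aemeasurable c.open_target.measurableSet).mono_ac
    (withDensity_absolutelyContinuous _ _)

theorem chartMeasure_apply (w : E → ENNReal) {A : Set N} (hA : MeasurableSet A) :
    chartMeasure c w A = ∫⁻ z in c.target ∩ c.symm ⁻¹' A, w z := by
  rw [chartMeasure, Measure.map_apply_of_aemeasurable (aemeasurable_symm c w) hA,
    withDensity_apply', Measure.restrict_restrict' c.open_target.measurableSet, inter_comm]

theorem chartMeasure_inter_source (w : E → ENNReal) {A : Set N} (hA : MeasurableSet A) :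
    chartMeasure c w (A ∩ c.source) = chartMeasure c w A := by
  rw [chartMeasure_apply c w hA, chartMeasure_apply c w (hA.inter c.open_source.measurableSet)]
  congr 2
  ext z
  constructor
  · rintro ⟨h1, h2, h3⟩
    exact ⟨h1, h2⟩
  · rintro ⟨h1, h2⟩
    exact ⟨h1, h2, c.map_target h1⟩

/-- The restriction to `U` of a measure given by a density in a chart, as the image of a measure
on the part of the chart target lying over `U`. -/
theorem chartMeasure_restrict (w : E → ENNReal) {U : Set N} (hU : MeasurableSet U) :
    (chartMeasure c w).restrict U = Measure.map c.symm
      ((volume.restrict (c.target ∩ c.symm ⁻¹' U)).withDensity w) := by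
  rw [chartMeasure, Measure.restrict_map_of_aemeasurable (aemeasurable_symm c w) hU,
    restrict_withDensity', Measure.restrict_restrict' c.open_target.measurableSet, inter_comm]

variable {w : E → ℝ} {U : Set N} {g : N → ℝ}

theorem aestronglyMeasurable_withDensity_symm {ν : Measure N} (hU : MeasurableSet U)
    (hν : ν.restrict U = (chartMeasure c fun z => ENNReal.ofReal (w z)).restrict U)
    (hg : AEStronglyMeasurable g (ν.restrict U)) :
    AEStronglyMeasurable g (Measure.map c.symm
      ((volume.restrict (c.target ∩ c.symm ⁻¹' U)).withDensity fun z => ENNReal.ofReal (w z))) := by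
  rwa [← chartMeasure_restrict c _ hU, ← hν]

theorem aemeasurable_symm_restrict (hU : MeasurableSet U) (w : E → ENNReal) :
    AEMeasurable c.symm ((volume.restrict (c.target ∩ c.symm ⁻¹' U)).withDensity w) :=
  ((c.continuousOn_symm.mono inter_subset_left).aemeasurable
    (measurableSet_target_inter_preimage c hU)).mono_ac (withDensity_absolutelyContinuous _ _)

theorem setIntegral_chartMeasure {ν : Measure N} (hU : MeasurableSet U)
    (hν : ν.restrict U = (chartMeasure c fun z => ENNReal.ofReal (w z)).restrict U)
    (hw : AEMeasurable w (volume.restrict (c.target ∩ c.symm ⁻¹' U)))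
    (hw0 : ∀ z, 0 ≤ w z)
    (hg : AEStronglyMeasurable g (ν.restrict U)) :
    ∫ x in U, g x ∂ν = ∫ z in c.target ∩ c.symm ⁻¹' U, w z * g (c.symm z) := by
  rw [hν, chartMeasure_restrict c _ hU, integral_map (aemeasurable_symm_restrict c hU _)
    (aestronglyMeasurable_withDensity_symm c hU hν hg),
    integral_withDensity_eq_integral_toReal_smul₀ hw.ennreal_ofReal (by simp)]
  simp only [ENNReal.toReal_ofReal (hw0 _), smul_eq_mul]

theorem integrableOn_chartMeasure {ν : Measure N} (hU : MeasurableSet U)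
    (hν : ν.restrict U = (chartMeasure c fun z => ENNReal.ofReal (w z)).restrict U)
    (hw : AEMeasurable w (volume.restrict (c.target ∩ c.symm ⁻¹' U)))
    (hw0 : ∀ z, 0 ≤ w z)
    (hg : AEStronglyMeasurable g (ν.restrict U)) :
    IntegrableOn g U ν ↔
      IntegrableOn (fun z => w z * g (c.symm z)) (c.target ∩ c.symm ⁻¹' U) := by
  rw [IntegrableOn, hν, chartMeasure_restrict c _ hU,
    integrable_map_measure (aestronglyMeasurable_withDensity_symm c hU hν hg)
      (aemeasurable_symm_restrict c hU _),
    integrable_withDensity_iff_integrable_smul₀' hw.ennreal_ofReal (by simp)]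
  simp only [ENNReal.toReal_ofReal (hw0 _), smul_eq_mul]
  rfl

end ChartMeasure

/-- A bound on `t` for all the measures of a family is a bound on `t` for their supremum: outside
`t` the supremum is only compared with the largest measure `⊤`. -/
theorem restrict_sSup_le {α : Type*} [MeasurableSpace α] {m : Set (Measure α)} {κ : Measure α}
    {t : Set α} (ht : MeasurableSet t) (h : ∀ μ ∈ m, μ.restrict t ≤ κ) :
    (sSup m).restrict t ≤ κ := by
  have h1 : sSup m ≤ κ + (⊤ : Measure α).restrict tᶜ := by
    refine sSup_le fun μ hμ => ?_
    rw [← Measure.restrict_add_restrict_compl (μ := μ) ht]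
    exact add_le_add (h μ hμ) (Measure.restrict_mono subset_rfl le_top)
  refine (Measure.restrict_mono subset_rfl h1).trans ?_
  rw [Measure.restrict_add, Measure.restrict_restrict ht, inter_compl_self, Measure.restrict_empty,
    add_zero]
  exact Measure.restrict_le_self

/-! ### The measure defined by the volume form -/

section VolMeasure

variable {n : ℕ}
  {M : Type*} [TopologicalSpace M] [ChartedSpace (EuclideanSpace ℝ (Fin n)) M]
  [IsManifold (𝓡 n) ∞ M] [CompactSpace M] [MeasurableSpace M] [BorelSpace M]
  {ηM : (p : M) → TangentSpace (𝓡 n) p [⋀^Fin n]→L[ℝ] ℝ}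
  {e e₁ : OpenPartialHomeomorph M (EuclideanSpace ℝ (Fin n))}

/-- The measures defined by `|ρ|` in two charts agree on the intersection of the chart domains, by
the change of variables formula. -/
theorem chartMeasure_density_eq (he : IsSmoothChart (𝓡 n) e) (he₁ : IsSmoothChart (𝓡 n) e₁)
    {A : Set M} (hA : MeasurableSet A) (h : A ⊆ e.source) (h₁ : A ⊆ e₁.source) :
    chartMeasure e (fun z => ENNReal.ofReal |density ηM e z|) A =
      chartMeasure e₁ (fun z => ENNReal.ofReal |density ηM e₁ z|) A := by
  rw [chartMeasure_apply e _ hA, chartMeasure_apply e₁ _ hA]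
  have himg : e₁.target ∩ e₁.symm ⁻¹' A = (e₁ ∘ e.symm) '' (e.target ∩ e.symm ⁻¹' A) := by
    ext z
    constructor
    · rintro ⟨h2, h3⟩
      refine ⟨e (e₁.symm z), ⟨e.map_source (h h3), ?_⟩, ?_⟩
      · simpa [e.left_inv (h h3)] using h3
      · simp [e.left_inv (h h3), e₁.right_inv h2]
    · rintro ⟨y, ⟨h2, h3⟩, rfl⟩
      refine ⟨e₁.map_source (h₁ h3), ?_⟩
      simpa [e₁.left_inv (h₁ h3)] using h3
  have hinj : InjOn (e₁ ∘ e.symm) (e.target ∩ e.symm ⁻¹' A) := by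
    rintro y ⟨h2, h3⟩ y' ⟨h2', h3'⟩ hy
    exact e.symm.injOn h2 h2' (e₁.injOn (h₁ h3) (h₁ h3') hy)
  rw [himg, lintegral_image_eq_lintegral_abs_det_fderiv_mul volume
    (measurableSet_target_inter_preimage e hA) (f' := fderiv ℝ (e₁ ∘ e.symm)) ?_ hinj]
  · refine setLIntegral_congr_fun (measurableSet_target_inter_preimage e hA) fun z hz => ?_
    rw [density_coordChange he he₁ hz.1 (h₁ hz.2), abs_mul,
      ENNReal.ofReal_mul (abs_nonneg _)]
    rfl
  · intro z hz
    exact ((he.contDiffAt_coordChange he₁ hz.1 (h₁ hz.2)).differentiableAt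
      (by simp)).hasFDerivAt.hasFDerivWithinAt

/-- On the domain of any smooth chart, `volMeasure` has density `|ρ|` in the chart. It suffices to
compare the two measures on countably many domains of preferred charts. -/
theorem volMeasure_restrict (he : IsSmoothChart (𝓡 n) e) :
    (volMeasure ηM).restrict e.source =
      chartMeasure e (fun z => ENNReal.ofReal |density ηM e z|) := by
  rcases isEmpty_or_nonempty M with hM | hM
  · exact Subsingleton.elim _ _
  set ν : OpenPartialHomeomorph M (EuclideanSpace ℝ (Fin n)) → Measure M :=
    fun e => chartMeasure e (fun z => ENNReal.ofReal |density ηM e z|) with hν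
  have hvol : volMeasure ηM = sSup (range fun p : M => ν (chartAt _ p)) := rfl
  obtain ⟨t, htc, ht⟩ := countable_cover_nhds_of_sigmaCompact
    (f := fun p : M => (chartAt (EuclideanSpace ℝ (Fin n)) p).source)
    (fun p => (chartAt (EuclideanSpace ℝ (Fin n)) p).open_source.mem_nhds (mem_chart_source _ p))
  have : Countable t := htc.to_subtype
  refine Measure.ext_of_iUnion_eq_univ
    (s := fun p : t => (chartAt (EuclideanSpace ℝ (Fin n)) (p : M)).source)
    (by rw [iUnion_subtype]; exact ht) fun p => ?_
  set ep := chartAt (EuclideanSpace ℝ (Fin n)) (p : M)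
  have hs := e.open_source.measurableSet
  have hps := ep.open_source.measurableSet
  rw [Measure.restrict_restrict hps, hvol]
  apply le_antisymm
  · refine restrict_sSup_le (hps.inter hs) ?_
    rintro _ ⟨p', rfl⟩
    refine Measure.le_iff.2 fun A hA => ?_
    set ep' := chartAt (EuclideanSpace ℝ (Fin n)) p'
    have hm : MeasurableSet (A ∩ (ep.source ∩ e.source)) := hA.inter (hps.inter hs)
    rw [Measure.restrict_apply hA, Measure.restrict_apply hA]
    change ν ep' _ ≤ ν e _
    rw [hν, ← chartMeasure_inter_source ep' _ hm, ← chartMeasure_density_eq he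
      (isSmoothChart_chartAt p') (hm.inter ep'.open_source.measurableSet) (fun x hx => hx.1.2.2)
      inter_subset_right]
    exact measure_mono fun x hx => ⟨hx.1.1, hx.1.2.1⟩
  · refine le_trans ?_ (Measure.restrict_mono subset_rfl (le_sSup ⟨(p : M), rfl⟩))
    refine Measure.le_iff.2 fun A hA => ?_
    rw [Measure.restrict_apply hA, Measure.restrict_apply hA]
    change ν e _ ≤ ν ep _
    rw [hν, ← chartMeasure_inter_source e _ (hA.inter hps), inter_assoc]
    exact (chartMeasure_density_eq he (isSmoothChart_chartAt (p : M))
      (hA.inter (hps.inter hs)) (fun x hx => hx.2.2) (fun x hx => hx.2.1)).le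

theorem isFiniteMeasure_volMeasure (hηM : IsSmoothForm (𝓡 n) ηM) :
    IsFiniteMeasure (volMeasure ηM) := by
  have : IsLocallyFiniteMeasure (volMeasure ηM) := by
    refine ⟨fun p => ?_⟩
    set e := chartAt (EuclideanSpace ℝ (Fin n)) p
    have he : IsSmoothChart (𝓡 n) e := isSmoothChart_chartAt p
    obtain ⟨r, hr, hrt⟩ := Metric.nhds_basis_closedBall.mem_iff.1
      (e.open_target.mem_nhds (mem_chart_target _ p))
    have hA : IsOpen (e.source ∩ e ⁻¹' Metric.ball (e p) r) :=
      e.continuousOn.isOpen_inter_preimage e.open_source Metric.isOpen_ball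
    refine ⟨e.source ∩ e ⁻¹' Metric.ball (e p) r, hA.mem_nhds
      ⟨mem_chart_source _ p, Metric.mem_ball_self hr⟩, ?_⟩
    have h1 : volMeasure ηM (e.source ∩ e ⁻¹' Metric.ball (e p) r) =
        (volMeasure ηM).restrict e.source (e.source ∩ e ⁻¹' Metric.ball (e p) r) :=
      (Measure.restrict_eq_self _ inter_subset_left).symm
    rw [h1, volMeasure_restrict he, chartMeasure_apply e _ hA.measurableSet]
    have hint : IntegrableOn (fun z => |density ηM e z|) (Metric.closedBall (e p) r) :=
      ContinuousOn.integrableOn_compact (isCompact_closedBall _ _) fun z hz =>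
        (contDiffAt_density hηM he (hrt hz)).continuousAt.abs.continuousWithinAt
    refine lt_of_le_of_lt (lintegral_mono_set ?_) hint.lintegral_lt_top
    rintro z ⟨hz, -, hz2⟩
    apply Metric.ball_subset_closedBall
    simpa [e.right_inv hz] using hz2
  infer_instance

/-- The measure on `X` defined by `η`. -/
abbrev volX (ηM : (p : M) → TangentSpace (𝓡 n) p [⋀^Fin n]→L[ℝ] ℝ) : Measure (ℝ × M) :=
  (volume : Measure ℝ).prod (volMeasure ηM)

/-- On the domain of a product chart, the measure of `X` has density `|ρ|` in the chart. -/
theorem volX_restrict [SecondCountableTopology M] (hηM : IsSmoothForm (𝓡 n) ηM)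
    (he : IsSmoothChart (𝓡 n) e) :
    (volX ηM).restrict (xChart e).source =
      chartMeasure (xChart e) (fun z => ENNReal.ofReal |density ηM e z.2|) := by
  have := isFiniteMeasure_volMeasure hηM
  have hsrc : (xChart e).source = (univ : Set ℝ) ×ˢ e.source := rfl
  rw [hsrc, ← Measure.prod_restrict, volMeasure_restrict he, Measure.restrict_univ]
  have : IsFiniteMeasure (chartMeasure e (fun z => ENNReal.ofReal |density ηM e z|)) := by
    rw [← volMeasure_restrict he]; infer_instance
  refine Measure.prod_eq fun s t hs ht => ?_
  rw [chartMeasure_apply _ _ (hs.prod ht), chartMeasure_apply e _ ht]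
  have hset : (xChart e).target ∩ (xChart e).symm ⁻¹' (s ×ˢ t) =
      s ×ˢ (e.target ∩ e.symm ⁻¹' t) := by
    ext z
    simp only [mem_inter_iff, mem_xChart_target, mem_preimage, xChart_symm_apply, mem_prod]
    tauto
  rw [hset, Measure.volume_eq_prod, ← Measure.prod_restrict]
  have hρ : AEMeasurable (fun z => ENNReal.ofReal |density ηM e z|)
      (volume.restrict (e.target ∩ e.symm ⁻¹' t)) := by
    refine AEMeasurable.ennreal_ofReal ?_
    refine ContinuousOn.aemeasurable (fun z hz => ?_) (measurableSet_target_inter_preimage e ht)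
    exact (contDiffAt_density hηM he hz.1).continuousAt.abs.continuousWithinAt
  have := lintegral_prod_mul (μ := (volume : Measure ℝ).restrict s) (f := fun _ => 1)
    aemeasurable_const hρ
  simpa using this

theorem volX_restrict_of_subset [SecondCountableTopology M] (hηM : IsSmoothForm (𝓡 n) ηM)
    (he : IsSmoothChart (𝓡 n) e) {U : Set (ℝ × M)} (hU : MeasurableSet U)
    (hUe : U ⊆ (xChart e).source) : (volX ηM).restrict U =
      (chartMeasure (xChart e) (fun z => ENNReal.ofReal |density ηM e z.2|)).restrict U := by
  rw [← volX_restrict hηM he, Measure.restrict_restrict hU, inter_eq_left.2 hUe]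

theorem aemeasurable_density (hηM : IsSmoothForm (𝓡 n) ηM) (he : IsSmoothChart (𝓡 n) e)
    {s : Set (EX n)} (hs : MeasurableSet s) (hse : s ⊆ (xChart e).target) :
    AEMeasurable (fun z : EX n => |density ηM e z.2|) (volume.restrict s) := by
  refine ContinuousOn.aemeasurable (fun z hz => ?_) hs
  exact (ContinuousAt.comp (f := fun z : EX n => z.2) (contDiffAt_density hηM he
    (mem_xChart_target.1 (hse hz))).continuousAt continuousAt_snd).abs.continuousWithinAt

/-- Integrals over subsets of a chart domain of `X`. -/
theorem setIntegral_volX [SecondCountableTopology M] (hηM : IsSmoothForm (𝓡 n) ηM)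
    (he : IsSmoothChart (𝓡 n) e) {U : Set (ℝ × M)} (hU : MeasurableSet U)
    (hUe : U ⊆ (xChart e).source) {g : ℝ × M → ℝ}
    (hg : AEStronglyMeasurable g ((volX ηM).restrict U)) :
    ∫ x in U, g x ∂(volX ηM) = ∫ z in (xChart e).target ∩ (xChart e).symm ⁻¹' U,
      |density ηM e z.2| * g ((xChart e).symm z) :=
  setIntegral_chartMeasure (xChart e) hU (volX_restrict_of_subset hηM he hU hUe)
    (aemeasurable_density hηM he (measurableSet_target_inter_preimage _ hU) inter_subset_left)
    (fun _ => abs_nonneg _) hg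

theorem integrableOn_volX [SecondCountableTopology M] (hηM : IsSmoothForm (𝓡 n) ηM)
    (he : IsSmoothChart (𝓡 n) e) {U : Set (ℝ × M)} (hU : MeasurableSet U)
    (hUe : U ⊆ (xChart e).source) {g : ℝ × M → ℝ}
    (hg : AEStronglyMeasurable g ((volX ηM).restrict U)) :
    IntegrableOn g U (volX ηM) ↔ IntegrableOn (fun z =>
      |density ηM e z.2| * g ((xChart e).symm z)) ((xChart e).target ∩ (xChart e).symm ⁻¹' U) :=
  integrableOn_chartMeasure (xChart e) hU (volX_restrict_of_subset hηM he hU hUe)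
    (aemeasurable_density hηM he (measurableSet_target_inter_preimage _ hU) inter_subset_left)
    (fun _ => abs_nonneg _) hg

end VolMeasure

/-! ### Integration by parts on open sets with arbitrary frontier -/

section IntegrationByParts

/-- Smooth functions vanishing near `0` whose derivatives are uniformly bounded and converge to `1`
away from `0`. -/
theorem exists_truncation : ∃ (θ : ℕ → ℝ → ℝ) (C : ℝ), (∀ k, ContDiff ℝ 1 (θ k)) ∧
    (∀ k, θ k =ᶠ[𝓝 0] 0) ∧ (∀ k t, |deriv (θ k) t| ≤ C) ∧
    ∀ t ≠ 0, ∀ᶠ k in Filter.atTop, deriv (θ k) t = 1 := by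
  -- `Θ s = s (1 - b s)` vanishes for `|s| ≤ 1` and is the identity for `|s| ≥ 2`; the functions
  -- `θ k` are its rescalings `t ↦ Θ (c t) / c` with `c = k + 1`
  let b : ContDiffBump (0 : ℝ) := ⟨1, 2, one_pos, one_lt_two⟩
  have hb : ContDiff ℝ 1 (fun s : ℝ => s * b s) := contDiff_id.mul b.contDiff
  have hbc : HasCompactSupport (fun s : ℝ => s * b s) := b.hasCompactSupport.mul_left
  obtain ⟨C, hC⟩ := (hb.continuous_deriv le_rfl).bounded_above_of_compact_support hbc.deriv
  let Θ : ℝ → ℝ := fun s => s - s * b s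
  have hΘ : ContDiff ℝ 1 Θ := contDiff_id.sub hb
  have hΘ' : ∀ s, deriv Θ s = 1 - deriv (fun s : ℝ => s * b s) s := fun s => by
    have h1 : HasDerivAt (fun s : ℝ => s * b s) (deriv (fun s : ℝ => s * b s) s) s :=
      (hb.differentiable (by simp) s).hasDerivAt
    exact ((hasDerivAt_id s).sub h1).deriv
  let c : ℕ → ℝ := fun k => (k : ℝ) + 1
  have hc : ∀ k, 0 < c k := fun k => by positivity
  have hd : ∀ k t, deriv (fun t => (c k)⁻¹ * Θ (c k * t)) t = deriv Θ (c k * t) := fun k t => by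
    have h1 : HasDerivAt Θ (deriv Θ (c k * t)) (c k * t) :=
      (hΘ.differentiable (by simp) _).hasDerivAt
    have h2 := (h1.comp t ((hasDerivAt_id t).const_mul (c k))).const_mul (c k)⁻¹
    refine h2.deriv.trans ?_
    have := (hc k).ne'
    field_simp
  refine ⟨fun k t => (c k)⁻¹ * Θ (c k * t), 1 + C, fun k => ?_, fun k => ?_, fun k t => ?_,
    fun t ht => ?_⟩
  · exact contDiff_const.mul (hΘ.comp (contDiff_const.mul contDiff_id))
  · have h1 : ∀ᶠ t : ℝ in 𝓝 0, c k * t ∈ Metric.ball (0 : ℝ) 1 := by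
      refine (continuous_const.mul continuous_id).continuousAt.preimage_mem_nhds ?_
      simpa using Metric.ball_mem_nhds (0 : ℝ) one_pos
    filter_upwards [h1] with t ht
    have : b (c k * t) = 1 := b.one_of_mem_closedBall (Metric.ball_subset_closedBall ht)
    simp [Θ, this]
  · rw [hd, hΘ']
    refine (abs_sub _ _).trans ?_
    rw [abs_one]
    exact add_le_add le_rfl (hC _)
  · obtain ⟨K, hK⟩ := exists_nat_gt (2 / |t|)
    filter_upwards [Filter.eventually_ge_atTop K] with k hk
    rw [hd]
    have h2 : 2 < |c k * t| := by
      rw [abs_mul, abs_of_pos (hc k)]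
      have h3 : 2 / |t| < c k := hK.trans (by
        have : (K : ℝ) ≤ k := by exact_mod_cast hk
        simp only [c]; linarith)
      exact (div_lt_iff₀ (abs_pos.2 ht)).1 h3
    have h4 : Θ =ᶠ[𝓝 (c k * t)] id := by
      filter_upwards [(isOpen_lt continuous_const continuous_abs).mem_nhds h2] with s hs
      have : b s = 0 := b.zero_of_le_dist (by simpa using le_of_lt hs)
      simp [Θ, this]
    rw [h4.deriv_eq]
    exact deriv_id _

variable {E : Type*} [NormedAddCommGroup E] [NormedSpace ℝ E] [FiniteDimensional ℝ E]
  [MeasurableSpace E] [BorelSpace E] {μ : Measure E} [μ.IsAddHaarMeasure]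

/-- The derivative of a function vanishes almost everywhere on the zero set of the function. -/
theorem ae_fderiv_eq_zero_of_eqOn_zero {g : E → ℝ} {Z : Set E} (hZ : MeasurableSet Z)
    (hg : ∀ z ∈ Z, DifferentiableAt ℝ g z) (h0 : ∀ z ∈ Z, g z = 0) (v : E) :
    ∀ᵐ z ∂μ.restrict Z, fderiv ℝ g z v = 0 := by
  by_cases hv : v = 0
  · simp [hv]
  -- the vector-valued function `g • v` is approximated on `Z` by `0` up to a zero error
  have happ : ApproximatesLinearOn (fun z => g z • v) (0 : E →L[ℝ] E) Z 0 := by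
    intro x hx y hy
    simp [h0 x hx, h0 y hy]
  have h := happ.norm_fderiv_sub_le μ hZ (fun z => (fderiv ℝ g z).smulRight v)
    fun z hz => ((hg z hz).hasFDerivAt.smul_const v).hasFDerivWithinAt
  filter_upwards [h] with z hz
  have h1 : fderiv ℝ g z = 0 ∨ v = 0 := by simpa using hz
  simp [h1.resolve_right hv]

theorem integrableOn_of_continuousAt_of_eq_zero {F : E → ℝ} {U K : Set E} (hU : MeasurableSet U)
    (hK : IsCompact K) (hF : ∀ z ∈ closure U ∩ K, ContinuousAt F z)
    (h0 : ∀ z ∈ U, z ∉ K → F z = 0) :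
    IntegrableOn F U μ := by
  have h1 : IntegrableOn F (closure U ∩ K) μ :=
    ContinuousOn.integrableOn_compact (hK.inter_left isClosed_closure)
      fun z hz => (hF z hz).continuousWithinAt
  refine (h1.mono_set (inter_subset_inter_left K subset_closure)).of_forall_sdiff_eq_zero hU ?_
  rintro z ⟨hz, hz2⟩
  exact h0 z hz fun h => hz2 ⟨hz, h⟩

/-- The integral over an open set of a partial derivative of a compactly supported function
vanishing on the frontier is zero, without any regularity of the frontier. The function is only
assumed smooth near the closure of the open set. -/
theorem setIntegral_fderiv_eq_zero {U K : Set E} (hU : IsOpen U) (hK : IsCompact K) {g : E → ℝ}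
    (hg : ∀ z ∈ closure U ∩ K, ContDiffAt ℝ 1 g z) (hgK : ∀ z ∈ U, z ∉ K → g z = 0)
    (hg0 : ∀ z ∈ frontier U ∩ K, g z = 0) (v : E) :
    IntegrableOn (fun z => fderiv ℝ g z v) U μ ∧ ∫ z in U, fderiv ℝ g z v ∂μ = 0 := by
  have hzero : ∀ z ∈ U, z ∉ K → g =ᶠ[𝓝 z] 0 := fun z hz hzK => by
    filter_upwards [(hU.sdiff hK.isClosed).mem_nhds ⟨hz, hzK⟩] with y hy using hgK y hy.1 hy.2
  have hgU : ∀ z ∈ U, ContDiffAt ℝ 1 g z := fun z hz => by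
    by_cases hzK : z ∈ K
    · exact hg z ⟨subset_closure hz, hzK⟩
    · exact contDiffAt_const.congr_of_eventuallyEq (hzero z hz hzK)
  have hint : IntegrableOn (fun z => fderiv ℝ g z v) U μ := by
    refine integrableOn_of_continuousAt_of_eq_zero hU.measurableSet hK (fun z hz => ?_) ?_
    · exact ((hg z hz).fderiv_right (m := 0) (by simp)).continuousAt.clm_apply continuousAt_const
    · intro z hz hzK
      rw [(hzero z hz hzK).fderiv_eq]
      simp
  refine ⟨hint, ?_⟩
  obtain ⟨θ, C, hθ, hθ0, hθC, hθ1⟩ := exists_truncation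
  set h : E → ℝ := U.indicator g with hh
  -- the truncated functions, extended by zero, are continuously differentiable
  have hout : ∀ k, ∀ z ∉ U, (fun z => θ k (h z)) =ᶠ[𝓝 z] 0 := by
    intro k z hz
    have hθz : θ k 0 = 0 := (hθ0 k).self_of_nhds
    by_cases hzK : z ∈ K
    · by_cases hzc : z ∈ closure U
      · have hgz : g z = 0 := hg0 z ⟨⟨hzc, fun h => hz (interior_subset h)⟩, hzK⟩
        have hcont := (hg z ⟨hzc, hzK⟩).continuousAt
        rw [ContinuousAt, hgz] at hcont
        filter_upwards [hcont.eventually (hθ0 k)] with y hy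
        by_cases hyU : y ∈ U
        · simpa [hh, hyU] using hy
        · simpa [hh, hyU] using hθz
      · filter_upwards [isClosed_closure.isOpen_compl.mem_nhds hzc] with y hy
        have hyU : y ∉ U := fun h => hy (subset_closure h)
        simpa [hh, hyU] using hθz
    · filter_upwards [hK.isClosed.isOpen_compl.mem_nhds hzK] with y hy
      by_cases hyU : y ∈ U
      · simpa [hh, hyU, hgK y hyU hy] using hθz
      · simpa [hh, hyU] using hθz
  have hin : ∀ k, ∀ z ∈ U, (fun z => θ k (h z)) =ᶠ[𝓝 z] fun z => θ k (g z) := fun k z hz => by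
    filter_upwards [hU.mem_nhds hz] with y hy
    simp [hh, hy]
  have hsm : ∀ k, ContDiff ℝ 1 (fun z => θ k (h z)) := fun k =>
      contDiff_iff_contDiffAt.2 fun z => by
    by_cases hz : z ∈ U
    · exact (((hθ k).contDiffAt).comp z (hgU z hz)).congr_of_eventuallyEq (hin k z hz)
    · exact contDiffAt_const.congr_of_eventuallyEq (hout k z hz)
  have hcs : ∀ k, HasCompactSupport (fun z => θ k (h z)) := fun k => by
    refine HasCompactSupport.intro hK fun z hzK => ?_
    by_cases hz : z ∈ U
    · simpa [hh, hz, hgK z hz hzK] using (hθ0 k).self_of_nhds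
    · exact (hout k z hz).self_of_nhds
  have hcsd : ∀ k, HasCompactSupport (fun z => fderiv ℝ (fun z => θ k (h z)) z v) := fun k =>
    (hcs k).fderiv_apply (𝕜 := ℝ) v
  have hcd : ∀ k, Continuous (fun z => fderiv ℝ (fun z => θ k (h z)) z v) := fun k =>
    ((hsm k).continuous_fderiv one_ne_zero).clm_apply continuous_const
  -- integration by parts against the constant function `1`
  have hI : ∀ k, ∫ z, fderiv ℝ (fun z => θ k (h z)) z v ∂μ = 0 := fun k => by
    have := integral_mul_fderiv_eq_neg_fderiv_mul_of_integrable (μ := μ) (𝕜 := ℝ)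
      (f := fun _ : E => (1 : ℝ)) (g := fun z => θ k (h z)) (v := v) (by simp)
      (by simpa using (hcd k).integrable_of_hasCompactSupport (hcsd k))
      (by simpa using (hsm k).continuous.integrable_of_hasCompactSupport (hcs k))
      (fun _ _ => differentiableAt_const _) (fun x _ => (hsm k).differentiable (by simp) x)
    simpa using this
  have hd : ∀ k z, fderiv ℝ (fun z => θ k (h z)) z v =
      U.indicator (fun z => deriv (θ k) (g z) * fderiv ℝ g z v) z := fun k z => by
    by_cases hz : z ∈ U
    · rw [(hin k z hz).fderiv_eq, indicator_of_mem hz]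
      have h1 : HasDerivAt (θ k) (deriv (θ k) (g z)) (g z) :=
        ((hθ k).differentiable (by simp) _).hasDerivAt
      have h2 := h1.comp_hasFDerivAt z ((hgU z hz).differentiableAt (by simp)).hasFDerivAt
      have h3 := congrArg (fun T : E →L[ℝ] ℝ => T v) h2.fderiv
      refine h3.trans ?_
      simp
    · rw [(hout k z hz).fderiv_eq, indicator_of_notMem hz]
      simp
  have hI' : ∀ k, ∫ z in U, deriv (θ k) (g z) * fderiv ℝ g z v ∂μ = 0 := fun k => by
    rw [← integral_indicator hU.measurableSet, ← hI k]
    simp only [hd]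
  -- the derivatives of the truncations converge to the derivative of `g` off the zero set of `g`,
  -- and to zero on it
  set F : E → ℝ := fun z => if g z = 0 then 0 else fderiv ℝ g z v with hF
  have hlim : Filter.Tendsto (fun k => ∫ z in U, deriv (θ k) (g z) * fderiv ℝ g z v ∂μ)
      Filter.atTop (𝓝 (∫ z in U, F z ∂μ)) := by
    refine tendsto_integral_of_dominated_convergence (fun z => C * |fderiv ℝ g z v|)
      (fun k => ?_) (hint.norm.const_mul C) (fun k => ?_) ?_
    · refine ContinuousOn.aestronglyMeasurable (fun z hz => ?_) hU.measurableSet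
      refine ContinuousAt.continuousWithinAt (ContinuousAt.mul ?_ ?_)
      · exact ((hθ k).continuous_deriv le_rfl).continuousAt.comp (hgU z hz).continuousAt
      · exact ((hgU z hz).fderiv_right (m := 0) (by simp)).continuousAt.clm_apply continuousAt_const
    · filter_upwards with z
      rw [norm_mul]
      exact mul_le_mul_of_nonneg_right (hθC k _) (abs_nonneg _)
    · filter_upwards with z
      by_cases hz : g z = 0
      · have h1 : ∀ k, deriv (θ k) (g z) = 0 := fun k => by
          rw [hz, (hθ0 k).deriv_eq]
          exact deriv_const _ _
        have h2 : F z = 0 := if_pos hz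
        simp only [h2, h1, zero_mul]
        exact tendsto_const_nhds
      · refine tendsto_const_nhds.congr' ?_
        filter_upwards [hθ1 (g z) hz] with k hk
        simp [hF, hz, hk]
  simp only [hI'] at hlim
  have hF0 : ∫ z in U, F z ∂μ = 0 := (tendsto_nhds_unique hlim tendsto_const_nhds)
  rw [← hF0]
  -- the limit `F` differs from the derivative of `g` only on a null set
  have hZ : MeasurableSet (U ∩ g ⁻¹' {0}) := by
    have hc : ContinuousOn g U := fun z hz => (hgU z hz).continuousAt.continuousWithinAt
    have h1 : IsOpen (U ∩ g ⁻¹' {0}ᶜ) := hc.isOpen_inter_preimage hU isOpen_compl_singleton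
    have h2 : U ∩ g ⁻¹' {0} = U \ (U ∩ g ⁻¹' {0}ᶜ) := by
      ext z; simp only [mem_inter_iff, mem_sdiff, mem_preimage, mem_compl_iff]; tauto
    rw [h2]
    exact hU.measurableSet.diff h1.measurableSet
  have hae := ae_fderiv_eq_zero_of_eqOn_zero (μ := μ) hZ
    (fun z hz => (hgU z hz.1).differentiableAt (by simp)) (fun z hz => hz.2) v
  rw [ae_restrict_iff' hZ] at hae
  refine setIntegral_congr_ae hU.measurableSet ?_
  filter_upwards [hae] with z hz hzU
  by_cases hgz : g z = 0
  · simp [hF, hgz, hz ⟨hzU, hgz⟩]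
  · simp [hF, hgz]

end IntegrationByParts

/-! ### The first variation formula in coordinates -/

/-- The product rule separating the derivative of the argument `v` from that of the coefficients. -/
theorem fderiv_mul_clm_apply_comp {E G H : Type*} [NormedAddCommGroup E] [NormedSpace ℝ E]
    [NormedAddCommGroup G] [NormedSpace ℝ G] [NormedAddCommGroup H] [NormedSpace ℝ H]
    {ρ : E → ℝ} {Q : E → H →L[ℝ] ℝ} {v : E → G} {z : E} (hρ : DifferentiableAt ℝ ρ z)
    (hQ : DifferentiableAt ℝ Q z) (hv : DifferentiableAt ℝ v z) (B : G →L[ℝ] H) (u : E) :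
    DifferentiableAt ℝ (fun z => ρ z * Q z (B (v z))) z ∧
    fderiv ℝ (fun z => ρ z * Q z (B (v z))) z u =
      fderiv ℝ (fun y => ρ y * Q y (B (v z))) z u + ρ z * Q z (B (fderiv ℝ v z u)) := by
  have hP : HasFDerivAt (fun z => ρ z • Q z) (fderiv ℝ (fun z => ρ z • Q z) z) z :=
    (hρ.smul hQ).hasFDerivAt
  have h1 := hP.clm_apply (B.hasFDerivAt.comp z hv.hasFDerivAt)
  have h2 := hP.clm_apply (hasFDerivAt_const (B (v z)) z)
  refine ⟨h1.differentiableAt, ?_⟩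
  have e1 := congrArg (fun T : E →L[ℝ] ℝ => T u) h1.fderiv
  have e2 := congrArg (fun T : E →L[ℝ] ℝ => T u) h2.fderiv
  refine e1.trans ?_
  refine Eq.trans ?_ (congrArg (· + ρ z * Q z (B (fderiv ℝ v z u))) e2.symm)
  simp
  ring

section ModelFirstVariation

variable {n m : ℕ}

instance : (volume : Measure (EX n)).IsAddHaarMeasure := by
  rw [Measure.volume_eq_prod]
  infer_instance

/-- The first variation formula in coordinates, for a variation `v` which vanishes outside the
compact set `K` and on the frontier of `U`. The two integrands differ by the divergence of the
vector field with components `|ρ| Q(dx^μ ⊗ v)`. -/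
theorem model_firstVariation {U K : Set (EX n)} (hU : IsOpen U) (hK : IsCompact K)
    {ρ : EX n → ℝ} {a : EX n → ES m →L[ℝ] ℝ} {Q : EX n → (EX n →L[ℝ] ES m) →L[ℝ] ℝ}
    {v : EX n → ES m} (hρ : ∀ z ∈ closure U ∩ K, ContDiffAt ℝ ∞ ρ z)
    (hρ0 : ∀ z ∈ closure U ∩ K, ρ z ≠ 0)
    (ha : ∀ z ∈ closure U ∩ K, ContinuousAt a z) (hQ : ∀ z ∈ closure U ∩ K, ContDiffAt ℝ ∞ Q z)
    (hv : ∀ z ∈ closure U ∩ K, ContDiffAt ℝ ∞ v z) (hvK : ∀ z ∈ U, z ∉ K → v z = 0)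
    (hv0 : ∀ z ∈ frontier U ∩ K, v z = 0) :
    IntegrableOn (fun z => |ρ z| * (a z (v z) + Q z (fderiv ℝ v z))) U ∧
    ∫ z in U, |ρ z| * (a z (v z) + Q z (fderiv ℝ v z)) =
      ∫ z in U, |ρ z| * (a z (v z) - (ρ z)⁻¹ * ∑ μ : Fin (n + 1), fderiv ℝ (fun y => ρ y *
        Q y ((dXdual μ).smulRight (v z))) z (dX μ)) := by
  have hzero : ∀ z ∈ U, z ∉ K → v =ᶠ[𝓝 z] 0 := fun z hz hzK => by
    filter_upwards [(hU.sdiff hK.isClosed).mem_nhds ⟨hz, hzK⟩] with y hy using hvK y hy.1 hy.2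
  have h1 : IntegrableOn (fun z => |ρ z| * (a z (v z) + Q z (fderiv ℝ v z))) U := by
    refine integrableOn_of_continuousAt_of_eq_zero hU.measurableSet hK (fun z hz => ?_) ?_
    · exact (hρ z hz).continuousAt.abs.mul (((ha z hz).clm_apply (hv z hz).continuousAt).add
        ((hQ z hz).continuousAt.clm_apply
          ((hv z hz).fderiv_right (m := ∞) (by simp)).continuousAt))
    · intro z hz hzK
      have h2 : fderiv ℝ v z = 0 := by rw [(hzero z hz hzK).fderiv_eq]; simp
      simp [h2, hvK z hz hzK]
  refine ⟨h1, ?_⟩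
  have hdiv : ∀ μ : Fin (n + 1), IntegrableOn (fun z => fderiv ℝ (fun y => |ρ y| *
      Q y ((dXdual μ).smulRight (v y))) z (dX μ)) U ∧ ∫ z in U, fderiv ℝ (fun y => |ρ y| *
      Q y ((dXdual μ).smulRight (v y))) z (dX μ) = 0 := fun μ => by
    refine setIntegral_fderiv_eq_zero hU hK (fun z hz => ?_) (fun z hz hzK => ?_)
      (fun z hz => ?_) (dX μ)
    · refine ContDiffAt.mul ?_ ?_
      · exact ((contDiffAt_abs (hρ0 z hz)).comp z (hρ z hz)).of_le (by simp)
      · refine ContDiffAt.clm_apply ((hQ z hz).of_le (by simp)) ?_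
        exact (ContinuousLinearMap.smulRightL ℝ (EX n) (ES m) (dXdual μ)).contDiff.contDiffAt.comp z
          ((hv z hz).of_le (by simp))
    · rw [hvK z hz hzK, dXdual_smulRight_zero, map_zero, mul_zero]
    · rw [hv0 z hz, dXdual_smulRight_zero, map_zero, mul_zero]
  have hpt : ∀ z ∈ U, |ρ z| * (a z (v z) - (ρ z)⁻¹ * ∑ μ : Fin (n + 1), fderiv ℝ (fun y => ρ y *
        Q y ((dXdual μ).smulRight (v z))) z (dX μ)) =
      |ρ z| * (a z (v z) + Q z (fderiv ℝ v z)) - ∑ μ : Fin (n + 1), fderiv ℝ (fun y => |ρ y| *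
      Q y ((dXdual μ).smulRight (v y))) z (dX μ) := by
    intro z hz
    by_cases hzK : z ∈ K
    · have hzz : z ∈ closure U ∩ K := ⟨subset_closure hz, hzK⟩
      have dρ := (hρ z hzz).differentiableAt (by simp)
      have dQ := (hQ z hzz).differentiableAt (by simp)
      have dv := (hv z hzz).differentiableAt (by simp)
      -- near `z` the density has constant sign
      obtain ⟨s, hs, hs1⟩ : ∃ s : ℝ, (fun y => |ρ y|) =ᶠ[𝓝 z] (fun y => s * ρ y) ∧
          |ρ z| * (ρ z)⁻¹ = s := by
        have h0 := hρ0 z hzz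
        rcases lt_or_gt_of_ne h0 with h | h
        · refine ⟨-1, ?_, ?_⟩
          · filter_upwards [(hρ z hzz).continuousAt.eventually (gt_mem_nhds h)] with y hy
            rw [abs_of_neg hy]; ring
          · rw [abs_of_neg h]; field_simp
        · refine ⟨1, ?_, ?_⟩
          · filter_upwards [(hρ z hzz).continuousAt.eventually (lt_mem_nhds h)] with y hy
            rw [abs_of_pos hy]; ring
          · rw [abs_of_pos h]; field_simp
      have hμ : ∀ μ : Fin (n + 1), fderiv ℝ (fun y => |ρ y| *
          Q y ((dXdual μ).smulRight (v y))) z (dX μ) = s * fderiv ℝ (fun y => ρ y *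
            Q y ((dXdual μ).smulRight (v z))) z (dX μ) +
          |ρ z| * Q z ((dXdual μ).smulRight (fderiv ℝ v z (dX μ))) := by
        intro μ
        obtain ⟨g1, g2⟩ := fderiv_mul_clm_apply_comp dρ dQ dv
          (ContinuousLinearMap.smulRightL ℝ (EX n) (ES m) (dXdual μ)) (dX μ)
        have h3 : (fun y => |ρ y| * Q y ((dXdual μ).smulRight (v y))) =ᶠ[𝓝 z]
            fun y => s * (ρ y * Q y ((dXdual μ).smulRight (v y))) := by
          filter_upwards [hs] with y hy
          rw [hy, mul_assoc]
        have h4 : |ρ z| = s * ρ z := hs.self_of_nhds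
        rw [h3.fderiv_eq]
        have h5 := congrArg (fun T : EX n →L[ℝ] ℝ => T (dX μ)) (fderiv_const_mul g1 s)
        refine h5.trans ?_
        rw [smul_apply, smul_eq_mul, g2, mul_add, ← mul_assoc, h4]
        rfl
      simp only [hμ, Finset.sum_add_distrib, ← Finset.mul_sum, ← map_sum]
      rw [sum_dXdual_smulRight, ← hs1]
      ring
    · have h2 : fderiv ℝ v z = 0 := by rw [(hzero z hz hzK).fderiv_eq]; simp
      have h3 : ∀ μ : Fin (n + 1), fderiv ℝ (fun y => |ρ y| *
          Q y ((dXdual μ).smulRight (v y))) z (dX μ) = 0 := fun μ => by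
        have : (fun y => |ρ y| * Q y ((dXdual μ).smulRight (v y))) =ᶠ[𝓝 z] fun _ => 0 := by
          filter_upwards [hzero z hz hzK] with y hy
          rw [hy]
          simp only [Pi.zero_apply]
          rw [dXdual_smulRight_zero, map_zero, mul_zero]
        rw [this.fderiv_eq]
        simp
      simp [h2, h3, hvK z hz hzK]
  rw [setIntegral_congr_fun hU.measurableSet hpt, integral_sub h1
    (integrable_finsetSum _ fun μ _ => (hdiv μ).1), integral_finsetSum _ fun μ _ => (hdiv μ).1,
    Finset.sum_eq_zero fun μ _ => (hdiv μ).2, sub_zero]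

end ModelFirstVariation

/-! ### Families of functions depending on a parameter -/

section ParametricCalculus

variable {E G : Type*} [NormedAddCommGroup E] [NormedSpace ℝ E]
  [NormedAddCommGroup G] [NormedSpace ℝ G]

theorem hasFDerivAt_slice {φ : ℝ × E → G} {ε : ℝ} {z : E} (h : DifferentiableAt ℝ φ (ε, z)) :
    HasFDerivAt (fun z' => φ (ε, z')) (fderiv ℝ φ (ε, z) ∘L ContinuousLinearMap.inr ℝ ℝ E) z :=
  h.hasFDerivAt.comp z (hasFDerivAt_prodMk_right ε z)

theorem hasDerivAt_slice {φ : ℝ × E → G} {ε : ℝ} {z : E} (h : DifferentiableAt ℝ φ (ε, z)) :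
    HasDerivAt (fun ε' => φ (ε', z)) (fderiv ℝ φ (ε, z) (1, 0)) ε :=
  h.hasFDerivAt.comp_hasDerivAt ε ((hasDerivAt_id ε).prodMk (hasDerivAt_const ε z))

theorem contDiffAt_deriv_slice {φ : ℝ × E → G} {ε : ℝ} {z : E} (h : ContDiffAt ℝ ∞ φ (ε, z)) :
    ContDiffAt ℝ ∞ (fun p : ℝ × E => deriv (fun ε' => φ (ε', p.2)) p.1) (ε, z) := by
  have h1 : ContDiffAt ℝ ∞ (fun p => fderiv ℝ φ p (1, 0)) (ε, z) :=
    (h.fderiv_right (m := ∞) (by simp)).clm_apply contDiffAt_const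
  refine h1.congr_of_eventuallyEq ?_
  filter_upwards [(h.of_le (m := 1) (by simp)).eventually (by simp)] with p hp
  exact (hasDerivAt_slice (hp.differentiableAt (by simp))).deriv

/-- Derivatives with respect to a parameter and to the variables commute. -/
theorem hasDerivAt_fderiv_slice {φ : ℝ × E → G} {ε : ℝ} {z : E} (h : ContDiffAt ℝ ∞ φ (ε, z)) :
    HasDerivAt (fun ε' => fderiv ℝ (fun z' => φ (ε', z')) z)
      (fderiv ℝ (fun z' => deriv (fun ε' => φ (ε', z')) ε) z) ε := by
  have hev : ∀ᶠ p in 𝓝 (ε, z), ContDiffAt ℝ 1 φ p :=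
    (h.of_le (m := 1) (by simp)).eventually (by simp)
  have hd : DifferentiableAt ℝ (fderiv ℝ φ) (ε, z) :=
    (h.fderiv_right (m := ∞) (by simp)).differentiableAt (by simp)
  have hε : Filter.Tendsto (fun ε' : ℝ => (ε', z)) (𝓝 ε) (𝓝 (ε, z)) :=
    (Continuous.prodMk_left z).tendsto ε
  have hz : Filter.Tendsto (fun z' : E => (ε, z')) (𝓝 z) (𝓝 (ε, z)) :=
    (Continuous.prodMk_right ε).tendsto z
  have h1 : (fun ε' => fderiv ℝ (fun z' => φ (ε', z')) z) =ᶠ[𝓝 ε]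
      fun ε' => fderiv ℝ φ (ε', z) ∘L ContinuousLinearMap.inr ℝ ℝ E := by
    filter_upwards [hε.eventually hev] with ε' hp
    exact (hasFDerivAt_slice (hp.differentiableAt (by simp))).fderiv
  have h2 : (fun z' => deriv (fun ε' => φ (ε', z')) ε) =ᶠ[𝓝 z]
      fun z' => fderiv ℝ φ (ε, z') (1, 0) := by
    filter_upwards [hz.eventually hev] with z' hp
    exact (hasDerivAt_slice (hp.differentiableAt (by simp))).deriv
  have h3 : fderiv ℝ (fun z' => fderiv ℝ φ (ε, z') (1, 0)) z =
      ((fderiv ℝ (fderiv ℝ φ) (ε, z)) (1, 0)) ∘L ContinuousLinearMap.inr ℝ ℝ E := by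
    have h4 := ((hasFDerivAt_slice hd).clm_apply
      (hasFDerivAt_const ((1, 0) : ℝ × E) z)).fderiv
    rw [h4]
    ext u
    have := (h.isSymmSndFDerivAt (by
      rw [minSmoothness_of_isRCLikeNormedField]; exact ENat.LEInfty.out)) (0, u) (1, 0)
    simpa using this
  have h5 := (hasDerivAt_slice hd).clm_comp
    (hasDerivAt_const ε (ContinuousLinearMap.inr ℝ ℝ E))
  rw [h2.fderiv_eq, h3]
  refine (h5.congr_of_eventuallyEq h1).congr_deriv ?_
  simp

theorem contDiffAt_fderiv_apply_comp {F : Type*} [NormedAddCommGroup F] [NormedSpace ℝ F]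
    {P : E → F →L[ℝ] ℝ} {z : E} (hP : ContDiffAt ℝ ∞ P z) (u : E) (B : G →L[ℝ] F) :
    ContDiffAt ℝ ∞ (fun z => fderiv ℝ P z u ∘L B) z :=
  ((hP.fderiv_right (m := ∞) (by simp)).clm_apply contDiffAt_const).clm_comp contDiffAt_const

end ParametricCalculus

/-! ### The first variation formula in a chart of the bundle -/

section FirstVariation
variable {n m : ℕ}
  {M : Type*} [TopologicalSpace M] [ChartedSpace (EuclideanSpace ℝ (Fin n)) M]
  [IsManifold (𝓡 n) ∞ M]
  {S : Type*} [TopologicalSpace S] [ChartedSpace (EuclideanSpace ℝ (Fin m)) S]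
  [IsManifold (𝓡 m) ∞ S]
  {e : OpenPartialHomeomorph M (EuclideanSpace ℝ (Fin n))}
  {e' : OpenPartialHomeomorph S (EuclideanSpace ℝ (Fin m))}
  {ηM : (p : M) → TangentSpace (𝓡 n) p [⋀^Fin n]→L[ℝ] ℝ} {L : J1 n m M S → ℝ}
  {f : ℝ × M → S}

theorem contDiffAt_partialY {ℓ : EJ n m → ℝ} {q : EJ n m} (h : ContDiffAt ℝ ∞ ℓ q) :
    ContDiffAt ℝ ∞ (partialY ℓ) q := by
  let ι : ES m →L[ℝ] EJ n m := (ContinuousLinearMap.inl ℝ (EX n × ES m) (EX n →L[ℝ] ES m)) ∘L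
        (ContinuousLinearMap.inr ℝ (EX n) (ES m))
  have h1 : ContDiffAt ℝ ∞ (fun q => fderiv ℝ ℓ q ∘L ι) q :=
    (h.fderiv_right (m := ∞) (by simp)).clm_comp contDiffAt_const
  refine h1.congr_of_eventuallyEq ?_
  filter_upwards [(h.of_le (m := 1) (by simp)).eventually (by simp)] with p hp
  exact ContinuousLinearMap.ext fun w => partialY_apply (hp.differentiableAt (by simp)) w

/-- The Euler–Lagrange covector along `φ`, as a function of the coordinates with values in the
continuous linear forms. -/
def elCovector (ηM : (p : M) → TangentSpace (𝓡 n) p [⋀^Fin n]→L[ℝ] ℝ) (L : J1 n m M S → ℝ)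
    (f : ℝ × M → S) (e : OpenPartialHomeomorph M (EuclideanSpace ℝ (Fin n)))
    (e' : OpenPartialHomeomorph S (EuclideanSpace ℝ (Fin m))) (z : EX n) : ES m →L[ℝ] ℝ :=
  partialY (lagr L e e') (modelJet (fieldInCharts f e e') z) -
    (density ηM e z.2)⁻¹ • ∑ μ : Fin (n + 1), fderiv ℝ (fun z : EX n => density ηM e z.2 •
      partialA (lagr L e e') (modelJet (fieldInCharts f e e') z)) z (dX μ) ∘L
        (ContinuousLinearMap.smulRightL ℝ (EX n) (ES m) (dXdual μ))

/-- Along a smooth section, the vector in `elForm` can be taken out of the derivatives. -/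
theorem elForm_eq_elCovector (hηM : IsSmoothForm (𝓡 n) ηM) (hL : ContMDiff (IJ n m) 𝓘(ℝ, ℝ) ∞ L)
    (he : IsSmoothChart (𝓡 n) e) (he' : IsSmoothChart (𝓡 m) e') {x : ℝ × M}
    (hf : ContMDiffAt (IX n) (𝓡 m) ∞ f x) (h1 : x.2 ∈ e.source) (h2 : f x ∈ e'.source)
    (w : ES m) : elForm ηM L f e e' x w = elCovector ηM L f e e' (xChart e x) w := by
  have h1' : x ∈ (xChart e).source := mem_xChart_source.2 h1
  have hl : (xChart e).symm (xChart e x) = x := (xChart e).left_inv h1'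
  have hP := (contDiffAt_momentum hηM hL he he' ((xChart e).map_source h1')
    (by rwa [hl]) (by rwa [hl])).differentiableAt (by simp)
  have hD : ∀ μ : Fin (n + 1), fderiv ℝ (fun z : EX n => density ηM e z.2 *
      partialA (lagr L e e') (modelJet (fieldInCharts f e e') z) ((dXdual μ).smulRight w))
        (xChart e x) (dX μ) = fderiv ℝ (fun z : EX n => density ηM e z.2 •
      partialA (lagr L e e') (modelJet (fieldInCharts f e e') z)) (xChart e x) (dX μ)
          (ContinuousLinearMap.smulRightL ℝ (EX n) (ES m) (dXdual μ) w) := by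
    intro μ
    have h3 := hP.hasFDerivAt.clm_apply (hasFDerivAt_const ((dXdual μ).smulRight w) (xChart e x))
    refine (congrArg (fun T : EX n →L[ℝ] ℝ => T (dX μ)) h3.fderiv).trans ?_
    simp
  simp only [elForm, hD]
  simp [elCovector, sum_apply]

theorem elForm_eq_sum (hηM : IsSmoothForm (𝓡 n) ηM) (hL : ContMDiff (IJ n m) 𝓘(ℝ, ℝ) ∞ L)
    (he : IsSmoothChart (𝓡 n) e) (he' : IsSmoothChart (𝓡 m) e') {x : ℝ × M}
    (hf : ContMDiffAt (IX n) (𝓡 m) ∞ f x) (h1 : x.2 ∈ e.source) (h2 : f x ∈ e'.source)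
    (w : ES m) :
    elForm ηM L f e e' x w = ∑ a, w a * eulerLagrange ηM L f e e' x a := by
  simp only [eulerLagrange_eq_elForm, elForm_eq_elCovector hηM hL he he' hf h1 h2]
  have hw : w = ∑ a, w a • EuclideanSpace.single a (1 : ℝ) := by
    ext i
    simp [Pi.single_apply]
  conv_lhs => rw [hw]
  simp

theorem contDiffAt_elCovector (hηM : IsSmoothForm (𝓡 n) ηM) (hηM0 : ∀ p, ηM p ≠ 0)
    (hL : ContMDiff (IJ n m) 𝓘(ℝ, ℝ) ∞ L)
    (he : IsSmoothChart (𝓡 n) e) (he' : IsSmoothChart (𝓡 m) e') {z : EX n}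
    (hz : z ∈ (xChart e).target) (hf : ContMDiffAt (IX n) (𝓡 m) ∞ f ((xChart e).symm z))
    (h2 : f ((xChart e).symm z) ∈ e'.source) :
    ContDiffAt ℝ ∞ (elCovector ηM L f e e') z := by
  have hP := contDiffAt_momentum hηM hL he he' hz hf h2
  have hq := contDiffAt_modelJet (contDiffAt_fieldInCharts he he' hz hf h2)
  have hY : ContDiffAt ℝ ∞
      (fun z => partialY (lagr L e e') (modelJet (fieldInCharts f e e') z)) z :=
    ContDiffAt.comp (𝕜 := ℝ) z (f := modelJet (fieldInCharts f e e'))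
      (contDiffAt_partialY (contDiffAt_lagr_modelJet hL he he' hz h2)) hq
  have hρ : ContDiffAt ℝ ∞ (fun z : EX n => (density ηM e z.2)⁻¹) z :=
    (ContDiffAt.comp (𝕜 := ℝ) z (f := fun z : EX n => z.2)
      (contDiffAt_density hηM he (mem_xChart_target.1 hz)) contDiffAt_snd).inv
        (density_ne_zero hηM0 he (mem_xChart_target.1 hz))
  refine hY.sub (contDiffAt_real_smul hρ (ContDiffAt.sum fun μ _ => ?_))
  exact contDiffAt_fderiv_apply_comp hP (dX μ) _

/-- The first variation of the Lagrangian along `φ` for the variation `v` of the field, in the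
charts `e`, `e'`. -/
def varDensity (L : J1 n m M S → ℝ) (f : ℝ × M → S)
    (e : OpenPartialHomeomorph M (EuclideanSpace ℝ (Fin n)))
    (e' : OpenPartialHomeomorph S (EuclideanSpace ℝ (Fin m))) (v : EX n → ES m) (z : EX n) : ℝ :=
  partialY (lagr L e e') (modelJet (fieldInCharts f e e') z) (v z) +
    partialA (lagr L e e') (modelJet (fieldInCharts f e e') z) (fderiv ℝ v z)

theorem closure_inter_target {U : Set (ℝ × M)} {z : EX n} (hz : z ∈ (xChart e).target)
    (h : z ∈ closure ((xChart e).target ∩ (xChart e).symm ⁻¹' U)) :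
    (xChart e).symm z ∈ closure U := by
  rw [mem_closure_iff_frequently] at h ⊢
  exact ((xChart e).continuousAt_symm hz).frequently (h.mono fun y hy => hy.2)

/-- The first variation formula for variations supported in a chart domain. -/
theorem firstVariation_chart [CompactSpace M] [SecondCountableTopology M] [MeasurableSpace M]
    [BorelSpace M] (hηM : IsSmoothForm (𝓡 n) ηM) (hηM0 : ∀ p, ηM p ≠ 0)
    (hL : ContMDiff (IJ n m) 𝓘(ℝ, ℝ) ∞ L) (he : IsSmoothChart (𝓡 n) e)
    (he' : IsSmoothChart (𝓡 m) e') {U K : Set (ℝ × M)} (hU : IsOpen U) (hK : IsCompact K)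
    (hKe : K ⊆ (xChart e).source) (hf : ∀ x ∈ closure U ∩ K, ContMDiffAt (IX n) (𝓡 m) ∞ f x)
    (hfK : ∀ x ∈ closure U ∩ K, f x ∈ e'.source) {v : EX n → ES m}
    (hv : ∀ x ∈ closure U ∩ K, ContDiffAt ℝ ∞ v (xChart e x))
    (hvK : ∀ x ∈ U, x ∈ (xChart e).source → x ∉ K → v (xChart e x) = 0)
    (hv0 : ∀ x ∈ frontier U ∩ K, v (xChart e x) = 0) :
    IntegrableOn (fun x => varDensity L f e e' v (xChart e x)) (U ∩ (xChart e).source) (volX ηM) ∧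
    ∫ x in U ∩ (xChart e).source, varDensity L f e e' v (xChart e x) ∂(volX ηM) =
      ∫ x in U ∩ (xChart e).source, elForm ηM L f e e' x (v (xChart e x)) ∂(volX ηM) := by
  set c := xChart e with hc
  set U' := c.target ∩ c.symm ⁻¹' U with hU'
  have hU'o : IsOpen U' := c.isOpen_inter_preimage_symm hU
  set K' := c '' K with hK'
  have hK'c : IsCompact K' := hK.image_of_continuousOn (c.continuousOn.mono hKe)
  have hKt : K' ⊆ c.target := by rintro _ ⟨x, hx, rfl⟩; exact c.map_source (hKe hx)
  have hKs : ∀ z ∈ K', c.symm z ∈ K := by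
    rintro _ ⟨x, hx, rfl⟩; rwa [c.left_inv (hKe hx)]
  have hcl : ∀ z ∈ closure U' ∩ K', c.symm z ∈ closure U ∩ K := fun z hz =>
    ⟨closure_inter_target (hKt hz.2) hz.1, hKs z hz.2⟩
  have hfr : ∀ z ∈ frontier U' ∩ K', c.symm z ∈ frontier U ∩ K := by
    rintro z ⟨hz1, hz2⟩
    rw [hU'o.frontier_eq] at hz1
    rw [hU.frontier_eq]
    exact ⟨⟨(hcl z ⟨hz1.1, hz2⟩).1, fun h => hz1.2 ⟨hKt hz2, h⟩⟩, hKs z hz2⟩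
  have hUK : ∀ z ∈ U', z ∉ K' → v z = 0 := by
    intro z hz hzK
    have := hvK (c.symm z) hz.2 (c.map_target hz.1) fun h => hzK ⟨_, h, c.right_inv hz.1⟩
    rwa [c.right_inv hz.1] at this
  have hρ : ∀ z ∈ c.target, ContDiffAt ℝ ∞ (fun z : EX n => density ηM e z.2) z := fun z hz =>
    ContDiffAt.comp (𝕜 := ℝ) z (f := fun z : EX n => z.2)
      (contDiffAt_density hηM he (mem_xChart_target.1 hz)) contDiffAt_snd
  have hq : ∀ z ∈ closure U' ∩ K', ContDiffAt ℝ ∞ (modelJet (fieldInCharts f e e')) z ∧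
      ContDiffAt ℝ ∞ (lagr L e e') (modelJet (fieldInCharts f e e') z) := fun z hz =>
    ⟨contDiffAt_modelJet (contDiffAt_fieldInCharts he he' (hKt hz.2) (hf _ (hcl z hz))
      (hfK _ (hcl z hz))), contDiffAt_lagr_modelJet hL he he' (hKt hz.2) (hfK _ (hcl z hz))⟩
  have hv' : ∀ z ∈ closure U' ∩ K', ContDiffAt ℝ ∞ v z := fun z hz => by
    have := hv _ (hcl z hz)
    rwa [c.right_inv (hKt hz.2)] at this
  have hYc : ∀ z ∈ closure U' ∩ K', ContDiffAt ℝ ∞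
      (fun z => partialY (lagr L e e') (modelJet (fieldInCharts f e e') z)) z := fun z hz =>
    ContDiffAt.comp (𝕜 := ℝ) z (f := modelJet (fieldInCharts f e e'))
      (contDiffAt_partialY (hq z hz).2) (hq z hz).1
  have hAc : ∀ z ∈ closure U' ∩ K', ContDiffAt ℝ ∞
      (fun z => partialA (lagr L e e') (modelJet (fieldInCharts f e e') z)) z := fun z hz =>
    ContDiffAt.comp (𝕜 := ℝ) z (f := modelJet (fieldInCharts f e e'))
      (contDiffAt_partialA (hq z hz).2) (hq z hz).1
  have key := model_firstVariation hU'o hK'c (ρ := fun z => density ηM e z.2)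
    (a := fun z => partialY (lagr L e e') (modelJet (fieldInCharts f e e') z))
    (Q := fun z => partialA (lagr L e e') (modelJet (fieldInCharts f e e') z)) (v := v)
    (fun z hz => hρ z (hKt hz.2))
    (fun z hz => density_ne_zero hηM0 he (mem_xChart_target.1 (hKt hz.2)))
    (fun z hz => (hYc z hz).continuousAt) hAc hv' hUK
    (fun z hz => by
      have := hv0 _ (hfr z hz)
      rwa [c.right_inv (hKt hz.2)] at this)
  have hW : IsOpen (U ∩ c.source) := hU.inter c.open_source
  have hpre : c.target ∩ c.symm ⁻¹' (U ∩ c.source) = U' := by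
    ext z
    constructor
    · rintro ⟨h1, h2, -⟩; exact ⟨h1, h2⟩
    · rintro ⟨h1, h2⟩; exact ⟨h1, h2, c.map_target h1⟩
  -- a function of the coordinates which is continuous on `K` and zero off `K` is continuous on `U`
  have hcont : ∀ H : EX n → ℝ, (∀ z ∈ closure U' ∩ K', ContinuousAt H z) →
      (∀ z ∈ U', z ∉ K' → H z = 0) →
      AEStronglyMeasurable (fun x => H (c x)) ((volX ηM).restrict (U ∩ c.source)) := by
    intro H h1 h2
    refine ContinuousOn.aestronglyMeasurable (fun x hx => ?_) hW.measurableSet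
    have hxU : c x ∈ U' := ⟨c.map_source hx.2, by
      change c.symm (c x) ∈ U
      rw [c.left_inv hx.2]; exact hx.1⟩
    have h3 : ContinuousAt H (c x) := by
      by_cases hxK : c x ∈ K'
      · exact h1 _ ⟨subset_closure hxU, hxK⟩
      · refine (continuousAt_const (y := (0 : ℝ))).congr ?_
        filter_upwards [(hU'o.sdiff hK'c.isClosed).mem_nhds ⟨hxU, hxK⟩] with y hy
        exact (h2 y hy.1 hy.2).symm
    exact (h3.comp (c.continuousAt hx.2)).continuousWithinAt
  have hfd : ∀ z ∈ U', z ∉ K' → fderiv ℝ v z = 0 := fun z hz hzK => by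
    have : v =ᶠ[𝓝 z] 0 := by
      filter_upwards [(hU'o.sdiff hK'c.isClosed).mem_nhds ⟨hz, hzK⟩] with y hy
      exact hUK y hy.1 hy.2
    rw [this.fderiv_eq]
    simp
  have hm1 : AEStronglyMeasurable (fun x => varDensity L f e e' v (c x))
      ((volX ηM).restrict (U ∩ c.source)) := by
    refine hcont (varDensity L f e e' v) (fun z hz => ?_) fun z hz hzK => ?_
    · exact ((hYc z hz).continuousAt.clm_apply (hv' z hz).continuousAt).add
        ((hAc z hz).continuousAt.clm_apply
          ((hv' z hz).fderiv_right (m := ∞) (by simp)).continuousAt)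
    · simp [varDensity, hUK z hz hzK, hfd z hz hzK]
  have hel : ∀ x ∈ U ∩ c.source, elForm ηM L f e e' x (v (c x)) =
      elCovector ηM L f e e' (c x) (v (c x)) := by
    intro x hx
    by_cases hxK : x ∈ K
    · exact elForm_eq_elCovector hηM hL he he' (hf x ⟨subset_closure hx.1, hxK⟩)
        (mem_xChart_source.1 hx.2) (hfK x ⟨subset_closure hx.1, hxK⟩) _
    · rw [hvK x hx.1 hx.2 hxK, map_zero, elForm_zero]
  have hm2 : AEStronglyMeasurable (fun x => elForm ηM L f e e' x (v (c x)))
      ((volX ηM).restrict (U ∩ c.source)) := by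
    refine (hcont (fun z => elCovector ηM L f e e' z (v z)) (fun z hz => ?_)
      fun z hz hzK => ?_).congr ?_
    · exact (contDiffAt_elCovector hηM hηM0 hL he he' (hKt hz.2) (hf _ (hcl z hz))
        (hfK _ (hcl z hz))).continuousAt.clm_apply (hv' z hz).continuousAt
    · simp only [hUK z hz hzK, map_zero]
    · filter_upwards [ae_restrict_mem hW.measurableSet] with x hx
      exact (hel x hx).symm
  have hI1 := setIntegral_volX hηM he hW.measurableSet inter_subset_right hm1
  have hI2 := setIntegral_volX hηM he hW.measurableSet inter_subset_right hm2
  have hI3 := integrableOn_volX hηM he hW.measurableSet inter_subset_right hm1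
  rw [← hc, hpre] at hI1 hI2 hI3
  have hr : ∀ z ∈ U', c (c.symm z) = z := fun z hz => c.right_inv hz.1
  constructor
  · rw [hI3]
    refine key.1.congr_fun (fun z hz => ?_) hU'o.measurableSet
    simp only [hr z hz]
    rfl
  · rw [hI1, hI2]
    refine Eq.trans ?_ (key.2.trans ?_)
    · refine setIntegral_congr_fun hU'o.measurableSet fun z hz => ?_
      simp only [hr z hz]
      rfl
    · refine setIntegral_congr_fun hU'o.measurableSet fun z hz => ?_
      have h2 : e (c.symm z).2 = z.2 := congrArg Prod.snd (hr z hz)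
      simp only [elForm, hr z hz, ← hc, h2]

end FirstVariation

/-! ### The action along a family of sections -/

section Families
variable {n m : ℕ}
  {M : Type*} [TopologicalSpace M] [ChartedSpace (EuclideanSpace ℝ (Fin n)) M]
  [IsManifold (𝓡 n) ∞ M]
  {S : Type*} [TopologicalSpace S] [ChartedSpace (EuclideanSpace ℝ (Fin m)) S]
  [IsManifold (𝓡 m) ∞ S]
  {e : OpenPartialHomeomorph M (EuclideanSpace ℝ (Fin n))}
  {e' : OpenPartialHomeomorph S (EuclideanSpace ℝ (Fin m))}
  {ηM : (p : M) → TangentSpace (𝓡 n) p [⋀^Fin n]→L[ℝ] ℝ} {L : J1 n m M S → ℝ}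
  {g : ℝ × (ℝ × M) → S}

/-- A one-parameter family of fields in coordinates. -/
def familyInCharts (g : ℝ × (ℝ × M) → S)
    (e : OpenPartialHomeomorph M (EuclideanSpace ℝ (Fin n)))
    (e' : OpenPartialHomeomorph S (EuclideanSpace ℝ (Fin m))) (p : ℝ × EX n) : ES m :=
  fieldInCharts (fun x => g (p.1, x)) e e' p.2

/-- The coordinate expression of the variation field `∂/∂ε` of a one-parameter family. -/
def variationInCharts (g : ℝ × (ℝ × M) → S)
    (e : OpenPartialHomeomorph M (EuclideanSpace ℝ (Fin n)))
    (e' : OpenPartialHomeomorph S (EuclideanSpace ℝ (Fin m))) (ε : ℝ) (z : EX n) : ES m :=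
  deriv (fun ε' => familyInCharts g e e' (ε', z)) ε

/-- The derivative of the Lagrangian along a one-parameter family of fields. -/
def lagrangianVariation (L : J1 n m M S → ℝ) (g : ℝ × (ℝ × M) → S) (p : ℝ × (ℝ × M)) : ℝ :=
  deriv (fun ε => L (jet (fun x => g (ε, x)) p.2)) p.1

theorem contDiffAt_familyInCharts (he : IsSmoothChart (𝓡 n) e) (he' : IsSmoothChart (𝓡 m) e')
    {ε : ℝ} {z : EX n} (hz : z ∈ (xChart e).target)
    (hg : ContMDiffAt (𝓘(ℝ, ℝ).prod (IX n)) (𝓡 m) ∞ g (ε, (xChart e).symm z))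
    (h2 : g (ε, (xChart e).symm z) ∈ e'.source) :
    ContDiffAt ℝ ∞ (familyInCharts g e e') (ε, z) := by
  have h1 : ContMDiffAt 𝓘(ℝ, ℝ × EX n) (𝓘(ℝ, ℝ).prod (IX n)) ∞
      (fun p : ℝ × EX n => (p.1, (xChart e).symm p.2)) (ε, z) :=
    (contDiff_fst.contMDiff.contMDiffAt).prodMk
      (ContMDiffAt.comp (ε, z) (g := (xChart e).symm) (f := fun p : ℝ × EX n => p.2)
        ((isSmoothChart_xChart he).contMDiffAt_symm hz) contDiff_snd.contMDiff.contMDiffAt)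
  exact ((he'.contMDiffAt h2).comp (ε, z) (hg.comp (ε, z) h1)).contDiffAt

theorem contMDiffAt_slice {ε : ℝ} {x : ℝ × M}
    (hg : ContMDiffAt (𝓘(ℝ, ℝ).prod (IX n)) (𝓡 m) ∞ g (ε, x)) :
    ContMDiffAt (IX n) (𝓡 m) ∞ (fun x => g (ε, x)) x :=
  ContMDiffAt.comp (I' := 𝓘(ℝ, ℝ).prod (IX n)) x (g := g) (f := fun x => (ε, x)) hg
    (contMDiffAt_const.prodMk contMDiffAt_id)

/-- The coordinates of the jets of the members of a family of sections. -/
theorem eventually_jet_family_eq (he : IsSmoothChart (𝓡 n) e) (he' : IsSmoothChart (𝓡 m) e')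
    {ε : ℝ} {x : ℝ × M} (h1 : x.2 ∈ e.source)
    (hg : ContMDiffAt (𝓘(ℝ, ℝ).prod (IX n)) (𝓡 m) ∞ g (ε, x)) (h2 : g (ε, x) ∈ e'.source) :
    ∀ᶠ p in 𝓝 (ε, x), (jet (fun x => g (p.1, x)) p.2 : J1 n m M S) =
      jetParam e e' ((xChart e p.2, familyInCharts g e e' (p.1, xChart e p.2)),
        fderiv ℝ (fun z => familyInCharts g e e' (p.1, z)) (xChart e p.2)) := by
  have h3 := (contMDiffAt_iff_contMDiffAt_nhds (by simp)).1 (hg.of_le (m := 1) (by simp))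
  have h4 : ∀ᶠ p : ℝ × (ℝ × M) in 𝓝 (ε, x), p.2 ∈ (xChart e).source :=
    ((xChart e).open_source.preimage continuous_snd).mem_nhds (mem_xChart_source.2 h1)
  filter_upwards [h3, hg.continuousAt.preimage_mem_nhds (e'.open_source.mem_nhds h2), h4]
    with p a1 a2 a3
  have a4 : ContMDiffAt (IX n) (𝓡 m) 1 (fun x => g (p.1, x)) p.2 :=
    ContMDiffAt.comp (I' := 𝓘(ℝ, ℝ).prod (IX n)) p.2 (g := g) (f := fun x => (p.1, x)) a1
      (contMDiffAt_const.prodMk contMDiffAt_id)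
  exact jet_eq_jetParam he he' (a4.mdifferentiableAt (by simp)) (mem_xChart_source.1 a3) a2

/-- The Lagrangian along a one-parameter family of fields is a smooth function. -/
theorem contMDiffAt_lagrangian_family (hL : ContMDiff (IJ n m) 𝓘(ℝ, ℝ) ∞ L) {ε : ℝ} {x : ℝ × M}
    (hg : ContMDiffAt (𝓘(ℝ, ℝ).prod (IX n)) (𝓡 m) ∞ g (ε, x)) :
    ContMDiffAt (𝓘(ℝ, ℝ).prod (IX n)) 𝓘(ℝ, ℝ) ∞
      (fun p : ℝ × (ℝ × M) => L (jet (fun x => g (p.1, x)) p.2)) (ε, x) := by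
  set e := chartAt (EuclideanSpace ℝ (Fin n)) x.2
  set e' := chartAt (EuclideanSpace ℝ (Fin m)) (g (ε, x))
  have he : IsSmoothChart (𝓡 n) e := isSmoothChart_chartAt _
  have he' : IsSmoothChart (𝓡 m) e' := isSmoothChart_chartAt _
  have h1 : x.2 ∈ e.source := mem_chart_source _ _
  have h2 : g (ε, x) ∈ e'.source := mem_chart_source _ _
  have h1' : x ∈ (xChart e).source := mem_xChart_source.2 h1
  have hl : (xChart e).symm (xChart e x) = x := (xChart e).left_inv h1'
  have hφ := contDiffAt_familyInCharts (g := g) (ε := ε) he he' ((xChart e).map_source h1')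
    (by rwa [hl]) (by rwa [hl])
  let Q : ℝ × EX n → EJ n m := fun p => ((p.2, familyInCharts g e e' p),
    fderiv ℝ (familyInCharts g e e') p ∘L ContinuousLinearMap.inr ℝ ℝ (EX n))
  have hQ : ContDiffAt ℝ ∞ Q (ε, xChart e x) :=
    (contDiffAt_snd.prodMk hφ).prodMk
      ((hφ.fderiv_right (m := ∞) (by simp)).clm_comp contDiffAt_const)
  have hx : ContMDiffAt (𝓘(ℝ, ℝ).prod (IX n)) 𝓘(ℝ, ℝ × EX n) ∞
      (fun p : ℝ × (ℝ × M) => (p.1, xChart e p.2)) (ε, x) := by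
    rw [modelWithCornersSelf_prod, ← chartedSpaceSelf_prod]
    exact contMDiffAt_fst.prodMk (ContMDiffAt.comp (I' := IX n) (ε, x) (g := xChart e)
      (f := fun p : ℝ × (ℝ × M) => p.2) ((isSmoothChart_xChart he).contMDiffAt h1')
        contMDiffAt_snd)
  have hq2 : (Q (ε, xChart e x)).1.2 ∈ e'.target := by
    change e' (g (ε, (xChart e).symm (xChart e x))) ∈ _
    rw [hl]; exact e'.map_source h2
  have h5 : ContMDiffAt (𝓘(ℝ, ℝ).prod (IX n)) (IJ n m) ∞
      (fun p : ℝ × (ℝ × M) => (jetParam e e' (Q (p.1, xChart e p.2)) : J1 n m M S)) (ε, x) :=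
    ContMDiffAt.comp (I' := 𝓘(ℝ, EJ n m)) (ε, x) (g := jetParam e e')
      (f := fun p : ℝ × (ℝ × M) => Q (p.1, xChart e p.2))
      (contMDiffAt_jetParam he he' (e.map_source h1) hq2)
      (ContMDiffAt.comp (I' := 𝓘(ℝ, ℝ × EX n)) (ε, x) (g := Q)
        (f := fun p : ℝ × (ℝ × M) => (p.1, xChart e p.2)) hQ.contMDiffAt hx)
  refine ((hL _).comp (ε, x) h5).congr_of_eventuallyEq ?_
  have hev : ∀ᶠ p : ℝ × (ℝ × M) in 𝓝 (ε, x),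
      ContDiffAt ℝ 1 (familyInCharts g e e') (p.1, xChart e p.2) :=
    hx.continuousAt.eventually ((hφ.of_le (m := 1) (by simp)).eventually (by simp))
  filter_upwards [eventually_jet_family_eq he he' h1 hg h2, hev] with p hp hp2
  have h6 := (hasFDerivAt_slice (hp2.differentiableAt (by simp))).fderiv
  simp only [Function.comp, hp, Q]
  rw [h6]

/-- The derivative of the Lagrangian along a family is the first variation for the variation
field of the family. -/
theorem hasDerivAt_lagrangian_family (hL : ContMDiff (IJ n m) 𝓘(ℝ, ℝ) ∞ L)
    (he : IsSmoothChart (𝓡 n) e) (he' : IsSmoothChart (𝓡 m) e')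
    {ε : ℝ} {x : ℝ × M} (h1 : x.2 ∈ e.source)
    (hg : ContMDiffAt (𝓘(ℝ, ℝ).prod (IX n)) (𝓡 m) ∞ g (ε, x)) (h2 : g (ε, x) ∈ e'.source) :
    HasDerivAt (fun ε' => L (jet (fun x => g (ε', x)) x))
      (varDensity L (fun x => g (ε, x)) e e' (variationInCharts g e e' ε) (xChart e x)) ε := by
  have h1' : x ∈ (xChart e).source := mem_xChart_source.2 h1
  have hl : (xChart e).symm (xChart e x) = x := (xChart e).left_inv h1'
  set z := xChart e x with hz
  have hzt : z ∈ (xChart e).target := (xChart e).map_source h1'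
  have hφ := contDiffAt_familyInCharts (g := g) (ε := ε) he he' hzt (by rwa [hl]) (by rwa [hl])
  set q := modelJet (fieldInCharts (fun x => g (ε, x)) e e') z with hq
  have hℓ : ContDiffAt ℝ ∞ (lagr L e e') q :=
    contDiffAt_lagr_modelJet (f := fun x => g (ε, x)) hL he he' hzt (by rwa [hl])
  have hd1 : HasDerivAt (fun ε' => familyInCharts g e e' (ε', z))
      (variationInCharts g e e' ε z) ε :=
    (hasDerivAt_slice (hφ.differentiableAt (by simp))).differentiableAt.hasDerivAt
  have hd2 := hasDerivAt_fderiv_slice hφ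
  have hd3 : HasDerivAt (fun ε' => (((z, familyInCharts g e e' (ε', z)),
      fderiv ℝ (fun z' => familyInCharts g e e' (ε', z')) z) : EJ n m))
      (((0, variationInCharts g e e' ε z), fderiv ℝ (variationInCharts g e e' ε) z) : EJ n m) ε :=
    ((hasDerivAt_const ε z).prodMk hd1).prodMk hd2
  have hℓd : DifferentiableAt ℝ (lagr L e e') q := hℓ.differentiableAt (by simp)
  have hd4 := HasFDerivAt.comp_hasDerivAt (𝕜 := ℝ) ε (l := lagr L e e')
    (f := fun ε' => (((z, familyInCharts g e e' (ε', z)),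
      fderiv ℝ (fun z' => familyInCharts g e e' (ε', z')) z) : EJ n m)) hℓd.hasFDerivAt hd3
  have hsplit : fderiv ℝ (lagr L e e') q ((0, variationInCharts g e e' ε z),
      fderiv ℝ (variationInCharts g e e' ε) z) =
      varDensity L (fun x => g (ε, x)) e e' (variationInCharts g e e' ε) z := by
    rw [varDensity, ← hq, partialY_apply hℓd, partialA_eq hℓd]
    refine Eq.trans ?_ (map_add (fderiv ℝ (lagr L e e') q) ((0, variationInCharts g e e' ε z), 0)
      (0, fderiv ℝ (variationInCharts g e e' ε) z))
    simp
  rw [← hsplit]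
  refine hd4.congr_of_eventuallyEq ?_
  have hε : Filter.Tendsto (fun ε' : ℝ => (ε', x)) (𝓝 ε) (𝓝 (ε, x)) :=
    (Continuous.prodMk_left x).tendsto ε
  filter_upwards [hε.eventually (eventually_jet_family_eq he he' h1 hg h2)] with ε' hε'
  exact congrArg L hε'

/-- The partial derivative with respect to the parameter of a smooth function on `ℝ × X`. -/
theorem continuousAt_deriv_slice {G : ℝ × (ℝ × M) → ℝ} {ε : ℝ} {x : ℝ × M}
    (hG : ContMDiffAt (𝓘(ℝ, ℝ).prod (IX n)) 𝓘(ℝ, ℝ) ∞ G (ε, x)) :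
    DifferentiableAt ℝ (fun ε' => G (ε', x)) ε ∧
    ContinuousAt (fun p : ℝ × (ℝ × M) => deriv (fun ε' => G (ε', p.2)) p.1) (ε, x) := by
  set e := chartAt (EuclideanSpace ℝ (Fin n)) x.2
  have he : IsSmoothChart (𝓡 n) e := isSmoothChart_chartAt _
  have h1' : x ∈ (xChart e).source := mem_xChart_source.2 (mem_chart_source _ _)
  have hl : (xChart e).symm (xChart e x) = x := (xChart e).left_inv h1'
  have h1 : ContMDiffAt 𝓘(ℝ, ℝ × EX n) (𝓘(ℝ, ℝ).prod (IX n)) ∞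
      (fun p : ℝ × EX n => (p.1, (xChart e).symm p.2)) (ε, xChart e x) :=
    (contDiff_fst.contMDiff.contMDiffAt).prodMk
      (ContMDiffAt.comp (ε, xChart e x) (g := (xChart e).symm) (f := fun p : ℝ × EX n => p.2)
        ((isSmoothChart_xChart he).contMDiffAt_symm ((xChart e).map_source h1'))
        contDiff_snd.contMDiff.contMDiffAt)
  have h2 : ContDiffAt ℝ ∞ (fun p : ℝ × EX n => G (p.1, (xChart e).symm p.2)) (ε, xChart e x) :=
    (ContMDiffAt.comp (I' := 𝓘(ℝ, ℝ).prod (IX n)) (ε, xChart e x) (g := G)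
      (f := fun p : ℝ × EX n => (p.1, (xChart e).symm p.2)) (by rwa [hl]) h1).contDiffAt
  constructor
  · have := (hasDerivAt_slice (h2.differentiableAt (by simp))).differentiableAt
    dsimp only at this
    rwa [hl] at this
  · have h3 := (contDiffAt_deriv_slice h2).continuousAt
    have h4 : ContinuousAt (fun p : ℝ × (ℝ × M) => (p.1, xChart e p.2)) (ε, x) :=
      continuousAt_fst.prodMk (ContinuousAt.comp (f := fun p : ℝ × (ℝ × M) => p.2)
        ((xChart e).continuousAt h1') continuousAt_snd)
    have h5 := ContinuousAt.comp (f := fun p : ℝ × (ℝ × M) => (p.1, xChart e p.2)) h3 h4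
    refine h5.congr ?_
    filter_upwards [((xChart e).open_source.preimage continuous_snd).mem_nhds h1'] with p hp
    have hp' : (xChart e).symm (xChart e p.2) = p.2 := (xChart e).left_inv hp
    simp only [Function.comp, hp']

/-- Differentiation of the action under the integral sign, for a family of fields which is smooth
on a neighbourhood of the closure of `U`. -/
theorem hasDerivAt_action [T2Space M] [CompactSpace M] [SecondCountableTopology M]
    [MeasurableSpace M] [BorelSpace M] (hηM : IsSmoothForm (𝓡 n) ηM)
    (hL : ContMDiff (IJ n m) 𝓘(ℝ, ℝ) ∞ L)
    {U : Set (ℝ × M)} (hU : IsOpen U) (hUc : IsCompact (closure U)) {δ : ℝ} (hδ : 0 < δ)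
    (hg : ∀ ε ∈ Ioo (-δ) δ, ∀ x ∈ closure U,
      ContMDiffAt (𝓘(ℝ, ℝ).prod (IX n)) (𝓡 m) ∞ g (ε, x)) :
    IntegrableOn (fun x => lagrangianVariation L g (0, x)) U (volX ηM) ∧
    HasDerivAt (fun ε => action ηM L U (fun x => g (ε, x)))
      (∫ x in U, lagrangianVariation L g (0, x) ∂(volX ηM)) 0 := by
  have := isFiniteMeasure_volMeasure hηM
  have hsm : ∀ ε ∈ Ioo (-δ) δ, ∀ x ∈ closure U, ContMDiffAt (𝓘(ℝ, ℝ).prod (IX n)) 𝓘(ℝ, ℝ) ∞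
      (fun p : ℝ × (ℝ × M) => L (jet (fun x => g (p.1, x)) p.2)) (ε, x) := fun ε hε x hx =>
    contMDiffAt_lagrangian_family hL (hg ε hε x hx)
  have hfin : (volX ηM) U < ⊤ := (measure_mono subset_closure).trans_lt hUc.measure_lt_top
  set r := δ / 2 with hr
  have hrδ : Icc (-r) r ⊆ Ioo (-δ) δ := fun ε hε => ⟨by linarith [hε.1], by linarith [hε.2]⟩
  have hcont : ContinuousOn (lagrangianVariation L g) (Icc (-r) r ×ˢ closure U) := by
    rintro ⟨ε, x⟩ ⟨hε, hx⟩
    exact (continuousAt_deriv_slice (hsm ε (hrδ hε) x hx)).2.continuousWithinAt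
  obtain ⟨C, hC⟩ := (isCompact_Icc.prod hUc).exists_bound_of_continuousOn hcont
  have hslice : ∀ ε ∈ Ioo (-δ) δ, ContinuousOn (fun x => L (jet (fun x => g (ε, x)) x))
      (closure U) := fun ε hε x hx =>
    (ContinuousAt.comp (f := fun x : ℝ × M => (ε, x)) (hsm ε hε x hx).continuousAt
      (Continuous.prodMk_right ε).continuousAt).continuousWithinAt
  have h0 : (0 : ℝ) ∈ Ioo (-δ) δ := ⟨by linarith, hδ⟩
  refine hasDerivAt_integral_of_dominated_loc_of_deriv_le (s := Icc (-r) r)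
    (F := fun ε x => L (jet (fun x => g (ε, x)) x))
    (F' := fun ε x => lagrangianVariation L g (ε, x))
    (bound := fun _ => C) (Icc_mem_nhds (by linarith) (by linarith)) ?_ ?_ ?_ ?_ ?_ ?_
  · filter_upwards [Ioo_mem_nhds h0.1 h0.2] with ε hε
    exact ((hslice ε hε).mono subset_closure).aestronglyMeasurable hU.measurableSet
  · exact ((hslice 0 h0).integrableOn_compact hUc).mono_set subset_closure
  · refine ContinuousOn.aestronglyMeasurable (fun x hx => ?_) hU.measurableSet
    exact (ContinuousAt.comp (f := fun x : ℝ × M => ((0 : ℝ), x))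
      (continuousAt_deriv_slice (hsm 0 h0 x (subset_closure hx))).2
      (Continuous.prodMk_right (0 : ℝ)).continuousAt).continuousWithinAt
  · filter_upwards [ae_restrict_mem hU.measurableSet] with x hx ε hε
    exact hC (ε, x) ⟨hε, subset_closure hx⟩
  · exact integrableOn_const hfin.ne
  · filter_upwards [ae_restrict_mem hU.measurableSet] with x hx ε hε
    exact (continuousAt_deriv_slice (hsm ε (hrδ hε) x (subset_closure hx))).1.hasDerivAt

end Families

/-! ### The global first variation formula -/

section GlobalFirstVariation
variable {n m : ℕ}
  {M : Type*} [TopologicalSpace M] [ChartedSpace (EuclideanSpace ℝ (Fin n)) M]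
  [IsManifold (𝓡 n) ∞ M]
  {S : Type*} [TopologicalSpace S] [ChartedSpace (EuclideanSpace ℝ (Fin m)) S]
  [IsManifold (𝓡 m) ∞ S]
  {e : OpenPartialHomeomorph M (EuclideanSpace ℝ (Fin n))}
  {e' : OpenPartialHomeomorph S (EuclideanSpace ℝ (Fin m))}
  {ηM : (p : M) → TangentSpace (𝓡 n) p [⋀^Fin n]→L[ℝ] ℝ} {L : J1 n m M S → ℝ}
  {f : ℝ × M → S} {g : ℝ × (ℝ × M) → S}

/-- The variation field `∂/∂ε` of a one-parameter family of fields; its value at `x` is a tangent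
vector of `S` at `g (ε, x)`. -/
def variationField (g : ℝ × (ℝ × M) → S) (ε : ℝ) (x : ℝ × M) : ES m :=
  mfderiv 𝓘(ℝ, ℝ) (𝓡 m) (fun ε' => g (ε', x)) ε (1 : ℝ)

/-- The differential of a real function on `X`. -/
def differentialX (χ : ℝ × M → ℝ) (x : ℝ × M) : EX n →L[ℝ] ℝ := mfderiv (IX n) 𝓘(ℝ, ℝ) χ x

theorem variationInCharts_eq (he' : IsSmoothChart (𝓡 m) e')
    {ε : ℝ} {x : ℝ × M} (h1 : x.2 ∈ e.source)
    (hg : MDifferentiableAt 𝓘(ℝ, ℝ) (𝓡 m) (fun ε' => g (ε', x)) ε) (h2 : g (ε, x) ∈ e'.source) :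
    variationInCharts g e e' ε (xChart e x) =
      (mfderiv (𝓡 m) (𝓡 m) e' (g (ε, x)) (variationField g ε x) : ES m) := by
  have hfun : (fun ε' => familyInCharts g e e' (ε', xChart e x)) = fun ε' => e' (g (ε', x)) :=
    funext fun ε' => fieldInCharts_xChart (f := fun x => g (ε', x)) h1
  have h3 := (HasMFDerivAt.comp ε (g := e') (f := fun ε' => g (ε', x))
    (he'.mdifferentiableAt h2).hasMFDerivAt hg.hasMFDerivAt)
  let T : ℝ →L[ℝ] ES m := mfderiv 𝓘(ℝ, ℝ) (𝓡 m) (fun ε' => g (ε', x)) ε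
  let T' : ES m →L[ℝ] ES m := mfderiv (𝓡 m) (𝓡 m) e' (g (ε, x))
  have h4 : HasFDerivAt (fun ε' => e' (g (ε', x))) (T' ∘L T) ε :=
    hasMFDerivAt_iff_hasFDerivAt.1 h3
  rw [variationInCharts, hfun]
  exact h4.hasDerivAt.deriv

theorem mdifferentiableAt_family {ε : ℝ} {x : ℝ × M}
    (hg : ContMDiffAt (𝓘(ℝ, ℝ).prod (IX n)) (𝓡 m) ∞ g (ε, x)) :
    MDifferentiableAt 𝓘(ℝ, ℝ) (𝓡 m) (fun ε' => g (ε', x)) ε :=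
  (ContMDiffAt.comp (I' := 𝓘(ℝ, ℝ).prod (IX n)) ε (g := g) (f := fun ε' => (ε', x)) hg
    (contMDiffAt_id.prodMk contMDiffAt_const)).mdifferentiableAt (by simp)

theorem contDiffAt_variationInCharts (he : IsSmoothChart (𝓡 n) e) (he' : IsSmoothChart (𝓡 m) e')
    {ε : ℝ} {z : EX n} (hz : z ∈ (xChart e).target)
    (hg : ContMDiffAt (𝓘(ℝ, ℝ).prod (IX n)) (𝓡 m) ∞ g (ε, (xChart e).symm z))
    (h2 : g (ε, (xChart e).symm z) ∈ e'.source) :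
    ContDiffAt ℝ ∞ (variationInCharts g e e' ε) z :=
  ContDiffAt.comp (𝕜 := ℝ) z (f := fun z : EX n => (ε, z))
    (contDiffAt_deriv_slice (contDiffAt_familyInCharts he he' hz hg h2))
    (contDiffAt_const.prodMk contDiffAt_id)

/-- The derivative of a finite sum of functions. The derivative is an argument `T` so that its
type may be that of linear forms on the model space. -/
theorem hasMFDerivAt_sum {ι : Type*} {χ : ι → ℝ × M → ℝ} {χ' : ι → EX n →L[ℝ] ℝ} {x : ℝ × M}
    (s : Finset ι) (h : ∀ i, HasMFDerivAt (IX n) 𝓘(ℝ, ℝ) (χ i) x (χ' i)) :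
    ∀ T : EX n →L[ℝ] ℝ, T = ∑ i ∈ s, χ' i →
      HasMFDerivAt (IX n) 𝓘(ℝ, ℝ) (fun y => ∑ i ∈ s, χ i y) x T := by
  classical
  induction s using Finset.induction_on with
  | empty =>
    rintro T rfl
    exact hasMFDerivAt_const (I := IX n) (I' := 𝓘(ℝ, ℝ)) (0 : ℝ) x
  | insert i s hi ih =>
    rintro T rfl
    have e1 : (fun y => ∑ j ∈ insert i s, χ j y) = fun y => χ i y + ∑ j ∈ s, χ j y :=
      funext fun y => Finset.sum_insert hi
    rw [e1, Finset.sum_insert hi]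
    exact (h i).add (ih _ rfl)

/-- The variation density of a multiple `χ v` of a variation; the derivative of `χ` enters through
the fibre derivative of `L`. -/
theorem varDensity_smul (hL : ContMDiff (IJ n m) 𝓘(ℝ, ℝ) ∞ L)
    (he : IsSmoothChart (𝓡 n) e) (he' : IsSmoothChart (𝓡 m) e') {x : ℝ × M}
    (h1 : x.2 ∈ e.source) (hf : ContMDiffAt (IX n) (𝓡 m) ∞ f x) (h2 : f x ∈ e'.source)
    {χ : ℝ × M → ℝ} (hχ : ContMDiffAt (IX n) 𝓘(ℝ, ℝ) ∞ χ x) {v : EX n → ES m}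
    (hv : ContDiffAt ℝ ∞ v (xChart e x)) {u : ES m}
    (hu : v (xChart e x) = (mfderiv (𝓡 m) (𝓡 m) e' (f x) u : ES m)) :
    varDensity L f e e' (fun z => χ ((xChart e).symm z) • v z) (xChart e x) =
      χ x * varDensity L f e e' v (xChart e x) + fibreDeriv L (jet f x)
        ((differentialX χ x).smulRight u) := by
  have h1' : x ∈ (xChart e).source := mem_xChart_source.2 h1
  have hl : (xChart e).symm (xChart e x) = x := (xChart e).left_inv h1'
  have hx := isSmoothChart_xChart he
  set z := xChart e x with hz
  have hzt : z ∈ (xChart e).target := (xChart e).map_source h1'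
  set q := modelJet (fieldInCharts f e e') z with hq
  have hjet : jet f x = jetParam e e' q :=
    jet_eq_jetParam he he' (hf.mdifferentiableAt (by simp)) h1 h2
  have hφz : q.1.2 = e' (f x) := fieldInCharts_xChart h1
  let D : EX n →L[ℝ] EX n := mfderiv 𝓘(ℝ, EX n) (IX n) (xChart e).symm z
  set ξ : EX n →L[ℝ] ℝ := differentialX χ x
  have hχd : HasFDerivAt (fun z => χ ((xChart e).symm z)) (ξ ∘L D) z := by
    have h3 : HasMFDerivAt (IX n) 𝓘(ℝ, ℝ) χ ((xChart e).symm z) ξ := by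
      rw [hl]
      exact (hχ.mdifferentiableAt (by simp)).hasMFDerivAt
    exact hasMFDerivAt_iff_hasFDerivAt.1
      (h3.comp z (hx.mdifferentiableAt_symm hzt).hasMFDerivAt)
  have hvd := (hv.differentiableAt (by simp)).hasFDerivAt
  have hd : fderiv ℝ (fun z => χ ((xChart e).symm z) • v z) z =
      χ x • fderiv ℝ v z + (ξ ∘L D).smulRight (v z) := by
    have := (hχd.smul hvd).fderiv
    rwa [hl] at this
  have hfib := fibreDeriv_jetParam hL he he' (q := q) (mem_xChart_target.1 hzt)
    (by rw [hφz]; exact e'.map_source h2) ξ (v z)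
  have hc : (mfderiv (𝓡 m) (𝓡 m) e'.symm q.1.2 (v z) : ES m) = u := by
    rw [hφz, hu]
    exact he'.mfderiv_symm_comp h2 u
  rw [hc, ← hjet] at hfib
  simp only [varDensity, hd, hl, map_add, map_smul, smul_eq_mul, ← hq]
  have hfib' : fibreDeriv L (jet f x) (ξ.smulRight u) =
    partialA (lagr L e e') q ((ξ ∘L D).smulRight (v z)) := hfib
  rw [hfib']
  ring

/-- The derivative of the action along a family of fields vanishes if the variation field vanishes
on the frontier and is annihilated by the Euler–Lagrange covector. The first variation formula is
applied to the products of the variation field with the functions `χ i` of a partition of unity; the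
terms containing the differentials of the `χ i` add up to zero. -/
theorem integral_lagrangianVariation_eq_zero [T2Space M] [CompactSpace M]
    [SecondCountableTopology M] [MeasurableSpace M]
    [BorelSpace M] (hηM : IsSmoothForm (𝓡 n) ηM) (hηM0 : ∀ p, ηM p ≠ 0)
    (hL : ContMDiff (IJ n m) 𝓘(ℝ, ℝ) ∞ L)
    {U : Set (ℝ × M)} (hU : IsOpen U) (hUc : IsCompact (closure U))
    (hg : ∀ x ∈ closure U, ContMDiffAt (𝓘(ℝ, ℝ).prod (IX n)) (𝓡 m) ∞ g (0, x))
    (hg0 : ∀ x ∈ frontier U, variationField (m := m) g 0 x = 0)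
    (hEL : ∀ x ∈ U, ∀ (p : M) (s : S), x.2 ∈ (chartAt (EuclideanSpace ℝ (Fin n)) p).source →
      g (0, x) ∈ (chartAt (EuclideanSpace ℝ (Fin m)) s).source →
      elForm ηM L (fun x => g (0, x)) (chartAt (EuclideanSpace ℝ (Fin n)) p)
        (chartAt (EuclideanSpace ℝ (Fin m)) s) x
        (mfderiv (𝓡 m) (𝓡 m) (chartAt (EuclideanSpace ℝ (Fin m)) s) (g (0, x))
          (variationField (m := m) g 0 x) : ES m) = 0) :
    ∫ x in U, lagrangianVariation L g (0, x) ∂(volX ηM) = 0 := by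
  set f : ℝ × M → S := fun x => g (0, x) with hf
  have hfs : ∀ x ∈ closure U, ContMDiffAt (IX n) (𝓡 m) ∞ f x := fun x hx =>
    contMDiffAt_slice (hg x hx)
  let ec : ℝ × M → OpenPartialHomeomorph M (EuclideanSpace ℝ (Fin n)) :=
    fun x => chartAt (EuclideanSpace ℝ (Fin n)) x.2
  let ec' : ℝ × M → OpenPartialHomeomorph S (EuclideanSpace ℝ (Fin m)) :=
    fun x => chartAt (EuclideanSpace ℝ (Fin m)) (f x)
  have hec : ∀ x, IsSmoothChart (𝓡 n) (ec x) := fun x => isSmoothChart_chartAt _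
  have hec' : ∀ x, IsSmoothChart (𝓡 m) (ec' x) := fun x => isSmoothChart_chartAt _
  let O : ℝ × M → Set (ℝ × M) := fun x => (xChart (ec x)).source ∩ interior (f ⁻¹' (ec' x).source)
  have hO : ∀ x, IsOpen (O x) := fun x => (xChart (ec x)).open_source.inter isOpen_interior
  have hxO : ∀ x ∈ closure U, x ∈ O x := fun x hx =>
    ⟨mem_xChart_source.2 (mem_chart_source _ _), mem_interior_iff_mem_nhds.2
      ((hfs x hx).continuousAt.preimage_mem_nhds
        ((ec' x).open_source.mem_nhds (mem_chart_source _ _)))⟩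
  obtain ⟨t, ht⟩ := hUc.elim_nhds_subcover' (fun x _ => O x)
    fun x hx => (hO x).mem_nhds (hxO x hx)
  obtain ⟨χ, hχ⟩ := SmoothPartitionOfUnity.exists_isSubordinate (IX n) (isClosed_closure (s := U))
    (fun i : t => O i.1) (fun i => hO _) (fun x hx => by
      obtain ⟨i, hi, hx⟩ := mem_iUnion₂.1 (ht hx)
      exact mem_iUnion.2 ⟨⟨i, hi⟩, hx⟩)
  have hχs : ∀ i : t, ∀ x ∈ tsupport (χ i), x ∈ (xChart (ec i.1)).source ∧
      f x ∈ (ec' i.1).source := fun i x hx =>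
    ⟨(hχ i hx).1, interior_subset (s := f ⁻¹' _) (hχ i hx).2⟩
  let w : t → EX n → ES m := fun i => variationInCharts g (ec i.1) (ec' i.1) 0
  let v : t → EX n → ES m := fun i z => χ i ((xChart (ec i.1)).symm z) • w i z
  let K : t → Set (ℝ × M) := fun i => closure U ∩ tsupport (χ i)
  have hwc : ∀ (i : t), ∀ x ∈ closure U, x ∈ tsupport (χ i) →
      ContDiffAt ℝ ∞ (w i) (xChart (ec i.1) x) ∧ w i (xChart (ec i.1) x) =
        (mfderiv (𝓡 m) (𝓡 m) (ec' i.1) (f x) (variationField (m := m) g 0 x) : ES m) := by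
    intro i x hx hxt
    have hl : (xChart (ec i.1)).symm (xChart (ec i.1) x) = x :=
      (xChart (ec i.1)).left_inv (hχs i x hxt).1
    refine ⟨contDiffAt_variationInCharts (hec _) (hec' _)
      ((xChart (ec i.1)).map_source (hχs i x hxt).1) ?_ ?_, variationInCharts_eq (hec' _)
        (mem_xChart_source.1 (hχs i x hxt).1) (mdifferentiableAt_family (hg x hx)) (hχs i x hxt).2⟩
    · rw [hl]; exact hg x hx
    · rw [hl]; exact (hχs i x hxt).2
  have hχc : ∀ (i : t), ∀ x ∈ (xChart (ec i.1)).source,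
      ContDiffAt ℝ ∞ (fun z => χ i ((xChart (ec i.1)).symm z)) (xChart (ec i.1) x) := fun i x hx =>
    (ContMDiffAt.comp (I' := IX n) (xChart (ec i.1) x) (g := χ i) (f := (xChart (ec i.1)).symm)
      (χ i).contMDiff.contMDiffAt ((isSmoothChart_xChart (hec i.1)).contMDiffAt_symm
        ((xChart (ec i.1)).map_source hx))).contDiffAt
  have hvx : ∀ (i : t), ∀ x ∈ (xChart (ec i.1)).source, v i (xChart (ec i.1) x) =
      χ i x • w i (xChart (ec i.1) x) := fun i x hx => by
    simp only [v, (xChart (ec i.1)).left_inv hx]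
  have hloc := fun i : t => firstVariation_chart hηM hηM0 hL (hec i.1) (hec' i.1) (f := f) hU
    (K := K i) (hUc.inter_right (isClosed_tsupport _)) (fun x hx => (hχs i x hx.2).1)
    (fun x hx => hfs x hx.1) (fun x hx => (hχs i x hx.2.2).2) (v := v i)
    (fun x hx => contDiffAt_real_smul (hχc i x (hχs i x hx.2.2).1) (hwc i x hx.1 hx.2.2).1)
    (fun x hx hxs hxK => by
      have hxt : x ∉ tsupport (χ i) := fun h => hxK ⟨subset_closure hx, h⟩
      rw [hvx i x hxs, image_eq_zero_of_notMem_tsupport hxt, zero_smul])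
    (fun x hx => by
      let T : ES m →L[ℝ] ES m := mfderiv (𝓡 m) (𝓡 m) (ec' i.1) (f x)
      have hT : w i (xChart (ec i.1) x) = T (variationField (m := m) g 0 x) :=
        (hwc i x hx.2.1 hx.2.2).2
      rw [hvx i x (hχs i x hx.2.2).1, hT, hg0 x hx.1, map_zero, smul_zero])
  have hzero : ∀ i : t, ∫ x in U ∩ (xChart (ec i.1)).source,
      varDensity L f (ec i.1) (ec' i.1) (v i) (xChart (ec i.1) x) ∂(volX ηM) = 0 := fun i => by
    rw [(hloc i).2]
    refine setIntegral_eq_zero_of_forall_eq_zero fun x hx => ?_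
    rw [hvx i x hx.2]
    by_cases hxt : x ∈ tsupport (χ i)
    · have hxU := subset_closure hx.1
      rw [elForm_eq_elCovector hηM hL (hec _) (hec' _) (hfs x hxU) (mem_xChart_source.1 hx.2)
        (hχs i x hxt).2, map_smul, ← elForm_eq_elCovector hηM hL (hec _) (hec' _) (hfs x hxU)
        (mem_xChart_source.1 hx.2) (hχs i x hxt).2, (hwc i x hxU hxt).2]
      have := hEL x hx.1 i.1.1.2 (f i.1.1) (mem_xChart_source.1 hx.2) (hχs i x hxt).2
      exact (congrArg (χ i x • ·) this).trans (smul_zero _)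
    · rw [image_eq_zero_of_notMem_tsupport hxt, zero_smul, elForm_zero]
  -- the first variation of the family is the sum of those of the pieces
  let D : t → ℝ × M → ℝ := fun i => (xChart (ec i.1)).source.indicator
    fun x => varDensity L f (ec i.1) (ec' i.1) (v i) (xChart (ec i.1) x)
  have hD : ∀ i, ∀ x ∈ U, D i x = χ i x * lagrangianVariation L g (0, x) + fibreDeriv L (jet f x)
        ((differentialX (n := n) (χ i) x).smulRight (variationField (m := m) g 0 x)) := by
    intro i x hx
    have hxU := subset_closure hx
    by_cases hxt : x ∈ tsupport (χ i)
    · have hs := (hχs i x hxt).1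
      simp only [D, indicator_of_mem hs]
      rw [varDensity_smul hL (hec _) (hec' _) (mem_xChart_source.1 hs) (hfs x hxU) (hχs i x hxt).2
        (χ i).contMDiff.contMDiffAt (hwc i x hxU hxt).1 (hwc i x hxU hxt).2]
      rw [show lagrangianVariation L g (0, x) = _ from (hasDerivAt_lagrangian_family hL
        (hec i.1) (hec' i.1) (mem_xChart_source.1 hs) (hg x hxU) (hχs i x hxt).2).deriv]
    · have h0 : (χ i : ℝ × M → ℝ) =ᶠ[𝓝 x] fun _ => 0 :=
        notMem_tsupport_iff_eventuallyEq.1 hxt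
      have h1 : (differentialX (n := n) (χ i) x) = 0 := by
        rw [differentialX, h0.mfderiv_eq]; exact mfderiv_const
      have h2 : (0 : EX n →L[ℝ] ℝ).smulRight (variationField (m := m) g 0 x) = 0 :=
        ContinuousLinearMap.ext fun u => zero_smul ℝ _
      rw [h1, h2, map_zero, image_eq_zero_of_notMem_tsupport hxt, zero_mul, add_zero]
      by_cases hs : x ∈ (xChart (ec i.1)).source
      · simp only [D, indicator_of_mem hs]
        have h3 : v i =ᶠ[𝓝 (xChart (ec i.1) x)] fun _ => 0 := by
          have hc : ContinuousAt (xChart (ec i.1)).symm (xChart (ec i.1) x) :=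
            (xChart (ec i.1)).continuousAt_symm ((xChart (ec i.1)).map_source hs)
          rw [ContinuousAt, (xChart (ec i.1)).left_inv hs] at hc
          filter_upwards [hc.eventually h0] with z hz
          simp only [v]
          rw [hz, zero_smul]
        rw [varDensity, h3.fderiv_eq, h3.self_of_nhds]
        simp
      · simp only [D, indicator_of_notMem hs]
  have hsum : ∀ x ∈ U, lagrangianVariation L g (0, x) = ∑ i, D i x := by
    intro x hx
    have h1 : ∑ i, χ i x = 1 := by
      rw [← finsum_eq_sum_of_fintype]
      exact χ.sum_eq_one (subset_closure hx)
    have h2 : ∑ i, (differentialX (n := n) (χ i) x) = 0 := by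
      have h3 : (fun y => ∑ i, χ i y) =ᶠ[𝓝 x] fun _ => 1 := by
        filter_upwards [hU.mem_nhds hx] with y hy
        rw [← finsum_eq_sum_of_fintype]
        exact χ.sum_eq_one (subset_closure hy)
      have h4 : HasMFDerivAt (IX n) 𝓘(ℝ, ℝ) (fun y => ∑ i, χ i y) x
          (∑ i, (differentialX (n := n) (χ i) x)) := by
        refine hasMFDerivAt_sum Finset.univ (fun i => ?_) _ rfl
        exact ((χ i).contMDiff.contMDiffAt.mdifferentiableAt (by simp)).hasMFDerivAt
      have h5 : HasMFDerivAt (IX n) 𝓘(ℝ, ℝ) (fun y => ∑ i, χ i y) x (0 : EX n →L[ℝ] ℝ) :=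
        (hasMFDerivAt_const (1 : ℝ) x).congr_of_eventuallyEq h3
      exact hasMFDerivAt_unique h4 h5
    rw [Finset.sum_congr rfl fun i _ => hD i x hx, Finset.sum_add_distrib, ← Finset.sum_mul, h1,
      one_mul, ← map_sum]
    have h6 : ∑ i, (differentialX (n := n) (χ i) x).smulRight
        (variationField (m := m) g 0 x) = (∑ i, (differentialX (n := n) (χ i) x)).smulRight
          (variationField (m := m) g 0 x) := by
      refine ContinuousLinearMap.ext fun u => ?_
      simp [sum_apply, Finset.sum_smul]
    rw [h6, h2]
    have h7 : (0 : EX n →L[ℝ] ℝ).smulRight (variationField (m := m) g 0 x) = 0 :=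
      ContinuousLinearMap.ext fun u => zero_smul ℝ _
    rw [h7, map_zero, add_zero]
  have hsm : ∀ i : t, MeasurableSet (xChart (ec i.1)).source := fun i =>
    (xChart (ec i.1)).open_source.measurableSet
  rw [setIntegral_congr_fun hU.measurableSet hsum, integral_finsetSum]
  · refine Finset.sum_eq_zero fun i _ => ?_
    simp only [D]
    rw [setIntegral_indicator (hsm i), hzero i]
  · intro i _
    rw [integrable_indicator_iff (hsm i), IntegrableOn, Measure.restrict_restrict (hsm i),
      inter_comm]
    exact (hloc i).1

end GlobalFirstVariation

/-! ### Translations in a chart of `S` -/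

section TestFamilies
variable {n m : ℕ}
  {M : Type*} [TopologicalSpace M] [ChartedSpace (EuclideanSpace ℝ (Fin n)) M]
  [IsManifold (𝓡 n) ∞ M]
  {S : Type*} [TopologicalSpace S] [ChartedSpace (EuclideanSpace ℝ (Fin m)) S]
  [IsManifold (𝓡 m) ∞ S]
  {e : OpenPartialHomeomorph M (EuclideanSpace ℝ (Fin n))}
  {e' : OpenPartialHomeomorph S (EuclideanSpace ℝ (Fin m))}
  {ηM : (p : M) → TangentSpace (𝓡 n) p [⋀^Fin n]→L[ℝ] ℝ} {L : J1 n m M S → ℝ}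
  {f : ℝ × M → S} {g : ℝ × (ℝ × M) → S} {u : ℝ × M → ES m}

/-- The first variation formula for a family of fields which does not depend on the parameter
outside a compact set contained in `U` and in the domain of a chart. -/
theorem integral_lagrangianVariation_eq [T2Space M] [CompactSpace M]
    [SecondCountableTopology M] [MeasurableSpace M] [BorelSpace M]
    (hηM : IsSmoothForm (𝓡 n) ηM) (hηM0 : ∀ p, ηM p ≠ 0)
    (hL : ContMDiff (IJ n m) 𝓘(ℝ, ℝ) ∞ L) (he : IsSmoothChart (𝓡 n) e)
    (he' : IsSmoothChart (𝓡 m) e') {U K : Set (ℝ × M)} (hU : IsOpen U) (hK : IsCompact K)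
    (hKU : K ⊆ U) (hKe : K ⊆ (xChart e).source)
    (hg : ∀ x ∈ K, ContMDiffAt (𝓘(ℝ, ℝ).prod (IX n)) (𝓡 m) ∞ g (0, x))
    (hgK : ∀ x ∈ K, g (0, x) ∈ e'.source) (hgn : ∀ x ∉ K, ∀ ε, g (ε, x) = g (0, x)) :
    ∫ x in U, lagrangianVariation L g (0, x) ∂(volX ηM) =
      ∫ x in U ∩ (xChart e).source, elForm ηM L (fun x => g (0, x)) e e' x
        (mfderiv (𝓡 m) (𝓡 m) e' (g (0, x)) (variationField (m := m) g 0 x) : ES m) ∂(volX ηM) := by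
  set f : ℝ × M → S := fun x => g (0, x) with hf
  set v := variationInCharts g e e' 0 with hv
  have hms : MeasurableSet (xChart e).source := (xChart e).open_source.measurableSet
  have hjet : ∀ x ∉ K, ∀ ε, (jet (fun x => g (ε, x)) x : J1 n m M S) = jet f x := by
    intro x hx ε
    have h : (fun x => g (ε, x)) =ᶠ[𝓝 x] f := by
      filter_upwards [hK.isClosed.isOpen_compl.mem_nhds hx] with y hy using hgn y hy ε
    have h1 : g (ε, x) = f x := h.self_of_nhds
    simp only [jet]
    rw [h.mfderiv_eq, h1]
  have hzero : ∀ x ∉ K, lagrangianVariation L g (0, x) = 0 := by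
    intro x hx
    simp only [lagrangianVariation, hjet x hx, deriv_const]
  have hv0 : ∀ z ∈ (xChart e).target, (xChart e).symm z ∉ K → v z = 0 := by
    intro z hz hzK
    have h : (fun ε' => familyInCharts g e e' (ε', z)) =
        fun _ => e' (f ((xChart e).symm z)) :=
      funext fun ε' => congrArg e' (hgn _ hzK ε')
    rw [hv, variationInCharts, h, deriv_const]
  have hl : ∀ x ∈ (xChart e).source, (xChart e).symm (xChart e x) = x :=
    fun x hx => (xChart e).left_inv hx
  have hfv := firstVariation_chart hηM hηM0 hL he he' (f := f) hU hK hKe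
    (fun x hx => contMDiffAt_slice (hg x hx.2)) (fun x hx => hgK x hx.2) (v := v)
    (fun x hx => contDiffAt_variationInCharts he he' ((xChart e).map_source (hKe hx.2))
      (by rw [hl x (hKe hx.2)]; exact hg x hx.2) (by rw [hl x (hKe hx.2)]; exact hgK x hx.2))
    (fun x _ hxs hxK => hv0 _ ((xChart e).map_source hxs) (by rwa [hl x hxs]))
    (fun x hx => absurd (hU.inter_frontier_eq.le ⟨hKU hx.2, hx.1⟩) (notMem_empty x))
  have h1 : ∫ x in U, lagrangianVariation L g (0, x) ∂(volX ηM) =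
      ∫ x in U ∩ (xChart e).source, lagrangianVariation L g (0, x) ∂(volX ηM) :=
    setIntegral_eq_of_subset_of_forall_sdiff_eq_zero hU.measurableSet inter_subset_left
      fun x hx => hzero x fun h => hx.2 ⟨hx.1, hKe h⟩
  rw [h1]
  refine (setIntegral_congr_fun (hU.measurableSet.inter hms) fun x hx => ?_).trans
    (hfv.2.trans (setIntegral_congr_fun (hU.measurableSet.inter hms) fun x hx => ?_))
  · by_cases hxK : x ∈ K
    · exact (hasDerivAt_lagrangian_family hL he he' (mem_xChart_source.1 hx.2) (hg x hxK)
        (hgK x hxK)).deriv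
    · have h3 : v =ᶠ[𝓝 (xChart e x)] fun _ => 0 := by
        have hc : ContinuousAt (xChart e).symm (xChart e x) :=
          (xChart e).continuousAt_symm ((xChart e).map_source hx.2)
        rw [ContinuousAt, hl x hx.2] at hc
        filter_upwards [hc.eventually (hK.isClosed.isOpen_compl.mem_nhds hxK),
          (xChart e).open_target.mem_nhds ((xChart e).map_source hx.2)] with z hz hzt
        exact hv0 z hzt hz
      change lagrangianVariation L g (0, x) = _
      rw [hzero x hxK, varDensity, h3.fderiv_eq, h3.self_of_nhds]
      simp
  · by_cases hxK : x ∈ K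
    · exact congrArg (elForm ηM L f e e' x) (variationInCharts_eq he' (mem_xChart_source.1 hx.2)
        (mdifferentiableAt_family (hg x hxK)) (hgK x hxK))
    · have h4 : variationField (m := m) g 0 x = 0 := by
        have h5 : (fun ε' => g (ε', x)) = fun _ => g (0, x) := funext (hgn x hxK)
        rw [variationField, h5]
        exact congrArg (fun T : ℝ →L[ℝ] ES m => T 1) mfderiv_const
      let T : ES m →L[ℝ] ES m := mfderiv (𝓡 m) (𝓡 m) e' (g (0, x))
      have h6 : v (xChart e x) = T (variationField (m := m) g 0 x) := by
        rw [h4, map_zero]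
        exact hv0 _ ((xChart e).map_source hx.2) (by rwa [hl x hx.2])
      exact congrArg (elForm ηM L f e e' x) h6

/-- The fundamental lemma of the calculus of variations: if a continuous function does not vanish at
`x₀`, its integral against bump functions at `x₀` with sufficiently small support is nonzero. -/
theorem exists_nhds_setIntegral_bump_mul_ne_zero [T2Space M] [CompactSpace M]
    [SecondCountableTopology M] [MeasurableSpace M] [BorelSpace M]
    (hηM : IsSmoothForm (𝓡 n) ηM) (hηM0 : ∀ p, ηM p ≠ 0) (he : IsSmoothChart (𝓡 n) e)
    {U : Set (ℝ × M)} (hU : IsOpen U) (hUe : U ⊆ (xChart e).source) {x₀ : ℝ × M} (hx₀ : x₀ ∈ U)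
    {h : ℝ × M → ℝ} (hh : ContinuousOn h U) (h0 : h x₀ ≠ 0) :
    ∃ O ∈ 𝓝 x₀, O ⊆ U ∧ ∀ χ : SmoothBumpFunction (IX n) x₀, tsupport χ ⊆ O →
      ∫ x in U, χ x * h x ∂(volX ηM) ≠ 0 := by
  wlog hpos : 0 < h x₀ generalizing h
  · obtain ⟨O, hO, hOU, H⟩ := this (h := fun x => -h x) hh.neg (neg_ne_zero.2 h0)
      (neg_pos.2 (lt_of_le_of_ne (not_lt.1 hpos) h0))
    refine ⟨O, hO, hOU, fun χ hχ h1 => H χ hχ ?_⟩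
    simp only [mul_neg, integral_neg, h1, neg_zero]
  have hcat : ∀ x ∈ U, ContinuousAt h x := fun x hx => hh.continuousAt (hU.mem_nhds hx)
  refine ⟨U ∩ {x | 0 < h x}, Filter.inter_mem (hU.mem_nhds hx₀)
    ((hcat x₀ hx₀).eventually (lt_mem_nhds hpos)), inter_subset_left, fun χ hχ => ?_⟩
  have hχc : Continuous (χ : ℝ × M → ℝ) := χ.continuous
  have hU' : IsOpen ((xChart e).target ∩ (xChart e).symm ⁻¹' U) :=
    (xChart e).isOpen_inter_preimage_symm hU
  rw [setIntegral_volX hηM he hU.measurableSet hUe (g := fun x => χ x * h x)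
    ((hχc.continuousOn.mul hh).aestronglyMeasurable hU.measurableSet)]
  have hρ : ∀ z ∈ (xChart e).target, 0 < |density ηM e z.2| := fun z hz =>
    abs_pos.2 (density_ne_zero hηM0 he (mem_xChart_target.1 hz))
  refine ne_of_gt ((setIntegral_pos_iff_support_of_nonneg_ae ?_ ?_).2 ?_)
  · filter_upwards [ae_restrict_mem hU'.measurableSet] with z hz
    refine mul_nonneg (abs_nonneg _) ?_
    by_cases hz2 : (xChart e).symm z ∈ tsupport χ
    · exact mul_nonneg χ.nonneg (hχ hz2).2.le
    · rw [image_eq_zero_of_notMem_tsupport hz2, zero_mul]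
  · refine integrableOn_of_continuousAt_of_eq_zero hU'.measurableSet (K := xChart e '' tsupport χ)
      (χ.hasCompactSupport.isCompact.image_of_continuousOn ((xChart e).continuousOn.mono
        fun x hx => hUe (hχ hx).1)) ?_ ?_
    · rintro _ ⟨-, x, hx, rfl⟩
      have hxs := hUe (hχ hx).1
      have hc := (xChart e).continuousAt_symm ((xChart e).map_source hxs)
      have hl : (xChart e).symm (xChart e x) = x := (xChart e).left_inv hxs
      have h1 : ContinuousAt (fun x => χ x * h x) ((xChart e).symm (xChart e x)) := by
        rw [hl]
        exact hχc.continuousAt.mul (hcat x (hχ hx).1)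
      have h2 : ContinuousAt (fun z : EX n => density ηM e z.2) (xChart e x) :=
        ContinuousAt.comp (f := fun z : EX n => z.2) (contDiffAt_density hηM he
          (mem_xChart_target.1 ((xChart e).map_source hxs))).continuousAt continuousAt_snd
      exact h2.abs.mul (ContinuousAt.comp (f := (xChart e).symm) h1 hc)
    · intro z hz hzK
      have : (xChart e).symm z ∉ tsupport χ := fun h1 =>
        hzK ⟨_, h1, (xChart e).right_inv hz.1⟩
      rw [image_eq_zero_of_notMem_tsupport this, zero_mul, mul_zero]
  · have ho : IsOpen ((xChart e).target ∩ (xChart e).symm ⁻¹' (Function.support χ)) :=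
      (xChart e).isOpen_inter_preimage_symm χ.isOpen_support
    have hxs := hUe hx₀
    refine (ho.measure_pos volume ⟨xChart e x₀, (xChart e).map_source hxs, ?_⟩).trans_le
      (measure_mono ?_)
    · rw [mem_preimage, (xChart e).left_inv hxs]
      exact χ.c_mem_support
    · rintro z ⟨hz1, hz2⟩
      have hz3 := hχ (subset_tsupport _ hz2)
      exact ⟨mul_ne_zero (hρ z hz1).ne' (mul_ne_zero hz2 hz3.2.ne'), hz1, hz3.1⟩

/-- The family of maps of `S` over `X` which, in the coordinates of `e'`, translates by `ε u`. Over
the zeros of `u` it is the identity on all of `S`; elsewhere it is meaningful only on the domain of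
`e'`, and as long as the translated point stays in the target. -/
def shift (e' : OpenPartialHomeomorph S (EuclideanSpace ℝ (Fin m))) (u : ℝ × M → ES m)
    (ε : ℝ) (x : ℝ × M) (s : S) : S :=
  open Classical in if u x = 0 then s else e'.symm (e' s + ε • u x)

theorem shift_of_eq_zero {ε : ℝ} {x : ℝ × M} {s : S} (h : u x = 0) : shift e' u ε x s = s := by
  rw [shift, if_pos h]

theorem shift_of_mem_source {ε : ℝ} {x : ℝ × M} {s : S} (h : s ∈ e'.source) :
    shift e' u ε x s = e'.symm (e' s + ε • u x) := by
  by_cases hu : u x = 0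
  · rw [shift, if_pos hu, hu, smul_zero, add_zero, e'.left_inv h]
  · rw [shift, if_neg hu]

theorem shift_zero {x : ℝ × M} {s : S} (h : u x ≠ 0 → s ∈ e'.source) :
    shift e' u 0 x s = s := by
  by_cases hu : u x = 0
  · exact shift_of_eq_zero hu
  · rw [shift_of_mem_source (h hu), zero_smul, add_zero, e'.left_inv (h hu)]

theorem contMDiffAt_shift (he' : IsSmoothChart (𝓡 m) e') {ε : ℝ} {x : ℝ × M} {s : S}
    (hu : ContMDiffAt (IX n) 𝓘(ℝ, ES m) ∞ u x) (hs : s ∈ e'.source)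
    (ht : e' s + ε • u x ∈ e'.target) :
    ContMDiffAt (𝓘(ℝ, ℝ).prod (IY n m)) (𝓡 m) ∞
      (fun q : ℝ × ((ℝ × M) × S) => shift e' u q.1 q.2.1 q.2.2) (ε, (x, s)) := by
  have h1 : ContMDiffAt (𝓘(ℝ, ℝ).prod (IY n m)) 𝓘(ℝ, ES m) ∞
      (fun q : ℝ × ((ℝ × M) × S) => e' q.2.2) (ε, (x, s)) :=
    ContMDiffAt.comp (I' := 𝓡 m) (ε, (x, s)) (g := e') (f := fun q : ℝ × ((ℝ × M) × S) => q.2.2)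
      (he'.contMDiffAt hs) (contMDiffAt_snd.comp (ε, (x, s)) contMDiffAt_snd)
  have h2 : ContMDiffAt (𝓘(ℝ, ℝ).prod (IY n m)) 𝓘(ℝ, ES m) ∞
      (fun q : ℝ × ((ℝ × M) × S) => u q.2.1) (ε, (x, s)) :=
    ContMDiffAt.comp (I' := IX n) (ε, (x, s)) (g := u) (f := fun q : ℝ × ((ℝ × M) × S) => q.2.1)
      hu (contMDiffAt_fst.comp (ε, (x, s)) contMDiffAt_snd)
  have h3 : ContMDiffAt (𝓘(ℝ, ℝ).prod (IY n m)) 𝓘(ℝ, ℝ) ∞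
      (fun q : ℝ × ((ℝ × M) × S) => q.1) (ε, (x, s)) := contMDiffAt_fst
  have h4 := ContMDiffAt.comp (I' := 𝓡 m) (ε, (x, s)) (g := e'.symm)
    (f := fun q : ℝ × ((ℝ × M) × S) => e' q.2.2 + q.1 • u q.2.1)
    (he'.contMDiffAt_symm ht) (h1.add (h3.smul h2))
  refine h4.congr_of_eventuallyEq ?_
  filter_upwards [(e'.open_source.preimage (continuous_snd.comp continuous_snd)).mem_nhds
    (x := ((ε, (x, s)) : ℝ × ((ℝ × M) × S))) hs] with q hq
  exact shift_of_mem_source hq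

theorem contMDiffAt_shift_field (he' : IsSmoothChart (𝓡 m) e') {ε : ℝ} {x : ℝ × M}
    (hu : ContMDiffAt (IX n) 𝓘(ℝ, ES m) ∞ u x) (hf : ContMDiffAt (IX n) (𝓡 m) ∞ f x)
    (hs : f x ∈ e'.source) (ht : e' (f x) + ε • u x ∈ e'.target) :
    ContMDiffAt (𝓘(ℝ, ℝ).prod (IX n)) (𝓡 m) ∞
      (fun q : ℝ × (ℝ × M) => shift e' u q.1 q.2 (f q.2)) (ε, x) := by
  have h1 : ContMDiffAt (𝓘(ℝ, ℝ).prod (IX n)) (𝓘(ℝ, ℝ).prod (IY n m)) ∞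
      (fun q : ℝ × (ℝ × M) => (q.1, (q.2, f q.2))) (ε, x) :=
    contMDiffAt_fst.prodMk (contMDiffAt_snd.prodMk (ContMDiffAt.comp (I' := IX n) (ε, x) (g := f)
      (f := fun q : ℝ × (ℝ × M) => q.2) hf contMDiffAt_snd))
  exact ContMDiffAt.comp (I' := 𝓘(ℝ, ℝ).prod (IY n m)) (ε, x)
    (g := fun q : ℝ × ((ℝ × M) × S) => shift e' u q.1 q.2.1 q.2.2)
    (contMDiffAt_shift he' hu hs ht) h1

/-- The velocity of the trajectories `ε ↦ shift e' u ε x s`. -/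
theorem hasMFDerivAt_shift (he' : IsSmoothChart (𝓡 m) e') {ε : ℝ} {x : ℝ × M} {s : S}
    (hs : s ∈ e'.source) (ht : e' s + ε • u x ∈ e'.target) :
    HasMFDerivAt 𝓘(ℝ, ℝ) (𝓡 m) (fun ε => shift e' u ε x s) ε
      ((1 : ℝ →L[ℝ] ℝ).smulRight
        (mfderiv (𝓡 m) (𝓡 m) e'.symm (e' s + ε • u x) (u x) : ES m)) := by
  have h1 : HasFDerivAt (fun ε : ℝ => e' s + ε • u x) ((1 : ℝ →L[ℝ] ℝ).smulRight (u x)) ε :=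
    (((hasDerivAt_id ε).smul_const (u x)).const_add (e' s)).hasFDerivAt.congr_fderiv
      (by ext; simp)
  let T : ES m →L[ℝ] ES m := mfderiv (𝓡 m) (𝓡 m) e'.symm (e' s + ε • u x)
  have h2 := HasMFDerivAt.comp ε (g := e'.symm) (f := fun ε : ℝ => e' s + ε • u x)
    (he'.mdifferentiableAt_symm ht).hasMFDerivAt h1.hasMFDerivAt
  have h3 : (1 : ℝ →L[ℝ] ℝ).smulRight (T (u x)) = T ∘L (1 : ℝ →L[ℝ] ℝ).smulRight (u x) := by
    ext; simp
  have h4 : (fun ε => shift e' u ε x s) = e'.symm ∘ fun ε : ℝ => e' s + ε • u x :=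
    funext fun ε => shift_of_mem_source hs
  rw [h4]
  exact (congrArg (HasMFDerivAt 𝓘(ℝ, ℝ) (𝓡 m) (e'.symm ∘ fun ε : ℝ => e' s + ε • u x) ε) h3).mpr h2

theorem variationField_shift (he' : IsSmoothChart (𝓡 m) e') {x : ℝ × M} (hs : f x ∈ e'.source) :
    variationField (m := m) (fun q => shift e' u q.1 q.2 (f q.2)) 0 x =
      (mfderiv (𝓡 m) (𝓡 m) e'.symm (e' (f x)) (u x) : ES m) := by
  have h0 : e' (f x) + (0 : ℝ) • u x = e' (f x) := by rw [zero_smul, add_zero]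
  have h1 := (hasMFDerivAt_shift (u := u) (ε := 0) (x := x) he' hs
    (by rw [h0]; exact e'.map_source hs)).mfderiv
  rw [h0] at h1
  refine (congrArg (fun T : ℝ →L[ℝ] ES m => T 1) h1).trans ?_
  exact one_smul ℝ _

end TestFamilies

/-! ### Covariance of the Euler–Lagrange covector -/

section Covariance
variable {n m : ℕ}
  {M : Type*} [TopologicalSpace M] [ChartedSpace (EuclideanSpace ℝ (Fin n)) M]
  [IsManifold (𝓡 n) ∞ M]
  {S : Type*} [TopologicalSpace S] [ChartedSpace (EuclideanSpace ℝ (Fin m)) S]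
  [IsManifold (𝓡 m) ∞ S]
  {e e₁ : OpenPartialHomeomorph M (EuclideanSpace ℝ (Fin n))}
  {e' e₁' : OpenPartialHomeomorph S (EuclideanSpace ℝ (Fin m))}
  {ηM : (p : M) → TangentSpace (𝓡 n) p [⋀^Fin n]→L[ℝ] ℝ} {L : J1 n m M S → ℝ}
  {f : ℝ × M → S} {u : ℝ × M → ES m}

/-- The first variation formula for the translations, in the coordinates of `e₁'`, by a compactly
supported `u`; it may be evaluated in other coordinates `e'`. -/
theorem integral_lagrangianVariation_shift [T2Space M] [CompactSpace M]
    [SecondCountableTopology M] [MeasurableSpace M] [BorelSpace M]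
    (hηM : IsSmoothForm (𝓡 n) ηM) (hηM0 : ∀ p, ηM p ≠ 0)
    (hL : ContMDiff (IJ n m) 𝓘(ℝ, ℝ) ∞ L) (he : IsSmoothChart (𝓡 n) e)
    (he' : IsSmoothChart (𝓡 m) e') (he₁' : IsSmoothChart (𝓡 m) e₁') {U : Set (ℝ × M)}
    (hU : IsOpen U) (hu : HasCompactSupport u) (huU : tsupport u ⊆ U)
    (hue : tsupport u ⊆ (xChart e).source)
    (hus : ∀ x ∈ tsupport u, ContMDiffAt (IX n) 𝓘(ℝ, ES m) ∞ u x)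
    (hf : ∀ x ∈ tsupport u, ContMDiffAt (IX n) (𝓡 m) ∞ f x)
    (hfe : ∀ x ∈ tsupport u, f x ∈ e'.source) (hfe₁ : ∀ x ∈ tsupport u, f x ∈ e₁'.source) :
    ∫ x in U, lagrangianVariation L (fun q => shift e₁' u q.1 q.2 (f q.2)) (0, x) ∂(volX ηM) =
      ∫ x in U ∩ (xChart e).source, elForm ηM L f e e' x
        (mfderiv (𝓡 m) (𝓡 m) e' (f x)
          (mfderiv (𝓡 m) (𝓡 m) e₁'.symm (e₁' (f x)) (u x)) : ES m) ∂(volX ηM) := by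
  have h0 : ∀ x, shift e₁' u 0 x (f x) = f x := fun x =>
    shift_zero fun hx => hfe₁ x (subset_tsupport _ hx)
  have h := integral_lagrangianVariation_eq hηM hηM0 hL he he' hU (K := tsupport u)
    (g := fun q => shift e₁' u q.1 q.2 (f q.2)) hu huU hue
    (fun x hx => contMDiffAt_shift_field he₁' (hus x hx) (hf x hx) (hfe₁ x hx)
      (by rw [zero_smul, add_zero]; exact e₁'.map_source (hfe₁ x hx)))
    (fun x hx => by simp only [h0]; exact hfe x hx)
    (fun x hx ε => by
      simp only [shift_of_eq_zero (image_eq_zero_of_notMem_tsupport hx)])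
  simp only [h0] at h
  refine h.trans (setIntegral_congr_fun
    (hU.measurableSet.inter (xChart e).open_source.measurableSet) fun x hx => ?_)
  let T : ES m →L[ℝ] ES m := mfderiv (𝓡 m) (𝓡 m) e' (f x)
  let T' : ES m →L[ℝ] ES m := mfderiv (𝓡 m) (𝓡 m) e₁'.symm (e₁' (f x))
  have h1 : variationField (m := m) (fun q => shift e₁' u q.1 q.2 (f q.2)) 0 x = T' (u x) := by
    by_cases hxu : x ∈ tsupport u
    · exact variationField_shift he₁' (hfe₁ x hxu)
    · have h2 : u x = 0 := image_eq_zero_of_notMem_tsupport hxu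
      have h5 : (fun ε => shift e₁' u ε x (f x)) = fun _ => f x :=
        funext fun ε => shift_of_eq_zero h2
      rw [h2, map_zero]
      exact (congrArg (fun γ : ℝ → S => (mfderiv 𝓘(ℝ, ℝ) (𝓡 m) γ 0 : ℝ →L[ℝ] ES m) 1) h5).trans
        (congrArg (fun T : ℝ →L[ℝ] ES m => T 1) (mfderiv_const (c := f x)))
  let T₀ : S → ES m →L[ℝ] ES m := fun s => mfderiv (𝓡 m) (𝓡 m) e' s
  have h3 : T₀ (shift e₁' u 0 x (f x)) = T := congrArg T₀ (h0 x)
  exact (congrArg (fun A : ES m →L[ℝ] ES m => elForm ηM L f e e' x (A (variationField (m := m)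
    (fun q => shift e₁' u q.1 q.2 (f q.2)) 0 x))) h3).trans
      (congrArg (fun w => elForm ηM L f e e' x (T w)) h1)

theorem continuousAt_elForm (hηM : IsSmoothForm (𝓡 n) ηM) (hηM0 : ∀ p, ηM p ≠ 0)
    (hL : ContMDiff (IJ n m) 𝓘(ℝ, ℝ) ∞ L) (he : IsSmoothChart (𝓡 n) e)
    (he' : IsSmoothChart (𝓡 m) e') {x : ℝ × M} (hf : ∀ᶠ x in 𝓝 x, ContMDiffAt (IX n) (𝓡 m) ∞ f x)
    (h1 : x.2 ∈ e.source) (h2 : f x ∈ e'.source) {v : ℝ × M → ES m} (hv : ContinuousAt v x) :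
    ContinuousAt (fun x => elForm ηM L f e e' x (v x)) x := by
  have h1' : x ∈ (xChart e).source := mem_xChart_source.2 h1
  have hl : (xChart e).symm (xChart e x) = x := (xChart e).left_inv h1'
  have h3 : ContinuousAt (fun x => elCovector ηM L f e e' (xChart e x)) x :=
    ContinuousAt.comp (f := xChart e) (contDiffAt_elCovector hηM hηM0 hL he he'
      ((xChart e).map_source h1') (by rw [hl]; exact hf.self_of_nhds)
      (by rwa [hl])).continuousAt ((xChart e).continuousAt h1')
  refine (h3.clm_apply hv).congr ?_
  filter_upwards [hf, hf.self_of_nhds.continuousAt.preimage_mem_nhds (e'.open_source.mem_nhds h2),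
    (xChart e).open_source.mem_nhds h1'] with y a1 a2 a3
  exact (elForm_eq_elCovector hηM hL he he' a1 (mem_xChart_source.1 a3) a2 _).symm

theorem elForm_smul (hηM : IsSmoothForm (𝓡 n) ηM) (hL : ContMDiff (IJ n m) 𝓘(ℝ, ℝ) ∞ L)
    (he : IsSmoothChart (𝓡 n) e) (he' : IsSmoothChart (𝓡 m) e') {x : ℝ × M}
    (hf : ContMDiffAt (IX n) (𝓡 m) ∞ f x) (h1 : x.2 ∈ e.source) (h2 : f x ∈ e'.source)
    (c : ℝ) (w : ES m) : elForm ηM L f e e' x (c • w) = c * elForm ηM L f e e' x w := by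
  rw [elForm_eq_elCovector hηM hL he he' hf h1 h2, elForm_eq_elCovector hηM hL he he' hf h1 h2,
    map_smul, smul_eq_mul]

theorem integrableOn_of_hasCompactSupport_mul [T2Space M] [CompactSpace M]
    [SecondCountableTopology M] [MeasurableSpace M] [BorelSpace M]
    (hηM : IsSmoothForm (𝓡 n) ηM) {U : Set (ℝ × M)} (hU : IsOpen U) {χ h : ℝ × M → ℝ}
    (hχ : Continuous χ) (hχc : HasCompactSupport χ) (hχU : tsupport χ ⊆ U)
    (hh : ContinuousOn h U) : IntegrableOn (fun x => χ x * h x) U (volX ηM) := by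
  have := isFiniteMeasure_volMeasure hηM
  have h1 : IntegrableOn (fun x => χ x * h x) (tsupport χ) (volX ηM) :=
    (hχ.continuousOn.mul (hh.mono hχU)).integrableOn_compact hχc
  refine h1.of_forall_sdiff_eq_zero hU.measurableSet fun x hx => ?_
  rw [image_eq_zero_of_notMem_tsupport hx.2, zero_mul]

/-- The Euler–Lagrange covector does not depend on the coordinates. Both sides, integrated against
bump functions, give the first variation of the action along the same family of fields. -/
theorem elForm_coordChange [T2Space M] [CompactSpace M] [SecondCountableTopology M]
    (hηM : IsSmoothForm (𝓡 n) ηM) (hηM0 : ∀ p, ηM p ≠ 0)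
    (hL : ContMDiff (IJ n m) 𝓘(ℝ, ℝ) ∞ L) (he : IsSmoothChart (𝓡 n) e)
    (he' : IsSmoothChart (𝓡 m) e') (he₁ : IsSmoothChart (𝓡 n) e₁)
    (he₁' : IsSmoothChart (𝓡 m) e₁') {x₀ : ℝ × M}
    (hf : ∀ᶠ x in 𝓝 x₀, ContMDiffAt (IX n) (𝓡 m) ∞ f x) (h1 : x₀.2 ∈ e.source)
    (h2 : f x₀ ∈ e'.source) (h3 : x₀.2 ∈ e₁.source) (h4 : f x₀ ∈ e₁'.source) (w : ES m) :
    elForm ηM L f e₁ e₁' x₀ (mfderiv (𝓡 m) (𝓡 m) e₁' (f x₀)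
      (mfderiv (𝓡 m) (𝓡 m) e'.symm (e' (f x₀)) w) : ES m) = elForm ηM L f e e' x₀ w := by
  borelize M
  by_contra hne
  have hfc := hf.self_of_nhds.continuousAt
  have hev : ∀ᶠ x in 𝓝 x₀, (ContMDiffAt (IX n) (𝓡 m) ∞ f x ∧ f x ∈ e'.source ∧ f x ∈ e₁'.source) ∧
      x ∈ (xChart e).source ∧ x ∈ (xChart e₁).source :=
    (hf.and (Filter.Eventually.and (hfc.preimage_mem_nhds (e'.open_source.mem_nhds h2))
      (hfc.preimage_mem_nhds (e₁'.open_source.mem_nhds h4)))).and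
      (Filter.Eventually.and ((xChart e).open_source.mem_nhds (mem_xChart_source.2 h1))
      ((xChart e₁).open_source.mem_nhds (mem_xChart_source.2 h3)))
  obtain ⟨U, hUs, hU, hx₀⟩ := mem_nhds_iff.1 hev
  let D : ℝ × M → ES m := fun x => fderiv ℝ (e₁' ∘ e'.symm) (e' (f x)) w
  have hD : ∀ x ∈ U, D x = (mfderiv (𝓡 m) (𝓡 m) e₁' (f x)
      (mfderiv (𝓡 m) (𝓡 m) e'.symm (e' (f x)) w) : ES m) := by
    intro x hx
    have h5 : e'.symm (e' (f x)) = f x := e'.left_inv (hUs hx).1.2.1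
    have h6 := he'.fderiv_coordChange he₁' (e'.map_source (hUs hx).1.2.1)
      (by rw [h5]; exact (hUs hx).1.2.2) w
    rw [h5] at h6
    exact h6
  have hDc : ∀ x ∈ U, ContinuousAt D x := by
    intro x hx
    have h5 : e'.symm (e' (f x)) = f x := e'.left_inv (hUs hx).1.2.1
    have h6 := (((he'.contDiffAt_coordChange he₁' (e'.map_source (hUs hx).1.2.1)
      (by rw [h5]; exact (hUs hx).1.2.2)).fderiv_right (m := 0) (by simp)).clm_apply
        (contDiffAt_const (c := w))).continuousAt
    exact ContinuousAt.comp (f := fun x => e' (f x)) h6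
      ((e'.continuousAt (hUs hx).1.2.1).comp (hUs hx).1.1.continuousAt)
  have hfev : ∀ x ∈ U, ∀ᶠ x in 𝓝 x, ContMDiffAt (IX n) (𝓡 m) ∞ f x := fun x hx => by
    filter_upwards [hU.mem_nhds hx] with y hy using (hUs hy).1.1
  have hc : ContinuousOn (fun x => elForm ηM L f e e' x w) U := fun x hx =>
    (continuousAt_elForm hηM hηM0 hL he he' (hfev x hx) (mem_xChart_source.1 (hUs hx).2.1)
      (hUs hx).1.2.1 continuousAt_const).continuousWithinAt
  have hc₁ : ContinuousOn (fun x => elForm ηM L f e₁ e₁' x (D x)) U := fun x hx =>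
    (continuousAt_elForm hηM hηM0 hL he₁ he₁' (hfev x hx) (mem_xChart_source.1 (hUs hx).2.2)
      (hUs hx).1.2.2 (hDc x hx)).continuousWithinAt
  obtain ⟨O, hO, hOU, H⟩ := exists_nhds_setIntegral_bump_mul_ne_zero hηM hηM0 he hU
    (fun x hx => (hUs hx).2.1) hx₀ (hc₁.sub hc) (sub_ne_zero.2 (by
      simp only [hD x₀ hx₀]
      exact hne))
  obtain ⟨χ, hχ⟩ := (SmoothBumpFunction.nhds_basis_tsupport (I := IX n) x₀).mem_iff.1 hO
  have hχO : tsupport χ ⊆ O := hχ.2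
  have hχU := hχO.trans hOU
  refine H χ hχO ?_
  let u : ℝ × M → ES m := fun x => χ x • w
  have hut : tsupport u ⊆ tsupport χ := closure_mono fun x hx => left_ne_zero_of_smul hx
  have hsub : ∀ x ∈ tsupport u, x ∈ U := fun x hx => hχU (hut hx)
  have huc : HasCompactSupport u := χ.hasCompactSupport.smul_right
  have hus : ∀ x ∈ tsupport u, ContMDiffAt (IX n) 𝓘(ℝ, ES m) ∞ u x := fun x _ =>
    χ.contMDiff.contMDiffAt.smul contMDiffAt_const
  have hi := integral_lagrangianVariation_shift hηM hηM0 hL he he' he' hU huc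
    (fun x hx => hsub x hx) (fun x hx => (hUs (hsub x hx)).2.1) hus
    (fun x hx => (hUs (hsub x hx)).1.1) (fun x hx => (hUs (hsub x hx)).1.2.1)
    (fun x hx => (hUs (hsub x hx)).1.2.1)
  have hi₁ := integral_lagrangianVariation_shift hηM hηM0 hL he₁ he₁' he' hU huc
    (fun x hx => hsub x hx) (fun x hx => (hUs (hsub x hx)).2.2) hus
    (fun x hx => (hUs (hsub x hx)).1.1) (fun x hx => (hUs (hsub x hx)).1.2.2)
    (fun x hx => (hUs (hsub x hx)).1.2.1)
  rw [inter_eq_left.2 fun x hx => (hUs hx).2.1] at hi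
  rw [inter_eq_left.2 fun x hx => (hUs hx).2.2] at hi₁
  have e1 := hi.trans (setIntegral_congr_fun (g := fun x => χ x * elForm ηM L f e e' x w)
    hU.measurableSet fun x hx => by
      have h5 := he'.mfderiv_comp_symm (e'.map_source (hUs hx).1.2.1) (u x)
      rw [e'.left_inv (hUs hx).1.2.1] at h5
      refine (congrArg (elForm ηM L f e e' x) h5).trans ?_
      exact elForm_smul hηM hL he he' (hUs hx).1.1 (mem_xChart_source.1 (hUs hx).2.1)
        (hUs hx).1.2.1 _ _)
  have e2 := hi₁.trans (setIntegral_congr_fun (g := fun x => χ x * elForm ηM L f e₁ e₁' x (D x))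
    hU.measurableSet fun x hx => by
      let T : ES m →L[ℝ] ES m := mfderiv (𝓡 m) (𝓡 m) e₁' (f x)
      let T' : ES m →L[ℝ] ES m := mfderiv (𝓡 m) (𝓡 m) e'.symm (e' (f x))
      have h5 : T (T' (u x)) = χ x • D x := by
        rw [hD x hx, map_smul, map_smul]
        rfl
      refine (congrArg (elForm ηM L f e₁ e₁' x) h5).trans ?_
      exact elForm_smul hηM hL he₁ he₁' (hUs hx).1.1 (mem_xChart_source.1 (hUs hx).2.2)
        (hUs hx).1.2.2 _ _)
  have e3 := integral_sub
    (integrableOn_of_hasCompactSupport_mul hηM hU χ.continuous χ.hasCompactSupport hχU hc₁)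
    (integrableOn_of_hasCompactSupport_mul hηM hU χ.continuous χ.hasCompactSupport hχU hc)
  rw [← e1, ← e2, sub_self] at e3
  rw [← e3]
  exact integral_congr_ae (Filter.Eventually.of_forall fun x => mul_sub _ _ _)

end Covariance

/-! ### Smooth right inverses -/

section RightInverse
variable {E H X V : Type*} [NormedAddCommGroup E] [NormedSpace ℝ E] [TopologicalSpace H]
  {I : ModelWithCorners ℝ E H} [TopologicalSpace X] [ChartedSpace H X]
  [NormedAddCommGroup V] [NormedSpace ℝ V] [FiniteDimensional ℝ V] {k : ℕ}

/-- Linearly independent linear forms take arbitrary values simultaneously. -/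
theorem surjective_pi_of_linearIndependent {a : Fin k → V →L[ℝ] ℝ}
    (ha : LinearIndependent ℝ a) : Function.Surjective (ContinuousLinearMap.pi a) := by
  by_contra h
  have h1 : (ContinuousLinearMap.pi a : V →L[ℝ] Fin k → ℝ).range < ⊤ :=
    lt_top_iff_ne_top.2 fun h2 => h (LinearMap.range_eq_top.1 h2)
  obtain ⟨φ, hφ, hle⟩ := Submodule.exists_le_ker_of_lt_top _ h1
  refine hφ (LinearMap.pi_ext' fun i => LinearMap.ext_ring ?_)
  have h2 : ∑ i, φ (Pi.single i 1) • a i = 0 := by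
    ext v
    have h3 : φ (fun i => a i v) = 0 := hle ⟨v, rfl⟩
    rw [LinearMap.pi_apply_eq_sum_univ φ] at h3
    simp only [sum_apply, smul_apply, smul_eq_mul,
      zero_apply]
    rw [← h3]
    refine Finset.sum_congr rfl fun i _ => ?_
    rw [smul_eq_mul, mul_comm]
    congr 2
    ext j
    simp [Pi.single_apply, eq_comm]
  exact Fintype.linearIndependent_iff.1 ha _ h2 i

/-- Smooth covectors which are linearly independent at a point have, near it, a smooth right
inverse. -/
theorem exists_contMDiffAt_rightInverse {a : Fin k → X → V →L[ℝ] ℝ} {x₀ : X}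
    (hs : ∀ i, ∀ᶠ x in 𝓝 x₀, ContMDiffAt I 𝓘(ℝ, V →L[ℝ] ℝ) ∞ (a i) x)
    (ha : LinearIndependent ℝ fun i => a i x₀) :
    ∃ P : X → (Fin k → ℝ) →L[ℝ] V, ∀ᶠ x in 𝓝 x₀,
      ContMDiffAt I 𝓘(ℝ, (Fin k → ℝ) →L[ℝ] V) ∞ P x ∧ ∀ c i, a i x (P x c) = c i := by
  -- a right inverse `R` at `x₀` is corrected at `x` by the inverse of `B x = a x ∘ R`
  obtain ⟨R, hR⟩ := (ContinuousLinearMap.pi fun i => a i x₀).exists_rightInverse_of_surjective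
    (LinearMap.range_eq_top.2 (surjective_pi_of_linearIndependent ha))
  let Q : (Fin k → V →L[ℝ] ℝ) →L[ℝ] ((Fin k → ℝ) →L[ℝ] (Fin k → ℝ)) :=
    LinearMap.toContinuousLinearMap
      { toFun := fun b => ContinuousLinearMap.pi b ∘L R
        map_add' := fun b c => by ext; simp
        map_smul' := fun r b => by ext; simp }
  let B : X → (Fin k → ℝ) →L[ℝ] (Fin k → ℝ) := fun x => Q fun i => a i x
  have hB : ∀ᶠ x in 𝓝 x₀, ContMDiffAt I 𝓘(ℝ, (Fin k → ℝ) →L[ℝ] (Fin k → ℝ)) ∞ B x := by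
    filter_upwards [Filter.eventually_all.2 hs] with x hx
    exact ContMDiffAt.comp x (I' := 𝓘(ℝ, Fin k → V →L[ℝ] ℝ)) (g := Q) (f := fun x i => a i x)
      Q.contDiff.contMDiff.contMDiffAt (contMDiffAt_pi_space.2 hx)
  have hB1 : B x₀ = 1 := hR
  have hu : ∀ᶠ x in 𝓝 x₀, IsUnit (B x) :=
    hB.self_of_nhds.continuousAt.preimage_mem_nhds
      (Units.isOpen.mem_nhds (by rw [hB1]; exact isUnit_one))
  refine ⟨fun x => R ∘L Ring.inverse (B x), ?_⟩
  filter_upwards [hB, hu] with x h1 h2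
  constructor
  · obtain ⟨b, hb⟩ := h2
    have h3 : ContDiffAt ℝ ∞ (fun b => R ∘L Ring.inverse b) (B x) := by
      rw [← hb]
      exact contDiffAt_const.clm_comp (contDiffAt_ringInverse ℝ b)
    exact h3.contMDiffAt.comp x h1
  · intro c i
    have h3 : B x (Ring.inverse (B x) c) = c :=
      congrArg (fun T : (Fin k → ℝ) →L[ℝ] (Fin k → ℝ) => T c) (Ring.mul_inverse_cancel _ h2)
    exact congrFun h3 i

end RightInverse

/-! ### Test vector fields and their flows -/

section TestVectorFields
variable {n m : ℕ}
  {M : Type*} [TopologicalSpace M] [ChartedSpace (EuclideanSpace ℝ (Fin n)) M]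
  [IsManifold (𝓡 n) ∞ M]
  {S : Type*} [TopologicalSpace S] [ChartedSpace (EuclideanSpace ℝ (Fin m)) S]
  [IsManifold (𝓡 m) ∞ S]
  {f : ℝ × M → S} {u : ℝ × M → ES m}

/-- The tangent vector at `s` with given components in the preferred chart at `s₀`, as a linear
function of its components. It is meaningful only for `s` in the domain of that chart. -/
def vectorOfComponents (s₀ s : S) : ES m →L[ℝ] ES m :=
  mfderiv (𝓡 m) (𝓡 m) (chartAt (EuclideanSpace ℝ (Fin m)) s₀).symm
    (chartAt (EuclideanSpace ℝ (Fin m)) s₀ s)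

theorem trivializationAt_symmL_eq {s₀ s : S}
    (hs : s ∈ (chartAt (EuclideanSpace ℝ (Fin m)) s₀).source) :
    ((trivializationAt (ES m) (TangentSpace (𝓡 m) : S → Type) s₀).symmL ℝ s : ES m →L[ℝ] ES m) =
      vectorOfComponents s₀ s := by
  have := TangentBundle.symmL_trivializationAt (I := 𝓡 m) hs
  rw [ModelWithCorners.range_eq_univ, mfderivWithin_univ] at this
  exact this

/-- In the trivialization of `TS` at `s₀`, the vector with components `w` is given by `w`. -/
theorem trivializationAt_vectorOfComponents {s₀ s : S}
    (hs : s ∈ (chartAt (EuclideanSpace ℝ (Fin m)) s₀).source) (w : ES m) :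
    ((trivializationAt (ES m) (TangentSpace (𝓡 m) : S → Type) s₀)
      ⟨s, (vectorOfComponents s₀ s w : ES m)⟩).2 = w := by
  have hb : s ∈ (trivializationAt (ES m) (TangentSpace (𝓡 m) : S → Type) s₀).baseSet := hs
  have h1 := (trivializationAt (ES m) (TangentSpace (𝓡 m) : S → Type)
    s₀).continuousLinearMapAt_symmL (R := ℝ) hb w
  rw [Bundle.Trivialization.continuousLinearMapAt_apply,
    Bundle.Trivialization.coe_linearMapAt_of_mem _ hb] at h1
  rw [← trivializationAt_symmL_eq hs]
  exact h1

/-- The components of a smooth covector field along `j¹φ` are smooth. -/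
theorem contMDiffAt_covector_comp {W : Set (J1 n m M S)}
    {A : (γ : J1 n m M S) → (TangentSpace (𝓡 m) γ.proj.2 →L[ℝ] ℝ)}
    (hA : ContMDiffOn (IJ n m) ((𝓡 m).prod 𝓘(ℝ, ES m →L[ℝ] ℝ)) ∞
      (fun γ => (⟨γ.proj.2, A γ⟩ : TotalSpace (ES m →L[ℝ] ℝ)
        (fun s : S => TangentSpace (𝓡 m) s →L[ℝ] Trivial S ℝ s))) W)
    {O : Set (ℝ × M)} (hO : IsOpen O) (hf : ∀ x ∈ O, ContMDiffAt (IX n) (𝓡 m) ∞ f x)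
    (hW : ∀ x ∈ O, jet f x ∈ W) {s₀ : S}
    (hs : ∀ x ∈ O, f x ∈ (chartAt (EuclideanSpace ℝ (Fin m)) s₀).source) {x : ℝ × M}
    (hx : x ∈ O) :
    ContMDiffAt (IX n) 𝓘(ℝ, ES m →L[ℝ] ℝ) ∞
      (fun x => (A (jet f x) : ES m →L[ℝ] ℝ) ∘L vectorOfComponents s₀ (f x)) x := by
  have h1 : ContMDiffOn (IX n) (IJ n m) ∞ (jet f : ℝ × M → J1 n m M S) O :=
    fun y hy => (contMDiffAt_jet (hf y hy)).contMDiffWithinAt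
  have h2 := (hA.comp h1 hW).contMDiffAt (hO.mem_nhds hx)
  have h3 := ((Bundle.Trivialization.contMDiffAt_iff (e := trivializationAt (ES m →L[ℝ] ℝ)
    (fun s : S => TangentSpace (𝓡 m) s →L[ℝ] Trivial S ℝ s) s₀) (by
      rw [Bundle.Trivialization.mem_source]
      exact ⟨hs x hx, mem_univ _⟩)).1 h2).2
  refine h3.congr_of_eventuallyEq ?_
  filter_upwards [hO.mem_nhds hx] with y hy
  refine ContinuousLinearMap.ext fun w => ?_
  rw [← trivializationAt_symmL_eq (hs y hy)]
  have h4 : ∀ c : ℝ,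
      ((trivializationAt ℝ (Trivial S ℝ) s₀).continuousLinearMapAt ℝ (f y) c : ℝ) = c :=
    fun c => congrArg (fun T : ℝ →L[ℝ] ℝ => T c)
      (Bundle.Trivial.continuousLinearMapAt_trivialization ℝ S ℝ (f y))
  exact (h4 _).symm

set_option maxHeartbeats 1000000 in
/-- In the preferred charts the tangent map of `J¹π → S` is the projection on the components
`dy^a`. -/
theorem mfderiv_projS_apply (γ : J1 n m M S) (v : EJ n m) :
    (mfderiv (IJ n m) (𝓡 m) (fun γ' : J1 n m M S => γ'.proj.2) γ v : ES m) = v.1.2 := by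
  have hp : ContMDiff (IJ n m) (IY n m) ∞ (fun γ' : J1 n m M S => γ'.proj) :=
    contMDiff_proj (n := ∞) (IB := IY n m) (fun y => TXY n m M S y →L[ℝ] TSY n m M S y)
  have hd : MDifferentiableAt (IJ n m) (𝓡 m) (fun γ' : J1 n m M S => γ'.proj.2) γ :=
    (contMDiff_snd.comp hp).contMDiffAt.mdifferentiableAt (by simp)
  have h1 : writtenInExtChartAt (IJ n m) (𝓡 m) γ (fun γ' : J1 n m M S => γ'.proj.2)
      =ᶠ[𝓝 (extChartAt (IJ n m) γ γ)] projS (n := n) (m := m) := by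
    have hc : Filter.Tendsto (fun z => ((extChartAt (IJ n m) γ).symm z).proj)
        (𝓝 (extChartAt (IJ n m) γ γ)) (𝓝 γ.proj) := by
      have := hp.continuous.continuousAt.tendsto.comp (continuousAt_extChartAt_symm (I := IJ n m) γ)
      rwa [extChartAt_to_inv] at this
    filter_upwards [extChartAt_target_mem_nhds (I := IJ n m) γ,
      hc.eventually (((chartAt (EuclideanSpace ℝ (Fin n)) γ.proj.1.2).open_source.preimage
        (continuous_snd.comp continuous_fst)).mem_nhds (mem_chart_source _ γ.proj.1.2)),
      hc.eventually (((chartAt (EuclideanSpace ℝ (Fin m)) γ.proj.2).open_source.preimage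
        continuous_snd).mem_nhds (mem_chart_source _ γ.proj.2))] with z hz a1 a2
    have h2 := extChartAt_J1_apply γ ((extChartAt (IJ n m) γ).symm z) a1 a2
    rw [(extChartAt (IJ n m) γ).right_inv hz] at h2
    exact (congrArg (fun q : EJ n m => q.1.2) h2).symm
  have h3 := hd.mfderiv
  rw [ModelWithCorners.range_eq_univ, fderivWithin_univ, h1.fderiv_eq,
    ContinuousLinearMap.fderiv] at h3
  exact congrArg (fun T : EJ n m →L[ℝ] ES m => T v) h3

/-- As the forms in `F` are pulled back from `S`, the condition `j¹V ∈ F°` only concerns the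
values of the vertical field `V`. -/
theorem prolong_mem_annihilator_iff {k : ℕ} {C : Constraint n m M S k} (F : ReactionForces C)
    (V : (y : (ℝ × M) × S) → TangentSpace (IY n m) y) (γ : J1 n m M S) :
    prolong V γ ∈ F.annihilator γ ↔ ∀ α ∈ F.fibre γ, α ((V γ.proj : EX n × ES m).2 : ES m) = 0 := by
  refine forall₂_congr fun α _ => ?_
  exact Eq.congr_left (congrArg (fun w : ES m => (α w : ℝ))
    (mfderiv_projS_apply γ (prolong V γ)))

theorem IsVerticalOn.fst_eq_zero {V : (y : (ℝ × M) × S) → TangentSpace (IY n m) y}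
    {N : Set ((ℝ × M) × S)} (hV : IsVerticalOn V N) {y : (ℝ × M) × S} (hy : y ∈ N) :
    (V y : EX n × ES m).1 = 0 := by
  have h := hV.2 y hy
  have h1 := mfderiv_fst (I := IX n) (I' := 𝓡 m) (x := y)
  exact (congrArg (fun T : (EX n × ES m) →L[ℝ] EX n => T (V y)) h1).symm.trans h

/-- The vertical vector field with components `ψ(s) u(x)` in the preferred chart at `s₀`. The
function `ψ` is a cut-off supported in the domain of that chart; it makes the field vanish where
`vectorOfComponents` is meaningless, so that the field is smooth on all of `Y`. -/
def testField (s₀ : S) (ψ : S → ℝ) (u : ℝ × M → ES m) (y : (ℝ × M) × S) :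
    TangentSpace (IY n m) y :=
  ((0, vectorOfComponents s₀ y.2 (ψ y.2 • u y.1)) : EX n × ES m)

theorem isVerticalOn_testField [T2Space S] {s₀ : S} (ψ : SmoothBumpFunction (𝓡 m) s₀)
    (hu : ContMDiff (IX n) 𝓘(ℝ, ES m) ∞ u) : IsVerticalOn (testField (n := n) s₀ ψ u) (univ) := by
  constructor
  · rw [contMDiffOn_univ]
    have h1 : ContMDiff (IY n m) (𝓡 m).tangent ∞ (fun y : (ℝ × M) × S =>
        (⟨y.2, (vectorOfComponents s₀ y.2 (ψ y.2 • u y.1) : ES m)⟩ : TangentBundle (𝓡 m) S)) := by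
      intro y
      by_cases hy : y.2 ∈ tsupport ψ
      · have hys := ψ.tsupport_subset_chartAt_source hy
        rw [Bundle.Trivialization.contMDiffAt_iff (e := trivializationAt (ES m)
          (TangentSpace (𝓡 m) : S → Type) s₀) (by
            rw [Bundle.Trivialization.mem_source]; exact hys)]
        refine ⟨contMDiffAt_snd, ?_⟩
        have h2 : ContMDiffAt (IY n m) 𝓘(ℝ, ES m) ∞
            (fun y : (ℝ × M) × S => ψ y.2 • u y.1) y :=
          (ψ.contMDiff.comp contMDiff_snd).contMDiffAt.smul (hu.comp contMDiff_fst).contMDiffAt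
        refine h2.congr_of_eventuallyEq ?_
        filter_upwards [((chartAt (EuclideanSpace ℝ (Fin m)) s₀).open_source.preimage
          continuous_snd).mem_nhds hys] with y' hy'
        exact trivializationAt_vectorOfComponents hy' _
      · have h2 : ContMDiffAt (IY n m) (𝓡 m).tangent ∞
            (fun y : (ℝ × M) × S => zeroSection (ES m) (TangentSpace (𝓡 m) : S → Type) y.2) y :=
          ((Bundle.contMDiff_zeroSection ℝ (TangentSpace (𝓡 m) : S → Type)).comp
            contMDiff_snd).contMDiffAt
        refine h2.congr_of_eventuallyEq ?_
        filter_upwards [((isClosed_tsupport ψ).isOpen_compl.preimage continuous_snd).mem_nhds hy]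
          with y' hy'
        have h3 : ψ y'.2 = 0 := image_eq_zero_of_notMem_tsupport hy'
        rw [h3, zero_smul, map_zero]
        rfl
    have h0 : ContMDiff (IY n m) (IX n).tangent ∞ (fun y : (ℝ × M) × S =>
        zeroSection (EX n) (TangentSpace (IX n) : ℝ × M → Type) y.1) :=
      (Bundle.contMDiff_zeroSection ℝ (TangentSpace (IX n) : ℝ × M → Type)).comp contMDiff_fst
    exact (contMDiff_equivTangentBundleProd_symm (I := IX n) (I' := 𝓡 m) (M := ℝ × M)
      (M' := S)).comp (h0.prodMk h1)
  · intro y _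
    have h1 := mfderiv_fst (I := IX n) (I' := 𝓡 m) (x := y)
    exact congrArg (fun T : (EX n × ES m) →L[ℝ] EX n => T (testField (n := n) s₀ ψ u y)) h1

/-- A test field has a local one-parameter group, given by translations by `ε u` in the chart, on
the union of two open sets: the part of `Y` over the complement of the support of `u`, where the
field vanishes, and the points in the chart ball of radius `r`. The trajectories of the latter
stay in the ball of radius `2 r`, where the cut-off `ψ` is equal to one. -/
theorem exists_isLocalFlow_testField {s₀ : S} {ψ : S → ℝ} {r : ℝ} (hr : 0 < r)
    (hψ : ∀ y ∈ Metric.ball (chartAt (EuclideanSpace ℝ (Fin m)) s₀ s₀) (2 * r),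
      y ∈ (chartAt (EuclideanSpace ℝ (Fin m)) s₀).target ∧
      ψ ((chartAt (EuclideanSpace ℝ (Fin m)) s₀).symm y) = 1)
    (hu : ContMDiff (IX n) 𝓘(ℝ, ES m) ∞ u) (huc : HasCompactSupport u) :
    ∃ δ, IsLocalFlow (testField (n := n) s₀ ψ u) univ δ
      ({y | y.1 ∉ tsupport u} ∪ {y | y.2 ∈ (chartAt (EuclideanSpace ℝ (Fin m)) s₀).source ∧
        chartAt (EuclideanSpace ℝ (Fin m)) s₀ y.2 ∈
          Metric.ball (chartAt (EuclideanSpace ℝ (Fin m)) s₀ s₀) r})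
      (fun ε y => (y.1, shift (chartAt (EuclideanSpace ℝ (Fin m)) s₀) u ε y.1 y.2)) := by
  set e' := chartAt (EuclideanSpace ℝ (Fin m)) s₀ with he'def
  have he' : IsSmoothChart (𝓡 m) e' := isSmoothChart_chartAt _
  obtain ⟨c, hc⟩ := hu.continuous.bounded_above_of_compact_support huc
  have hc0 : 0 ≤ max c 0 := le_max_right _ _
  have hδ : 0 < r / (max c 0 + 1) := by positivity
  -- for `|ε| < r / (c + 1)`, where `c` bounds `u`, points move by at most `r` in the chart
  have hball : ∀ ε ∈ Ioo (-(r / (max c 0 + 1))) (r / (max c 0 + 1)), ∀ x : ℝ × M, ∀ y ∈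
      Metric.ball (e' s₀) r, y + ε • u x ∈ Metric.ball (e' s₀) (2 * r) := by
    intro ε hε x y hy
    have h1 : ‖ε • u x‖ ≤ r := by
      rw [norm_smul, Real.norm_eq_abs]
      have h2 : |ε| ≤ r / (max c 0 + 1) := (abs_lt.2 hε).le
      have h3 : ‖u x‖ ≤ max c 0 + 1 := ((hc x).trans (le_max_left _ _)).trans (by linarith)
      calc |ε| * ‖u x‖ ≤ r / (max c 0 + 1) * (max c 0 + 1) := by gcongr
        _ = r := div_mul_cancel₀ _ (by positivity)
    rw [mem_ball_iff_norm] at hy ⊢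
    calc ‖y + ε • u x - e' s₀‖ = ‖(y - e' s₀) + ε • u x‖ := by congr 1; abel
      _ ≤ ‖y - e' s₀‖ + ‖ε • u x‖ := norm_add_le _ _
      _ < 2 * r := by linarith
  refine ⟨r / (max c 0 + 1), hδ, ?_, ?_, ?_⟩
  · exact ((isClosed_tsupport u).isOpen_compl.preimage continuous_fst).union
      ((e'.isOpen_inter_preimage Metric.isOpen_ball).preimage continuous_snd)
  · rintro ⟨ε, y⟩ ⟨hε, hy⟩
    refine ContMDiffAt.contMDiffWithinAt ?_
    refine (contMDiffAt_fst.comp (ε, y) contMDiffAt_snd).prodMk ?_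
    rcases hy with hy | ⟨hy1, hy2⟩
    · have h2 : ContMDiffAt (𝓘(ℝ, ℝ).prod (IY n m)) (𝓡 m) ∞
          (fun q : ℝ × ((ℝ × M) × S) => q.2.2) (ε, y) :=
        contMDiffAt_snd.comp (ε, y) contMDiffAt_snd
      refine h2.congr_of_eventuallyEq ?_
      filter_upwards [((isClosed_tsupport u).isOpen_compl.preimage
        (continuous_fst.comp continuous_snd)).mem_nhds
          (x := ((ε, y) : ℝ × ((ℝ × M) × S))) hy] with q hq
      exact shift_of_eq_zero (image_eq_zero_of_notMem_tsupport hq)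
    · exact contMDiffAt_shift he' hu.contMDiffAt hy1 (hψ _ (hball ε hε y.1 _ hy2)).1
  · rintro ⟨x, s⟩ hy
    have h0 : shift e' u 0 x s = s := by
      refine shift_zero fun hux => ?_
      rcases hy with hy | hy
      · exact absurd (image_eq_zero_of_notMem_tsupport hy) hux
      · exact hy.1
    refine ⟨Prod.ext rfl h0, fun _ _ => mem_univ _, fun ε hε => ?_⟩
    refine HasMFDerivAt.hasMFDerivWithinAt ?_
    have key : HasMFDerivAt 𝓘(ℝ, ℝ) (𝓡 m) (fun ε => shift e' u ε x s) ε
        ((1 : ℝ →L[ℝ] ℝ).smulRight (vectorOfComponents s₀ (shift e' u ε x s)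
          (ψ (shift e' u ε x s) • u x) : ES m)) := by
      rcases hy with hy | ⟨hy1, hy2⟩
      · have h2 : u x = 0 := image_eq_zero_of_notMem_tsupport hy
        have h5 : (fun ε => shift e' u ε x s) = fun _ => s :=
          funext fun ε => shift_of_eq_zero h2
        rw [h2, smul_zero, map_zero, h5]
        have h6 : (1 : ℝ →L[ℝ] ℝ).smulRight (0 : ES m) = 0 :=
          ContinuousLinearMap.ext fun t => smul_zero t
        exact (hasMFDerivAt_const s ε).congr_mfderiv h6.symm
      · have h1 := hψ _ (hball ε hε x _ hy2)
        have h2 := hasMFDerivAt_shift (u := u) he' hy1 h1.1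
        have h3 : shift e' u ε x s = e'.symm (e' s + ε • u x) := shift_of_mem_source hy1
        have h4 : vectorOfComponents s₀ (shift e' u ε x s) (ψ (shift e' u ε x s) • u x) =
            (mfderiv (𝓡 m) (𝓡 m) e'.symm (e' s + ε • u x) (u x) : ES m) := by
          rw [h3, h1.2, one_smul, vectorOfComponents, ← he'def, e'.right_inv h1.1]
          rfl
        rw [h4]
        exact h2
    have h7 := (hasMFDerivAt_const (I := 𝓘(ℝ, ℝ)) (I' := IX n) x ε).prodMk key
    refine h7.congr_mfderiv ?_
    exact ContinuousLinearMap.ext fun t : ℝ =>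
      Prod.ext (show (0 : EX n) = t • (0 : EX n) from (smul_zero t).symm) rfl

end TestVectorFields

/-! ### Admissible vectors along a section -/

section Equivalence
variable {n m k : ℕ}
  {M : Type*} [TopologicalSpace M] [ChartedSpace (EuclideanSpace ℝ (Fin n)) M]
  [IsManifold (𝓡 n) ∞ M]
  {S : Type*} [TopologicalSpace S] [ChartedSpace (EuclideanSpace ℝ (Fin m)) S]
  [IsManifold (𝓡 m) ∞ S]
  {e : OpenPartialHomeomorph M (EuclideanSpace ℝ (Fin n))}
  {e' : OpenPartialHomeomorph S (EuclideanSpace ℝ (Fin m))}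
  {ηM : (p : M) → TangentSpace (𝓡 n) p [⋀^Fin n]→L[ℝ] ℝ} {L : J1 n m M S → ℝ}
  {C : Constraint n m M S k} {F : ReactionForces C} {U : Set (ℝ × M)} {f : ℝ × M → S}

theorem mfderiv_chartAt_self (s : S) (v : ES m) :
    (mfderiv (𝓡 m) (𝓡 m) (chartAt (EuclideanSpace ℝ (Fin m)) s) s v : ES m) = v :=
  mfderiv_extChartAt_self (I := 𝓡 m) s v

theorem vectorOfComponents_self (s : S) (v : ES m) : vectorOfComponents s s v = v := by
  have h := (isSmoothChart_chartAt (m := m) s).mfderiv_symm_comp (mem_chart_source _ s) v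
  rw [mfderiv_chartAt_self] at h
  exact h

/-- The Euler–Lagrange covector at `x` as a form on the tangent space of `S` at `f x`. In the
preferred chart at `f x` a tangent vector at `f x` is identified with its components. -/
def elCovectorAt (ηM : (p : M) → TangentSpace (𝓡 n) p [⋀^Fin n]→L[ℝ] ℝ) (L : J1 n m M S → ℝ)
    (f : ℝ × M → S) (x : ℝ × M) (w : ES m) : ℝ :=
  elForm ηM L f (chartAt (EuclideanSpace ℝ (Fin n)) x.2) (chartAt (EuclideanSpace ℝ (Fin m)) (f x))
    x w

/-- In arbitrary charts, the Euler–Lagrange expression is the value of the intrinsic covector on the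
vector with the given components. -/
theorem elForm_eq_elCovectorAt [T2Space M] [CompactSpace M] [SecondCountableTopology M]
    (hηM : IsSmoothForm (𝓡 n) ηM) (hηM0 : ∀ p, ηM p ≠ 0)
    (hL : ContMDiff (IJ n m) 𝓘(ℝ, ℝ) ∞ L) (he : IsSmoothChart (𝓡 n) e)
    (he' : IsSmoothChart (𝓡 m) e') {x : ℝ × M}
    (hf : ∀ᶠ x in 𝓝 x, ContMDiffAt (IX n) (𝓡 m) ∞ f x) (h1 : x.2 ∈ e.source)
    (h2 : f x ∈ e'.source) (w : ES m) :
    elForm ηM L f e e' x w =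
      elCovectorAt ηM L f x (mfderiv (𝓡 m) (𝓡 m) e'.symm (e' (f x)) w : ES m) := by
  refine (elForm_coordChange hηM hηM0 hL he he' (isSmoothChart_chartAt x.2)
    (isSmoothChart_chartAt (f x)) hf h1 h2 (mem_chart_source _ _)
    (mem_chart_source _ _) w).symm.trans ?_
  exact congrArg (elForm ηM L f _ _ x) (mfderiv_chartAt_self (f x) _)

/-- The Euler–Lagrange expression at `x` depends only on the germ of the section at `x`. -/
theorem elForm_congr {f₁ : ℝ × M → S} {x : ℝ × M} (h1 : x.2 ∈ e.source) (h : f =ᶠ[𝓝 x] f₁)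
    (w : ES m) : elForm ηM L f e e' x w = elForm ηM L f₁ e e' x w := by
  have h1' : x ∈ (xChart e).source := mem_xChart_source.2 h1
  have hc : ContinuousAt (xChart e).symm (xChart e x) :=
    (xChart e).continuousAt_symm ((xChart e).map_source h1')
  rw [ContinuousAt, (xChart e).left_inv h1'] at hc
  have h2 : fieldInCharts f e e' =ᶠ[𝓝 (xChart e x)] fieldInCharts f₁ e e' := by
    filter_upwards [hc.eventually h] with z hz using congrArg e' hz
  have h3 : modelJet (fieldInCharts f e e') =ᶠ[𝓝 (xChart e x)]
      modelJet (fieldInCharts f₁ e e') := by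
    filter_upwards [h2, h2.fderiv (𝕜 := ℝ)] with z a1 a2
    simp only [modelJet, a1, a2]
  have h4 : ∀ μ : Fin (n + 1), (fun z : EX n => density ηM e z.2 *
      partialA (lagr L e e') (modelJet (fieldInCharts f e e') z) ((dXdual μ).smulRight w))
        =ᶠ[𝓝 (xChart e x)] fun z : EX n => density ηM e z.2 *
      partialA (lagr L e e') (modelJet (fieldInCharts f₁ e e') z) ((dXdual μ).smulRight w) := by
    intro μ
    filter_upwards [h3] with z hz
    rw [hz]
  simp only [elForm, h3.self_of_nhds, (h4 _).fderiv_eq]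

/-- The common content of the three conditions: at each point of `U` the Euler–Lagrange covector
vanishes on the tangent vectors annihilated by the reaction forces. -/
def AnnihilatesAdmissible (ηM : (p : M) → TangentSpace (𝓡 n) p [⋀^Fin n]→L[ℝ] ℝ)
    (L : J1 n m M S → ℝ) (F : ReactionForces C) (U : Set (ℝ × M)) (f : ℝ × M → S) : Prop :=
  ∀ x ∈ U, ∀ w : ES m, (∀ α ∈ F.fibre (jet f x), (α w : ℝ) = 0) → elCovectorAt ηM L f x w = 0

/-- A vector annihilated by a frame is annihilated by all reaction forces. -/
theorem apply_eq_zero_of_isFrameOn {W : Set (J1 n m M S)}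
    {A : Fin k → (γ : J1 n m M S) → (TangentSpace (𝓡 m) γ.proj.2 →L[ℝ] ℝ)}
    (hA : IsFrameOn C.carrier F.fibre W A) {γ : J1 n m M S} (hγ : γ ∈ C.carrier ∩ W) {w : ES m}
    (h : ∀ i, (A i γ w : ℝ) = 0) : ∀ α ∈ F.fibre γ, (α w : ℝ) = 0 := by
  intro α hα
  rw [← (hA.2 γ hγ).2] at hα
  induction hα using Submodule.span_induction with
  | mem α hα =>
    obtain ⟨i, rfl⟩ := hα
    exact h i
  | zero => rfl
  | add α β _ _ h1 h2 => exact (congrArg₂ (· + ·) h1 h2).trans (add_zero 0)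
  | smul c α _ h1 => exact (congrArg (c * ·) h1).trans (mul_zero c)

/-- The components along `j¹φ` of a covector field, in the preferred chart at `s₀`. -/
def componentsAlong (A : (γ : J1 n m M S) → (TangentSpace (𝓡 m) γ.proj.2 →L[ℝ] ℝ))
    (f : ℝ × M → S) (s₀ : S) (x : ℝ × M) : ES m →L[ℝ] ℝ :=
  (A (jet f x) : ES m →L[ℝ] ℝ) ∘L vectorOfComponents s₀ (f x)

theorem componentsAlong_self (A : (γ : J1 n m M S) → (TangentSpace (𝓡 m) γ.proj.2 →L[ℝ] ℝ))
    (x : ℝ × M) : componentsAlong A f (f x) x = (A (jet f x) : ES m →L[ℝ] ℝ) :=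
  ContinuousLinearMap.ext fun w =>
    congrArg (A (jet f x) : ES m →L[ℝ] ℝ) (vectorOfComponents_self (f x) w)

/-- Near a point, the components along `j¹φ` of a local frame are smooth and have a smooth right
inverse `P`. -/
theorem exists_rightInverse_frame (hU : IsOpen U) (hf : ∀ x ∈ U, ContMDiffAt (IX n) (𝓡 m) ∞ f x)
    (hC : ∀ x ∈ U, jet f x ∈ C.carrier) {W : Set (J1 n m M S)}
    {A : Fin k → (γ : J1 n m M S) → (TangentSpace (𝓡 m) γ.proj.2 →L[ℝ] ℝ)}
    (hW : IsOpen W) (hA : IsFrameOn C.carrier F.fibre W A) {x₀ : ℝ × M} (hx₀ : x₀ ∈ U)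
    (hx₀W : jet f x₀ ∈ W) :
    ∃ (O : Set (ℝ × M)) (P : ℝ × M → (Fin k → ℝ) →L[ℝ] ES m), IsOpen O ∧ x₀ ∈ O ∧ O ⊆ U ∧
      ∀ x ∈ O, jet f x ∈ W ∧ f x ∈ (chartAt (EuclideanSpace ℝ (Fin m)) (f x₀)).source ∧
        (∀ i, ContMDiffAt (IX n) 𝓘(ℝ, ES m →L[ℝ] ℝ) ∞ (componentsAlong (A i) f (f x₀)) x) ∧
        ContMDiffAt (IX n) 𝓘(ℝ, (Fin k → ℝ) →L[ℝ] ES m) ∞ P x ∧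
        ∀ c i, componentsAlong (A i) f (f x₀) x (P x c) = c i := by
  have hev : ∀ᶠ x in 𝓝 x₀, x ∈ U ∧ jet f x ∈ W ∧
      f x ∈ (chartAt (EuclideanSpace ℝ (Fin m)) (f x₀)).source :=
    Filter.Eventually.and (hU.mem_nhds hx₀) (Filter.Eventually.and
      ((contMDiffAt_jet (hf x₀ hx₀)).continuousAt.preimage_mem_nhds (hW.mem_nhds hx₀W))
      ((hf x₀ hx₀).continuousAt.preimage_mem_nhds
        ((chartAt (EuclideanSpace ℝ (Fin m)) (f x₀)).open_source.mem_nhds (mem_chart_source _ _))))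
  obtain ⟨O₁, hO₁, hO₁o, hxO₁⟩ := mem_nhds_iff.1 hev
  have hs : ∀ i, ∀ x ∈ O₁, ContMDiffAt (IX n) 𝓘(ℝ, ES m →L[ℝ] ℝ) ∞
      (componentsAlong (A i) f (f x₀)) x := fun i x hx =>
    contMDiffAt_covector_comp (hA.1 i) hO₁o (fun y hy => hf y (hO₁ hy).1)
      (fun y hy => ⟨hC y (hO₁ hy).1, (hO₁ hy).2.1⟩) (fun y hy => (hO₁ hy).2.2) hx
  have hli : LinearIndependent ℝ fun i => componentsAlong (A i) f (f x₀) x₀ := by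
    have h1 : LinearIndependent ℝ fun i => (A i (jet f x₀) : ES m →L[ℝ] ℝ) :=
      (hA.2 (jet f x₀) ⟨hC x₀ hx₀, hx₀W⟩).1
    have h2 : (fun i => componentsAlong (A i) f (f x₀) x₀) =
        fun i => (A i (jet f x₀) : ES m →L[ℝ] ℝ) := funext fun i => componentsAlong_self (A i) x₀
    rw [h2]
    exact h1
  obtain ⟨P, hP⟩ := exists_contMDiffAt_rightInverse (I := IX n) (x₀ := x₀)
    (fun i => by filter_upwards [hO₁o.mem_nhds hxO₁] with x hx using hs i x hx) hli
  obtain ⟨O₂, hO₂, hO₂o, hxO₂⟩ := mem_nhds_iff.1 hP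
  exact ⟨O₁ ∩ O₂, P, hO₁o.inter hO₂o, ⟨hxO₁, hxO₂⟩, fun x hx => (hO₁ hx.1).1, fun x hx =>
    ⟨(hO₁ hx.1).2.1, (hO₁ hx.1).2.2, fun i => hs i x hx.1, (hO₂ hx.2).1, (hO₂ hx.2).2⟩⟩

/-- A tangent vector annihilated by the reaction forces extends to a smooth field of such vectors
along the section. -/
theorem exists_admissible_extension (hU : IsOpen U)
    (hf : ∀ x ∈ U, ContMDiffAt (IX n) (𝓡 m) ∞ f x)
    (hC : ∀ x ∈ U, jet f x ∈ C.carrier) {x₀ : ℝ × M} (hx₀ : x₀ ∈ U) {w : ES m}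
    (hw : ∀ α ∈ F.fibre (jet f x₀), (α w : ℝ) = 0) :
    ∃ (O : Set (ℝ × M)) (v : ℝ × M → ES m), IsOpen O ∧ x₀ ∈ O ∧ O ⊆ U ∧ v x₀ = w ∧
      ∀ x ∈ O, f x ∈ (chartAt (EuclideanSpace ℝ (Fin m)) (f x₀)).source ∧
        ContMDiffAt (IX n) 𝓘(ℝ, ES m) ∞ v x ∧ ∀ α ∈ F.fibre (jet f x),
          (α (vectorOfComponents (f x₀) (f x) (v x) : ES m) : ℝ) = 0 := by
  obtain ⟨W, hW, hx₀W, A, hA⟩ := F.exists_frame (jet f x₀) (hC x₀ hx₀)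
  obtain ⟨O, P, hO, hxO, hOU, H⟩ := exists_rightInverse_frame hU hf hC hW hA hx₀ hx₀W
  let a : ℝ × M → Fin k → ℝ := fun x i => componentsAlong (A i) f (f x₀) x w
  -- at `x₀` the frame vanishes on `w`, so that the corrected vector is `w` itself
  refine ⟨O, fun x => w - P x (a x), hO, hxO, hOU, ?_, fun x hx => ⟨(H x hx).2.1, ?_, ?_⟩⟩
  · have h1 : a x₀ = 0 := by
      funext i
      have h2 : A i (jet f x₀) ∈ F.fibre (jet f x₀) := by
        rw [← (hA.2 (jet f x₀) ⟨hC x₀ hx₀, hx₀W⟩).2]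
        exact Submodule.subset_span ⟨i, rfl⟩
      exact (congrArg (fun T : ES m →L[ℝ] ℝ => T w) (componentsAlong_self (A i) x₀)).trans (hw _ h2)
    change w - P x₀ (a x₀) = w
    rw [h1, map_zero, sub_zero]
  · have ha : ContMDiffAt (IX n) 𝓘(ℝ, Fin k → ℝ) ∞ a x := contMDiffAt_pi_space.2 fun i =>
      ((H x hx).2.2.1 i).clm_apply contMDiffAt_const
    exact contMDiffAt_const.sub ((H x hx).2.2.2.1.clm_apply ha)
  · refine apply_eq_zero_of_isFrameOn hA ⟨hC x (hOU hx), (H x hx).1⟩ fun i => ?_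
    set T : ES m →L[ℝ] ℝ := componentsAlong (A i) f (f x₀) x
    have h1 : T (P x (a x)) = T w := (H x hx).2.2.2.2 (a x) i
    change T (w - P x (a x)) = 0
    rw [map_sub, h1, sub_self]

theorem contMDiffAt_flow {V : (y : (ℝ × M) × S) → TangentSpace (IY n m) y} {N : Set ((ℝ × M) × S)}
    {δ : ℝ} {N' : Set ((ℝ × M) × S)} {Φ : ℝ → (ℝ × M) × S → (ℝ × M) × S}
    (hΦ : IsLocalFlow V N δ N' Φ) {x : ℝ × M} (hf : ContMDiffAt (IX n) (𝓡 m) ∞ f x)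
    (hx : (x, f x) ∈ N') {ε : ℝ} (hε : ε ∈ Ioo (-δ) δ) :
    ContMDiffAt (𝓘(ℝ, ℝ).prod (IX n)) (𝓡 m) ∞
      (fun q : ℝ × (ℝ × M) => (Φ q.1 (q.2, f q.2)).2) (ε, x) := by
  obtain ⟨-, hN', hs, -⟩ := hΦ
  have h1 : ContMDiffAt (𝓘(ℝ, ℝ).prod (IX n)) (𝓘(ℝ, ℝ).prod (IY n m)) ∞
      (fun q : ℝ × (ℝ × M) => (q.1, (q.2, f q.2))) (ε, x) :=
    contMDiffAt_fst.prodMk (contMDiffAt_snd.prodMk (ContMDiffAt.comp (I' := IX n) (ε, x) (g := f)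
      (f := fun q : ℝ × (ℝ × M) => q.2) hf contMDiffAt_snd))
  have h2 : ContMDiffAt (𝓘(ℝ, ℝ).prod (IY n m)) (IY n m) ∞
      (fun q : ℝ × ((ℝ × M) × S) => Φ q.1 q.2) (ε, (x, f x)) :=
    hs.contMDiffAt ((isOpen_Ioo.prod hN').mem_nhds ⟨hε, hx⟩)
  exact contMDiffAt_snd.comp (ε, x) (ContMDiffAt.comp (I' := 𝓘(ℝ, ℝ).prod (IY n m)) (ε, x)
    (g := fun q : ℝ × ((ℝ × M) × S) => Φ q.1 q.2) h2 h1)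

/-- The variation field of a section transported by a flow is the vertical part of the generator. -/
theorem variationField_flow {V : (y : (ℝ × M) × S) → TangentSpace (IY n m) y}
    {N : Set ((ℝ × M) × S)} {δ : ℝ} {N' : Set ((ℝ × M) × S)}
    {Φ : ℝ → (ℝ × M) × S → (ℝ × M) × S} (hΦ : IsLocalFlow V N δ N' Φ) {x : ℝ × M}
    (hx : (x, f x) ∈ N') :
    variationField (m := m) (fun q : ℝ × (ℝ × M) => (Φ q.1 (q.2, f q.2)).2) 0 x =
      (V (x, f x) : EX n × ES m).2 := by
  obtain ⟨hδ, -, -, h⟩ := hΦ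
  obtain ⟨h0, -, hi⟩ := h _ hx
  have h1 : HasMFDerivAt 𝓘(ℝ, ℝ) (IY n m) (fun ε => Φ ε (x, f x)) 0
      ((1 : ℝ →L[ℝ] ℝ).smulRight (V (Φ 0 (x, f x)))) :=
    (hi 0 ⟨neg_lt_zero.2 hδ, hδ⟩).hasMFDerivAt (Ioo_mem_nhds (neg_lt_zero.2 hδ) hδ)
  have h2 := (hasMFDerivAt_snd (I := IX n) (I' := 𝓡 m) (Φ 0 (x, f x))).comp (0 : ℝ) h1
  have h3 := congrArg (fun T : ℝ →L[ℝ] ES m => T 1) h2.mfderiv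
  let V' : (ℝ × M) × S → EX n × ES m := V
  have h4 : V' (Φ 0 (x, f x)) = V' (x, f x) := congrArg V' h0
  refine h3.trans ?_
  change ((1 : ℝ) • V' (Φ 0 (x, f x))).2 = (V' (x, f x)).2
  rw [h4, one_smul]

end Equivalence

/-! ### Stationarity and the contraction of `Ω_L` -/

section MainEquivalences
variable {n m k : ℕ}
  {M : Type*} [TopologicalSpace M] [ChartedSpace (EuclideanSpace ℝ (Fin n)) M]
  [IsManifold (𝓡 n) ∞ M] [T2Space M] [CompactSpace M] [SecondCountableTopology M]
  {S : Type*} [TopologicalSpace S] [ChartedSpace (EuclideanSpace ℝ (Fin m)) S]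
  [IsManifold (𝓡 m) ∞ S]
  {ηM : (p : M) → TangentSpace (𝓡 n) p [⋀^Fin n]→L[ℝ] ℝ} {L : J1 n m M S → ℝ}
  {C : Constraint n m M S k} {F : ReactionForces C} {U : Set (ℝ × M)} {f : ℝ × M → S}

/-- A field `v`, smooth on the support of a bump function `χ`, gives a smooth field `χ v`. -/
theorem contMDiff_bump_smul {x₀ : ℝ × M} (χ : SmoothBumpFunction (IX n) x₀) {v : ℝ × M → ES m}
    (hv : ∀ x ∈ tsupport χ, ContMDiffAt (IX n) 𝓘(ℝ, ES m) ∞ v x) :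
    ContMDiff (IX n) 𝓘(ℝ, ES m) ∞ fun x => χ x • v x := by
  intro x
  by_cases hx : x ∈ tsupport χ
  · exact χ.contMDiff.contMDiffAt.smul (hv x hx)
  · refine (contMDiffAt_const (c := (0 : ES m))).congr_of_eventuallyEq ?_
    filter_upwards [(isClosed_tsupport χ).isOpen_compl.mem_nhds hx] with y hy
    rw [image_eq_zero_of_notMem_tsupport hy, zero_smul]

/-- A test field built from admissible vectors is an admissible variation, along the whole
section. -/
theorem prolong_testField_mem_annihilator {χ : ℝ × M → ℝ} {ψ : S → ℝ}
    {v : ℝ × M → ES m} {s₀ : S} (hv : ∀ x ∈ tsupport χ, ∀ α ∈ F.fibre (jet f x),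
      (α (vectorOfComponents s₀ (f x) (v x) : ES m) : ℝ) = 0) (x : ℝ × M) :
    prolong (testField (n := n) s₀ ψ fun x => χ x • v x) (jet f x) ∈ F.annihilator (jet f x) := by
  rw [prolong_mem_annihilator_iff]
  intro α hα
  let T : ES m →L[ℝ] ℝ := (α : ES m →L[ℝ] ℝ) ∘L vectorOfComponents s₀ (f x)
  change T (ψ (f x) • χ x • v x) = 0
  by_cases hx : x ∈ tsupport χ
  · have h1 : T (v x) = 0 := hv x hx α hα
    rw [map_smul, map_smul, h1, smul_zero, smul_zero]
  · rw [image_eq_zero_of_notMem_tsupport hx, zero_smul, smul_zero, map_zero]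

/-- The contraction of `Ω_L` with the prolongation of a vertical field, on the coordinate vectors.
-/
theorem pullbackContraction_prolong (hηM : IsSmoothForm (𝓡 n) ηM) (hηM0 : ∀ p, ηM p ≠ 0)
    (hL : ContMDiff (IJ n m) 𝓘(ℝ, ℝ) ∞ L) {x : ℝ × M} (hf : ContMDiffAt (IX n) (𝓡 m) ∞ f x)
    {V : (y : (ℝ × M) × S) → TangentSpace (IY n m) y} (hV : (V (x, f x) : EX n × ES m).1 = 0) :
    pullbackContraction ηM L f (prolong V) x dX =
      -(elCovectorAt ηM L f x (V (x, f x) : EX n × ES m).2 *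
        density ηM (chartAt (EuclideanSpace ℝ (Fin n)) x.2)
          (chartAt (EuclideanSpace ℝ (Fin n)) x.2 x.2)) := by
  let W : EJ n m := prolong V (jet f x)
  have hW : W = (((0, (V (x, f x) : EX n × ES m).2), W.2) : EJ n m) :=
    Prod.ext (Prod.ext hV rfl) rfl
  exact pullbackContraction_apply_dX hηM hηM0 hL hf (prolong V) _ W.2 hW

/-- A form of top degree on `X` vanishes if it vanishes on the coordinate vectors, where the
contraction is computed by `pullbackContraction_prolong`. -/
theorem satisfiesIntrinsic_of_annihilatesAdmissible (hηM : IsSmoothForm (𝓡 n) ηM)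
    (hηM0 : ∀ p, ηM p ≠ 0) (hL : ContMDiff (IJ n m) 𝓘(ℝ, ℝ) ∞ L)
    (hf : ∀ x ∈ U, ContMDiffAt (IX n) (𝓡 m) ∞ f x) (h : AnnihilatesAdmissible ηM L F U f) :
    SatisfiesIntrinsic ηM L F U f := by
  intro V hV hVF x hx
  have h1 := pullbackContraction_prolong hηM hηM0 hL (hf x hx) (hV.fst_eq_zero (mem_univ (x, f x)))
  have h2 : elCovectorAt ηM L f x (V (x, f x) : EX n × ES m).2 = 0 :=
    h x hx _ ((prolong_mem_annihilator_iff F V _).1 (hVF x hx))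
  rw [h2, zero_mul, neg_zero] at h1
  exact topForm_ext h1

/-- The test field through a given admissible vector at `x₀` detects the Euler–Lagrange covector
there, as the density of the volume form is not zero. -/
theorem annihilatesAdmissible_of_satisfiesIntrinsic [T2Space S] (hηM : IsSmoothForm (𝓡 n) ηM)
    (hηM0 : ∀ p, ηM p ≠ 0) (hL : ContMDiff (IJ n m) 𝓘(ℝ, ℝ) ∞ L) (hU : IsOpen U)
    (hf : ∀ x ∈ U, ContMDiffAt (IX n) (𝓡 m) ∞ f x) (hC : ∀ x ∈ U, jet f x ∈ C.carrier)
    (h : SatisfiesIntrinsic ηM L F U f) : AnnihilatesAdmissible ηM L F U f := by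
  intro x₀ hx₀ w hw
  obtain ⟨O, v, hO, hxO, hOU, hvw, hv⟩ := exists_admissible_extension hU hf hC hx₀ hw
  obtain ⟨χ, -, hχ⟩ := (SmoothBumpFunction.nhds_basis_tsupport (I := IX n) x₀).mem_iff.1
    (hO.mem_nhds hxO)
  let ψ : SmoothBumpFunction (𝓡 m) (f x₀) := Classical.arbitrary _
  have hu := contMDiff_bump_smul χ (fun x hx => (hv x (hχ hx)).2.1)
  have h1 := h (testField (f x₀) ψ fun x => χ x • v x) (isVerticalOn_testField ψ hu)
    (fun x _ => prolong_testField_mem_annihilator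
      (fun x hx => (hv x (hχ hx)).2.2) x) x₀ hx₀
  have h2 := pullbackContraction_prolong (V := testField (f x₀) ψ fun x => χ x • v x) hηM hηM0 hL
    (hf x₀ hx₀) rfl
  have h3 : ((testField (n := n) (f x₀) ψ (fun x => χ x • v x) (x₀, f x₀) :
      EX n × ES m).2) = w := by
    change vectorOfComponents (f x₀) (f x₀) (ψ (f x₀) • χ x₀ • v x₀) = w
    rw [vectorOfComponents_self, ψ.eq_one, χ.eq_one, one_smul, one_smul, hvw]
  rw [h1, h3] at h2
  have h4 := neg_eq_zero.1 h2.symm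
  exact (mul_eq_zero.1 h4).resolve_right (density_ne_zero hηM0 (isSmoothChart_chartAt x₀.2)
    ((chartAt (EuclideanSpace ℝ (Fin n)) x₀.2).map_source (mem_chart_source _ _)))

/-- The variation field of the transported section is the given vertical field, whose values are
admissible; hence the first variation vanishes. -/
theorem isStationary_of_annihilatesAdmissible [MeasurableSpace M] [BorelSpace M]
    (hηM : IsSmoothForm (𝓡 n) ηM)
    (hηM0 : ∀ p, ηM p ≠ 0) (hL : ContMDiff (IJ n m) 𝓘(ℝ, ℝ) ∞ L) (hU : IsOpen U)
    (hUc : IsCompact (closure U)) (hf : ∀ x ∈ closure U, ContMDiffAt (IX n) (𝓡 m) ∞ f x)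
    (h : AnnihilatesAdmissible ηM L F U f) : IsStationary ηM L F U f := by
  intro N V hN hUN hV hV0 hVF δ N' Φ hΦ hUN'
  set g : ℝ × (ℝ × M) → S := fun q => (Φ q.1 (q.2, f q.2)).2 with hg
  have hδ : 0 < δ := hΦ.1
  have hgs : ∀ ε ∈ Ioo (-δ) δ, ∀ x ∈ closure U,
      ContMDiffAt (𝓘(ℝ, ℝ).prod (IX n)) (𝓡 m) ∞ g (ε, x) := fun ε hε x hx =>
    contMDiffAt_flow hΦ (hf x hx) (hUN' x hx) hε
  have hvf : ∀ x ∈ closure U, variationField (m := m) g 0 x = (V (x, f x) : EX n × ES m).2 :=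
    fun x hx => variationField_flow hΦ (hUN' x hx)
  have hg0 : ∀ x ∈ closure U, g (0, x) = f x := fun x hx =>
    congrArg Prod.snd (hΦ.2.2.2 _ (hUN' x hx)).1
  have h0 : (0 : ℝ) ∈ Ioo (-δ) δ := ⟨neg_lt_zero.2 hδ, hδ⟩
  have hd := (hasDerivAt_action hηM hL hU hUc hδ hgs).2
  rw [integral_lagrangianVariation_eq_zero hηM hηM0 hL hU hUc (hgs 0 h0) (fun x hx => ?_)
    (fun x hx p s hp hs => ?_)] at hd
  · exact hd
  · rw [hvf x (frontier_subset_closure hx)]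
    exact congrArg (fun v : EX n × ES m => v.2) (hV0 x hx)
  -- the flow is the identity at `ε = 0` only on its domain, which contains `φ(closure U)`; thus
  -- `g (0, ·)` and `f` are compared as germs at points of `U`
  · have hge : (fun x => g (0, x)) =ᶠ[𝓝 x] f := by
      filter_upwards [hU.mem_nhds hx] with y hy using hg0 y (subset_closure hy)
    have hfe : ∀ᶠ y in 𝓝 x, ContMDiffAt (IX n) (𝓡 m) ∞ f y := by
      filter_upwards [hU.mem_nhds hx] with y hy using hf y (subset_closure hy)
    have hx0 := hg0 x (subset_closure hx)
    have hs' : f x ∈ (chartAt (EuclideanSpace ℝ (Fin m)) s).source := by rwa [← hx0]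
    refine (elForm_congr hp hge _).trans ?_
    have he' := isSmoothChart_chartAt (m := m) s
    refine (elForm_eq_elCovectorAt hηM hηM0 hL (isSmoothChart_chartAt p) he' hfe hp hs' _).trans ?_
    let T : S → ES m →L[ℝ] ES m := fun s' =>
      mfderiv (𝓡 m) (𝓡 m) (chartAt (EuclideanSpace ℝ (Fin m)) s) s'
    let w : ES m := variationField (m := m) g 0 x
    have h1 : T (g (0, x)) w = T (f x) w := congrArg (fun s' => T s' w) hx0
    have h2 : (mfderiv (𝓡 m) (𝓡 m) (chartAt (EuclideanSpace ℝ (Fin m)) s).symm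
        (chartAt (EuclideanSpace ℝ (Fin m)) s (f x)) (T (g (0, x)) w) : ES m) = w := by
      rw [h1]
      exact he'.mfderiv_symm_comp hs' w
    refine (congrArg (elCovectorAt ηM L f x) h2).trans (h x hx w ?_)
    intro α hα
    exact (congrArg (α : ES m →L[ℝ] ℝ) (hvf x (subset_closure hx))).trans
      ((prolong_mem_annihilator_iff F V _).1 (hVF x hx) α hα)

set_option maxHeartbeats 1000000 in
/-- If the Euler–Lagrange covector did not vanish on an admissible vector at `x₀`, the first
variation of the action along the flow of a test field concentrated near `x₀` would not be zero.
-/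
theorem annihilatesAdmissible_of_isStationary [T2Space S] [MeasurableSpace M] [BorelSpace M]
    (hηM : IsSmoothForm (𝓡 n) ηM)
    (hηM0 : ∀ p, ηM p ≠ 0) (hL : ContMDiff (IJ n m) 𝓘(ℝ, ℝ) ∞ L) (hU : IsOpen U)
    (hUc : IsCompact (closure U)) (hf : ∀ x ∈ closure U, ContMDiffAt (IX n) (𝓡 m) ∞ f x)
    (hC : ∀ x ∈ U, jet f x ∈ C.carrier)
    (h : IsStationary ηM L F U f) : AnnihilatesAdmissible ηM L F U f := by
  intro x₀ hx₀ w hw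
  by_contra hne
  have hfU : ∀ x ∈ U, ContMDiffAt (IX n) (𝓡 m) ∞ f x := fun x hx => hf x (subset_closure hx)
  obtain ⟨O, v, hO, hxO, hOU, hvw, hv⟩ := exists_admissible_extension hU hfU hC hx₀ hw
  set e := chartAt (EuclideanSpace ℝ (Fin n)) x₀.2
  set e' := chartAt (EuclideanSpace ℝ (Fin m)) (f x₀) with he'def
  have he : IsSmoothChart (𝓡 n) e := isSmoothChart_chartAt _
  have he' : IsSmoothChart (𝓡 m) e' := isSmoothChart_chartAt _
  let ψ : SmoothBumpFunction (𝓡 m) (f x₀) := Classical.arbitrary _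
  -- a ball in the chart at `f x₀` on which the cut-off function is equal to one
  obtain ⟨r, hr, hψ⟩ : ∃ r > 0, ∀ y ∈ Metric.ball (e' (f x₀)) (2 * r),
      y ∈ e'.target ∧ ψ (e'.symm y) = 1 := by
    have ht := e'.map_source (mem_chart_source _ (f x₀))
    have hc := e'.continuousAt_symm ht
    rw [ContinuousAt, e'.left_inv (mem_chart_source _ (f x₀))] at hc
    have hev : ∀ᶠ y in 𝓝 (e' (f x₀)), y ∈ e'.target ∧ ψ (e'.symm y) = 1 :=
      Filter.Eventually.and (e'.open_target.mem_nhds ht) (hc.eventually ψ.eventuallyEq_one)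
    obtain ⟨R, hR, H⟩ := Metric.mem_nhds_iff.1 hev
    exact ⟨R / 2, by positivity, fun y hy => H (by rwa [mul_div_cancel₀ _ two_ne_zero] at hy)⟩
  set U₁ := O ∩ (xChart e).source with hU₁
  have hU₁o : IsOpen U₁ := hO.inter (xChart e).open_source
  have hxU₁ : x₀ ∈ U₁ := ⟨hxO, mem_xChart_source.2 (mem_chart_source _ _)⟩
  have hE : ContinuousOn (fun x => elForm ηM L f e e' x (v x)) U₁ := fun x hx =>
    (continuousAt_elForm hηM hηM0 hL he he' (by
      filter_upwards [hO.mem_nhds hx.1] with y hy using hfU y (hOU hy)) (mem_xChart_source.1 hx.2)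
      (hv x hx.1).1 (hv x hx.1).2.1.continuousAt).continuousWithinAt
  obtain ⟨O₂, hO₂, hO₂U, H⟩ := exists_nhds_setIntegral_bump_mul_ne_zero hηM hηM0 he hU₁o
    inter_subset_right hxU₁ hE (by rw [hvw]; exact hne)
  -- over the support of `χ` the section stays in the ball where the flow is defined
  have hO₃ : O₂ ∩ f ⁻¹' (e'.source ∩ e' ⁻¹' Metric.ball (e' (f x₀)) r) ∈ 𝓝 x₀ :=
    Filter.inter_mem hO₂ ((hfU x₀ hx₀).continuousAt.preimage_mem_nhds
      ((e'.isOpen_inter_preimage Metric.isOpen_ball).mem_nhds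
        ⟨mem_chart_source _ _, Metric.mem_ball_self hr⟩))
  obtain ⟨χ, -, hχ⟩ := (SmoothBumpFunction.nhds_basis_tsupport (I := IX n) x₀).mem_iff.1 hO₃
  have hχU₁ : tsupport χ ⊆ U₁ := fun x hx => hO₂U (hχ hx).1
  have hχU : tsupport χ ⊆ U := fun x hx => hOU (hχU₁ hx).1
  refine H χ (fun x hx => (hχ hx).1) ?_
  let u : ℝ × M → ES m := fun x => χ x • v x
  have hut : tsupport u ⊆ tsupport χ := closure_mono fun x hx => left_ne_zero_of_smul hx
  have huc : HasCompactSupport u := χ.hasCompactSupport.smul_right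
  have hu : ContMDiff (IX n) 𝓘(ℝ, ES m) ∞ u :=
    contMDiff_bump_smul χ fun x hx => (hv x (hχU₁ hx).1).2.1
  obtain ⟨δ, hΦ⟩ := exists_isLocalFlow_testField (n := n) (M := M) hr hψ hu huc
  set N' : Set ((ℝ × M) × S) := {y | y.1 ∉ tsupport u} ∪ {y | y.2 ∈ e'.source ∧
        e' y.2 ∈ Metric.ball (e' (f x₀)) r} with hN'
  have hUN' : ∀ x ∈ closure U, (x, f x) ∈ N' := fun x _ => by
    by_cases hx : x ∈ tsupport u
    · exact Or.inr (hχ (hut hx)).2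
    · exact Or.inl hx
  have hst := h univ (testField (f x₀) ψ u) isOpen_univ (fun _ _ => mem_univ _)
    (isVerticalOn_testField ψ hu) (fun x hx => by
      -- the support of `u` is a closed subset of the open set `U` and does not meet its frontier
      have h1 : u x = 0 := by
        refine image_eq_zero_of_notMem_tsupport fun h2 => ?_
        exact hU.inter_frontier_eq.le ⟨hχU (hut h2), hx⟩
      have h2 : vectorOfComponents (f x₀) (f x) (ψ (f x) • u x) = 0 := by
        rw [h1, smul_zero, map_zero]
      exact Prod.ext rfl h2)
    (fun x _ => prolong_testField_mem_annihilator
      (fun x hx => (hv x (hχU₁ hx).1).2.2) x) δ N' _ hΦ hUN'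
  have hd := (hasDerivAt_action hηM hL hU hUc hΦ.1
    (g := fun q => shift e' u q.1 q.2 (f q.2)) (fun ε hε x hx =>
      contMDiffAt_flow hΦ (hf x hx) (hUN' x hx) hε)).2
  have h0 := hd.unique hst
  rw [integral_lagrangianVariation_shift hηM hηM0 hL he he' he' hU huc (hut.trans hχU)
    (fun x hx => (hχU₁ (hut hx)).2) (fun x _ => hu.contMDiffAt)
    (fun x hx => hfU x (hχU (hut hx))) (fun x hx => (hv x (hχU₁ (hut hx)).1).1)
    (fun x hx => (hv x (hχU₁ (hut hx)).1).1)] at h0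
  rw [← h0]
  have hsub : U₁ ⊆ U ∩ (xChart e).source := inter_subset_inter_left _ hOU
  refine Eq.trans ?_ (setIntegral_eq_of_subset_of_forall_sdiff_eq_zero
    (hU.inter (xChart e).open_source).measurableSet hsub fun x hx => ?_).symm
  · refine setIntegral_congr_fun hU₁o.measurableSet fun x hx => ?_
    have hs : f x ∈ e'.source := (hv x hx.1).1
    have h5 := he'.mfderiv_comp_symm (e'.map_source hs) (u x)
    rw [e'.left_inv hs] at h5
    refine Eq.trans ?_ (congrArg (elForm ηM L f e e' x) h5).symm
    exact (elForm_smul hηM hL he he' (hfU x (hOU hx.1)) (mem_xChart_source.1 hx.2) hs _ _).symm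
  · have hux : u x = 0 := image_eq_zero_of_notMem_tsupport fun h2 => hx.2 (hχU₁ (hut h2))
    let T : ES m →L[ℝ] ES m := (mfderiv (𝓡 m) (𝓡 m) e' (f x) : ES m →L[ℝ] ES m) ∘L
      (mfderiv (𝓡 m) (𝓡 m) e'.symm (e' (f x)) : ES m →L[ℝ] ES m)
    have h6 : T (u x) = 0 := by rw [hux, map_zero]
    exact (congrArg (elForm ηM L f e e' x) h6).trans (elForm_zero x)

end MainEquivalences

/-! ### The multipliers -/

section EulerLagrange
variable {n m k : ℕ}
  {M : Type*} [TopologicalSpace M] [ChartedSpace (EuclideanSpace ℝ (Fin n)) M]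
  [IsManifold (𝓡 n) ∞ M] [T2Space M] [CompactSpace M] [SecondCountableTopology M]
  {S : Type*} [TopologicalSpace S] [ChartedSpace (EuclideanSpace ℝ (Fin m)) S]
  [IsManifold (𝓡 m) ∞ S]
  {ηM : (p : M) → TangentSpace (𝓡 n) p [⋀^Fin n]→L[ℝ] ℝ} {L : J1 n m M S → ℝ}
  {C : Constraint n m M S k} {F : ReactionForces C} {U : Set (ℝ × M)} {f : ℝ × M → S}

/-- Around each point of `j¹φ(U)` there is a frame, and the equations express the Euler–Lagrange
covector as a combination of it. -/
theorem annihilatesAdmissible_of_satisfiesEL (hηM : IsSmoothForm (𝓡 n) ηM)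
    (hL : ContMDiff (IJ n m) 𝓘(ℝ, ℝ) ∞ L)
    (hf : ∀ x ∈ U, ContMDiffAt (IX n) (𝓡 m) ∞ f x) (hC : ∀ x ∈ U, jet f x ∈ C.carrier)
    (h : SatisfiesEL ηM L F U f) : AnnihilatesAdmissible ηM L F U f := by
  intro x hx w hw
  obtain ⟨W, hW, hxW, A, hA⟩ := F.exists_frame (jet f x) (hC x hx)
  obtain ⟨lam, -, hlam⟩ := h.1 W A hW hA
  have h1 := hlam _ (IsManifold.chart_mem_maximalAtlas x.2) _
    (IsManifold.chart_mem_maximalAtlas (f x)) x hx hxW (mem_chart_source _ _) (mem_chart_source _ _)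
  rw [elCovectorAt, elForm_eq_sum hηM hL (isSmoothChart_chartAt x.2) (isSmoothChart_chartAt (f x))
    (hf x hx) (mem_chart_source _ _) (mem_chart_source _ _)]
  let T : Fin k → ES m →L[ℝ] ℝ := fun i => componentsAlong (A i) f (f x) x
  have h2 : ∀ a, eulerLagrange ηM L f (chartAt (EuclideanSpace ℝ (Fin n)) x.2)
      (chartAt (EuclideanSpace ℝ (Fin m)) (f x)) x a =
        ∑ i, lam i x * T i (EuclideanSpace.single a 1) := h1
  have h3 : ∀ i, T i w = 0 := fun i => by
    have h4 : A i (jet f x) ∈ F.fibre (jet f x) := by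
      rw [← (hA.2 (jet f x) ⟨hC x hx, hxW⟩).2]
      exact Submodule.subset_span ⟨i, rfl⟩
    exact (congrArg (fun T : ES m →L[ℝ] ℝ => T w) (componentsAlong_self (A i) x)).trans (hw _ h4)
  have h5 : w = ∑ a, w a • EuclideanSpace.single a (1 : ℝ) := by
    ext b
    simp [Finset.sum_apply, Pi.single_apply]
  calc ∑ a, w a * eulerLagrange ηM L f (chartAt (EuclideanSpace ℝ (Fin n)) x.2)
        (chartAt (EuclideanSpace ℝ (Fin m)) (f x)) x a
      = ∑ i, lam i x * T i (∑ a, w a • EuclideanSpace.single a (1 : ℝ)) := by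
        simp only [h2, map_sum, map_smul, smul_eq_mul, Finset.mul_sum]
        rw [Finset.sum_comm]
        exact Finset.sum_congr rfl fun i _ => Finset.sum_congr rfl fun a _ => by ring
    _ = 0 := by
        rw [← h5]
        exact Finset.sum_eq_zero fun i _ => by rw [h3, mul_zero]

/-- At each point of the domain of a frame, the Euler–Lagrange covector is a linear combination of
the frame. The coefficients are unique, so that the values of the covector on the columns of a
smooth right inverse of the frame show that they are smooth. -/
theorem exists_multipliers (hηM : IsSmoothForm (𝓡 n) ηM) (hηM0 : ∀ p, ηM p ≠ 0)
    (hL : ContMDiff (IJ n m) 𝓘(ℝ, ℝ) ∞ L) (hU : IsOpen U)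
    (hf : ∀ x ∈ U, ContMDiffAt (IX n) (𝓡 m) ∞ f x) (hC : ∀ x ∈ U, jet f x ∈ C.carrier)
    (h : AnnihilatesAdmissible ηM L F U f) {W : Set (J1 n m M S)}
    {A : Fin k → (γ : J1 n m M S) → (TangentSpace (𝓡 m) γ.proj.2 →L[ℝ] ℝ)}
    (hW : IsOpen W) (hA : IsFrameOn C.carrier F.fibre W A) :
    ∃ lam : Fin k → ℝ × M → ℝ,
      (∀ i, ContMDiffOn (IX n) 𝓘(ℝ, ℝ) ∞ (lam i) {x ∈ U | jet f x ∈ W}) ∧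
      ∀ x ∈ U, jet f x ∈ W → ∀ w : ES m,
        elCovectorAt ηM L f x w = ∑ i, lam i x * (A i (jet f x) w : ℝ) := by
  have hfe : ∀ x ∈ U, ∀ᶠ y in 𝓝 x, ContMDiffAt (IX n) (𝓡 m) ∞ f y := fun x hx => by
    filter_upwards [hU.mem_nhds hx] with y hy using hf y hy
  -- existence of the multipliers at a point
  have hex : ∀ x : ℝ × M, ∃ c : Fin k → ℝ, x ∈ U → jet f x ∈ W → ∀ w : ES m,
      elCovectorAt ηM L f x w = ∑ i, c i * (A i (jet f x) w : ℝ) := by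
    intro x
    by_cases hx : x ∈ U ∧ jet f x ∈ W
    swap
    · exact ⟨0, fun h1 h2 => absurd ⟨h1, h2⟩ hx⟩
    obtain ⟨O, P, -, hxO, -, H⟩ := exists_rightInverse_frame hU hf hC hW hA hx.1 hx.2
    let T : Fin k → ES m →L[ℝ] ℝ := fun i => A i (jet f x)
    let E : ES m →L[ℝ] ℝ := elCovector ηM L f (chartAt (EuclideanSpace ℝ (Fin n)) x.2)
      (chartAt (EuclideanSpace ℝ (Fin m)) (f x))
      (xChart (chartAt (EuclideanSpace ℝ (Fin n)) x.2) x)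
    have hE : ∀ w, elCovectorAt ηM L f x w = E w := elForm_eq_elCovector hηM hL
      (isSmoothChart_chartAt x.2) (isSmoothChart_chartAt (f x)) (hf x hx.1) (mem_chart_source _ _)
      (mem_chart_source _ _)
    have hT : ∀ c i, T i (P x c) = c i := fun c i =>
      (congrArg (fun T : ES m →L[ℝ] ℝ => T (P x c)) (componentsAlong_self (A i) x)).symm.trans
        ((H x hxO).2.2.2.2 c i)
    refine ⟨fun i => E (P x (Pi.single i 1)), fun _ _ w => ?_⟩
    -- `w` minus the image under the right inverse of its frame components is admissible
    have h1 : E (w - P x fun i => T i w) = 0 := by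
      rw [← hE]
      refine h x hx.1 _ (apply_eq_zero_of_isFrameOn hA ⟨hC x hx.1, hx.2⟩ fun i => ?_)
      change T i (w - P x fun i => T i w) = 0
      rw [map_sub, hT, sub_self]
    rw [map_sub, sub_eq_zero] at h1
    have h2 : (fun i => T i w) = ∑ i, T i w • (Pi.single i 1 : Fin k → ℝ) := by
      ext j
      simp [Finset.sum_apply, Pi.single_apply]
    rw [hE, h1, h2, map_sum, map_sum]
    refine Finset.sum_congr rfl fun i _ => ?_
    rw [map_smul, map_smul, smul_eq_mul, mul_comm]
    rfl
  choose c hc using hex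
  refine ⟨fun i x => c x i, fun i x₀ hx₀ => ?_, fun x hx hxW => hc x hx hxW⟩
  -- near a point, the multipliers are the values of the covector on the right inverse of the frame
  obtain ⟨O, P, hO, hxO, hOU, H⟩ := exists_rightInverse_frame hU hf hC hW hA hx₀.1 hx₀.2
  set e := chartAt (EuclideanSpace ℝ (Fin n)) x₀.2
  set e' := chartAt (EuclideanSpace ℝ (Fin m)) (f x₀)
  have he : IsSmoothChart (𝓡 n) e := isSmoothChart_chartAt _
  have he' : IsSmoothChart (𝓡 m) e' := isSmoothChart_chartAt _
  have hxe : x₀ ∈ (xChart e).source := mem_xChart_source.2 (mem_chart_source _ _)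
  have hl : (xChart e).symm (xChart e x₀) = x₀ := (xChart e).left_inv hxe
  have hs : ContMDiffAt (IX n) 𝓘(ℝ, ℝ) ∞ (fun x =>
      elCovector ηM L f e e' (xChart e x) (P x (Pi.single i 1))) x₀ := by
    have h1 : ContMDiffAt (IX n) 𝓘(ℝ, ES m →L[ℝ] ℝ) ∞
        (fun x => elCovector ηM L f e e' (xChart e x)) x₀ :=
      ContMDiffAt.comp (I' := 𝓘(ℝ, EX n)) x₀ (g := elCovector ηM L f e e') (f := xChart e)
        (contDiffAt_elCovector hηM hηM0 hL he he' ((xChart e).map_source hxe)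
          (by rw [hl]; exact hf x₀ hx₀.1) (by rw [hl]; exact mem_chart_source _ _)).contMDiffAt
        ((isSmoothChart_xChart he).contMDiffAt hxe)
    exact h1.clm_apply ((H x₀ hxO).2.2.2.1.clm_apply contMDiffAt_const)
  refine (hs.congr_of_eventuallyEq ?_).contMDiffWithinAt
  filter_upwards [hO.mem_nhds hxO, (xChart e).open_source.mem_nhds hxe] with x hx hxs
  have hxU := hOU hx
  let T : Fin k → ES m →L[ℝ] ℝ := fun j => componentsAlong (A j) f (f x₀) x
  have h2 : elForm ηM L f e e' x (P x (Pi.single i 1)) =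
      ∑ j, c x j * T j (P x (Pi.single i 1)) :=
    (elForm_eq_elCovectorAt hηM hηM0 hL he he' (hfe x hxU) (mem_xChart_source.1 hxs) (H x hx).2.1
      _).trans (hc x hxU (H x hx).1 _)
  have h3 : ∀ j, T j (P x (Pi.single i 1)) = (Pi.single i 1 : Fin k → ℝ) j := fun j =>
    (H x hx).2.2.2.2 _ j
  rw [← elForm_eq_elCovector hηM hL he he' (hf x hxU) (mem_xChart_source.1 hxs) (H x hx).2.1, h2]
  simp [h3, Pi.single_apply]

/-- The multipliers of the intrinsic covector serve for all charts simultaneously. -/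
theorem satisfiesEL_of_annihilatesAdmissible (hηM : IsSmoothForm (𝓡 n) ηM)
    (hηM0 : ∀ p, ηM p ≠ 0) (hL : ContMDiff (IJ n m) 𝓘(ℝ, ℝ) ∞ L) (hU : IsOpen U)
    (hf : ∀ x ∈ U, ContMDiffAt (IX n) (𝓡 m) ∞ f x) (hC : ∀ x ∈ U, jet f x ∈ C.carrier)
    (h : AnnihilatesAdmissible ηM L F U f) : SatisfiesEL ηM L F U f := by
  refine ⟨fun W A hW hA => ?_, hC⟩
  obtain ⟨lam, hs, hlam⟩ := exists_multipliers hηM hηM0 hL hU hf hC h hW hA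
  refine ⟨lam, hs, fun e he e' he' x hx hxW h1 h2 a => ?_⟩
  have hfe : ∀ᶠ y in 𝓝 x, ContMDiffAt (IX n) (𝓡 m) ∞ f y := by
    filter_upwards [hU.mem_nhds hx] with y hy using hf y hy
  rw [eulerLagrange_eq_elForm]
  exact (elForm_eq_elCovectorAt hηM hηM0 hL (isSmoothChart_of_mem_maximalAtlas he)
    (isSmoothChart_of_mem_maximalAtlas he') hfe h1 h2 _).trans (hlam x hx hxW _)

end EulerLagrange

end NonholonomicFieldTheory

end

open NonholonomicFieldTheory in
theorem mainTheorem1 {n m k : ℕ}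
    {M : Type*} [TopologicalSpace M] [ChartedSpace (EuclideanSpace ℝ (Fin n)) M]
    [IsManifold (𝓡 n) ∞ M] [T2Space M] [CompactSpace M] [MeasurableSpace M] [BorelSpace M]
    {S : Type*} [TopologicalSpace S] [ChartedSpace (EuclideanSpace ℝ (Fin m)) S]
    [IsManifold (𝓡 m) ∞ S] [T2Space S] [SecondCountableTopology S]
    -- the volume form of `M`
    (ηM : (p : M) → TangentSpace (𝓡 n) p [⋀^Fin n]→L[ℝ] ℝ)
    (hηM : IsSmoothForm (𝓡 n) ηM) (hηM0 : ∀ p, ηM p ≠ 0)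
    -- the Lagrangian, the constraint submanifold, the bundle of reaction forces
    (L : J1 n m M S → ℝ) (hL : ContMDiff (IJ n m) 𝓘(ℝ, ℝ) ∞ L)
    (C : Constraint n m M S k) (F : ReactionForces C)
    -- a section `x ↦ (x, f x)`, smooth on a neighbourhood `D` of the closure of `U`
    (U D : Set (ℝ × M)) (hU : IsOpen U) (hUc : IsCompact (closure U))
    (hD : IsOpen D) (hUD : closure U ⊆ D)
    (f : ℝ × M → S) (hf : ContMDiffOn (IX n) (𝓡 m) ∞ f D)
    (hC : ∀ x ∈ U, jet f x ∈ C.carrier) :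
    List.TFAE [IsStationary ηM L F U f, SatisfiesEL ηM L F U f,
      SatisfiesIntrinsic ηM L F U f] := by
  have : SecondCountableTopology M :=
    ChartedSpace.secondCountable_of_sigmaCompact (EuclideanSpace ℝ (Fin n)) M
  have hfc : ∀ x ∈ closure U, ContMDiffAt (IX n) (𝓡 m) ∞ f x := fun x hx =>
    hf.contMDiffAt (hD.mem_nhds (hUD hx))
  have hfU : ∀ x ∈ U, ContMDiffAt (IX n) (𝓡 m) ∞ f x := fun x hx => hfc x (subset_closure hx)
  tfae_have 1 → 2 := fun h => satisfiesEL_of_annihilatesAdmissible hηM hηM0 hL hU hfU hC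
    (annihilatesAdmissible_of_isStationary hηM hηM0 hL hU hUc hfc hC h)
  tfae_have 2 → 3 := fun h => satisfiesIntrinsic_of_annihilatesAdmissible hηM hηM0 hL hfU
    (annihilatesAdmissible_of_satisfiesEL hηM hL hfU hC h)
  tfae_have 3 → 1 := fun h => isStationary_of_annihilatesAdmissible hηM hηM0 hL hU hUc hfc
    (annihilatesAdmissible_of_satisfiesIntrinsic hηM hηM0 hL hU hfU hC h)
  tfae_finish
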